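/- Consider $n$ hard balls of radius $1$ and equal masses in $\mathbb{R}^d$ with disjoint interiors, with centers $x_1(t),\dots,x_n(t)$, $t\ge 0$. The velocity of each ball is constant except at times when it touches another ball; when exactly two balls $i,j$ touch each other (and neither touches a third ball) at time $t$, their velocities change according to the law of elastic collisions, $v_i(t)=v_i(t-)-P_{x_i(t)-x_j(t)}\big(v_i(t-)-v_j(t-)\big)$ and symmetrically for $j$, where $P_wz=(z\cdot w)w/|w|^2$. A simultaneous collision occurs at time $t$ if some ball touches at least two other balls at time $t$; evolutions are followed only as long as no simultaneous collision has occurred. Balls $i\neq j$ collide at time $t>0$ if they are tangent at time $t$, do not touch during $(t-\varepsilon,t)$ and $(t,t+\varepsilon)$ for some $\varepsilon>0$, and both change velocity at time $t$. Let $K(n,d)$ be the supremum of the number of collisions over all initial conditions (positions and velocities at time $0$). For $n\ge 3$ let $n_1=\lfloor n/3\rfloor$, $n_2=n-2n_1$ and $$f(n)=n_1(n_1+1)n_2+\frac{n_2(n_2-1)}{2}+n_1(n_1-1).$$ **Theorem.** For all $n\ge 3$ and $d\ge 2$, $K(n,d)\ge f(n)$. Moreover, $f(n)>n^3/27$ for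 all $n\ge 3$, and $\lim_{n\to\infty} f(n)/(n^3/27)=1$. -/

import Mathlib

open Set Filter Topology

noncomputable section

/-- `f(n) = n₁(n₁+1)n₂ + n₂(n₂-1)/2 + n₁(n₁-1)` with `n₁ = ⌊n/3⌋` and `n₂ = n - 2n₁`.
All natural-number subtractions and divisions by two below are exact for `n ≥ 1`. -/
def collisionBound (n : ℕ) : ℕ :=
  let n₁ := n / 3
  let n₂ := n - 2 * n₁
  n₁ * (n₁ + 1) * n₂ + n₂ * (n₂ - 1) / 2 + n₁ * (n₁ - 1)

/-- The orthogonal projection `P_w z = (z · w) w / |w|²` of `z` on the line spanned by `w`. -/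
def projAlong {d : ℕ} (w z : EuclideanSpace ℝ (Fin d)) : EuclideanSpace ℝ (Fin d) :=
  (inner ℝ z w / ‖w‖ ^ 2) • w

/-- The unit balls centred at `x i` and `x j` are tangent. -/
def Touching {n d : ℕ} (x : Fin n → EuclideanSpace ℝ (Fin d)) (i j : Fin n) : Prop :=
  i ≠ j ∧ dist (x i) (x j) = 2

/-- Three or more balls form a connected cluster of touching balls, that is, some ball touches
two different balls. -/
def SimultaneousContact {n d : ℕ} (x : Fin n → EuclideanSpace ℝ (Fin d)) : Prop :=
  ∃ i j k : Fin n, j ≠ k ∧ Touching x i j ∧ Touching x i k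

/-- An evolution, over the time interval `[0, T]`, of `n` elastically colliding balls of radius `1`
and equal masses in `ℝᵈ`, without simultaneous collisions.  Only the values at times in `[0, T]`
matter. -/
structure BallEvolution (n d : ℕ) (T : ℝ) where
  /-- positions of the centres -/
  pos : ℝ → Fin n → EuclideanSpace ℝ (Fin d)
  /-- velocities just after time `t` (right derivatives of the positions) -/
  vel : ℝ → Fin n → EuclideanSpace ℝ (Fin d)
  /-- velocities just before time `t` (left limits of the velocities) -/
  velBefore : ℝ → Fin n → EuclideanSpace ℝ (Fin d)
  /-- the balls are hard: their interiors are disjoint -/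
  hard : ∀ t ∈ Icc 0 T, ∀ i j, i ≠ j → 2 ≤ dist (pos t i) (pos t j)
  /-- the velocity is constant, equal to `vel t`, on some interval to the right of `t` -/
  motion_after : ∀ t ∈ Ico 0 T, ∀ i,
    ∀ᶠ s in 𝓝[>] t, pos s i = pos t i + (s - t) • vel t i
  /-- the velocity is constant, equal to `velBefore t`, on some interval to the left of `t` -/
  motion_before : ∀ t ∈ Ioc 0 T, ∀ i,
    ∀ᶠ s in 𝓝[<] t, pos s i = pos t i + (s - t) • velBefore t i
  /-- there are no simultaneous collisions -/
  not_simultaneous : ∀ t ∈ Icc 0 T, ¬ SimultaneousContact (pos t)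
  /-- a ball that touches no other ball does not change its velocity -/
  free : ∀ t ∈ Ioo 0 T, ∀ i, (∀ j, ¬ Touching (pos t) i j) → vel t i = velBefore t i
  /-- the law of elastic collision (for a grazing contact it says that nothing changes) -/
  elastic : ∀ t ∈ Ioo 0 T, ∀ i j, Touching (pos t) i j →
    vel t i = velBefore t i -
      projAlong (pos t i - pos t j) (velBefore t i - velBefore t j)

/-- Balls `i` and `j` collide at time `t`: they are tangent at time `t`, they do not touch at the
times just before and just after `t`, and both of them change velocity. -/
def BallEvolution.Collide {n d : ℕ} {T : ℝ} (S : BallEvolution n d T) (t : ℝ) (i j : Fin n) :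
    Prop :=
  t ∈ Ioo 0 T ∧ Touching (S.pos t) i j ∧ (∀ᶠ s in 𝓝[≠] t, ¬ Touching (S.pos s) i j) ∧
    S.vel t i ≠ S.velBefore t i ∧ S.vel t j ≠ S.velBefore t j

/-- The number of collisions during an evolution; each colliding (unordered) pair and each collision
time is counted once. -/
def BallEvolution.numCollisions {n d : ℕ} {T : ℝ} (S : BallEvolution n d T) : ℕ∞ :=
  {c : ℝ × Fin n × Fin n | c.2.1 < c.2.2 ∧ S.Collide c.1 c.2.1 c.2.2}.encard

/-- The total number of collisions of the system started at time `0` with positions `x` and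
velocities `v`: all times `t > 0` are taken into account for which the evolution is free of
simultaneous collisions up to time `t`. -/
def totalCollisions {n d : ℕ} (x v : Fin n → EuclideanSpace ℝ (Fin d)) : ℕ∞ :=
  ⨆ (T : ℝ) (_ : 0 < T) (S : BallEvolution n d T) (_ : S.pos 0 = x ∧ S.vel 0 = v), S.numCollisions

/-- `K(n,d)`: the supremum, over all initial positions and velocities, of the number of elastic
collisions of `n` balls of equal radii and masses in `ℝᵈ`. -/
def maxCollisions (n d : ℕ) : ℕ∞ :=
  ⨆ (x : Fin n → EuclideanSpace ℝ (Fin d)) (v : Fin n → EuclideanSpace ℝ (Fin d)),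
    totalCollisions x v

end

/-! The `n = 2m + c` balls form two horizontal chains of `m` balls, to the left and to the right of
a vertical axis, and a column of `c` balls falling along the axis with speed 1. All centres stay in
a coordinate plane, which is where `2 ≤ d` enters.

When a falling ball arrives, the chains are at rest and their gaps are very small, on the scale of
the passage. The ball hits the tip of the left chain; the kick runs through the chain, since equal
masses exchange velocities, and sends the outermost ball away. This makes `m` collisions. The ball
rebounds to the right chain, then back to the left chain, which now has `m - 1` resting balls, and
so on. The sweeps cost `m, m, m - 1, m - 1, ..., 1, 1` collisions, in all `m(m + 1)` per falling
ball (`Ball.limitEvo_sweep`, `Ball.exists_pass`).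

The passage is analysed in a limit. With horizontal displacements of order `lam²`, vertical ones of
order `lam` and time of order `lam`, the contact condition of neighbours becomes `Δx + Δy²/4 = 0`,
and collisions change only horizontal velocities. In this limit the falling ball bounces between two
parabolic walls, and its height above the chains is multiplied by about `√2 - 1` at each bounce
after the first. Contacts in the limit are transversal and all other gaps are positive, so hard
balls shadow the limiting evolution for small `lam` (`LimitEvo.exists_planeEvo`).

After a passage the chains expand with velocities of order `lam`. When the next ball arrives, about
10 time units later, their displacements are of order `lam`, which is the square of the larger scale
`√lam`; on that scale the velocities are negligible and the chains are again at rest. Hence the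
passages can be concatenated, each on its own scale (`Ball.exists_stages`).

Before the first passage the `2m` chain balls form a one-dimensional gas in which every pair of
point particles meets once, which gives `m(2m - 1)` more collisions and ends in slowly expanding
chains (`Ball.exists_evolution_gas`). The total `m(2m - 1) + c·m(m + 1)` is at least `f(n)` when `m`
is `n / 3` rounded to the nearest integer. The remaining assertions follow from the explicit cubic
polynomials for `f` in the residue classes modulo 3. -/

/-! ### Evolutions, their concatenation, and counting of collision times. -/

/-- Two balls of a configuration indexed by an arbitrary type touch. -/
def Tangent {ι : Type*} {d : ℕ} (x : ι → EuclideanSpace ℝ (Fin d)) (i j : ι) : Prop :=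
  i ≠ j ∧ dist (x i) (x j) = 2

/-- All balls are at positive distance from each other. -/
def Apart {ι : Type*} {d : ℕ} (x : ι → EuclideanSpace ℝ (Fin d)) : Prop :=
  ∀ i j, i ≠ j → 2 < dist (x i) (x j)

theorem Apart.not_tangent {ι : Type*} {d : ℕ} {x : ι → EuclideanSpace ℝ (Fin d)} (h : Apart x)
    (i j : ι) : ¬ Tangent x i j := fun hT => (h i j hT.1).ne' hT.2

/-- The conditions of `BallEvolution`, for balls indexed by an arbitrary type. -/
structure IsEvol {ι : Type*} {d : ℕ} (T : ℝ) (pos vel vb : ℝ → ι → EuclideanSpace ℝ (Fin d)) :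
    Prop where
  hard : ∀ t ∈ Icc 0 T, ∀ i j, i ≠ j → 2 ≤ dist (pos t i) (pos t j)
  motion_after : ∀ t ∈ Ico 0 T, ∀ i, ∀ᶠ s in 𝓝[>] t, pos s i = pos t i + (s - t) • vel t i
  motion_before : ∀ t ∈ Ioc 0 T, ∀ i, ∀ᶠ s in 𝓝[<] t, pos s i = pos t i + (s - t) • vb t i
  not_simultaneous : ∀ t ∈ Icc 0 T, ∀ i j k, j ≠ k → Tangent (pos t) i j → ¬ Tangent (pos t) i k
  free : ∀ t ∈ Ioo 0 T, ∀ i, (∀ j, ¬ Tangent (pos t) i j) → vel t i = vb t i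
  elastic : ∀ t ∈ Ioo 0 T, ∀ i j, Tangent (pos t) i j →
    vel t i = vb t i - projAlong (pos t i - pos t j) (vb t i - vb t j)

/-- The times at which some pair of balls collides. -/
def collisionTimes {ι : Type*} {d : ℕ} (T : ℝ) (pos vel vb : ℝ → ι → EuclideanSpace ℝ (Fin d)) :
    Set ℝ :=
  {t | t ∈ Ioo 0 T ∧ ∃ i j, Tangent (pos t) i j ∧ (∀ᶠ s in 𝓝[≠] t, ¬ Tangent (pos s) i j) ∧
    vel t i ≠ vb t i ∧ vel t j ≠ vb t j}

/-- Some evolution leads in time `T` from the state `(x, v)` to the state `(x', v')`, with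
collisions at no fewer than `N` different times. -/
def Evo {ι : Type*} {d : ℕ} (x v : ι → EuclideanSpace ℝ (Fin d)) (T : ℝ) (N : ℕ)
    (x' v' : ι → EuclideanSpace ℝ (Fin d)) : Prop :=
  0 < T ∧ ∃ pos vel vb : ℝ → ι → EuclideanSpace ℝ (Fin d), IsEvol T pos vel vb ∧
    pos 0 = x ∧ vel 0 = v ∧ pos T = x' ∧ vb T = v' ∧ Apart x ∧ Apart x' ∧
    (N : ℕ∞) ≤ (collisionTimes T pos vel vb).encard

/-- Collision times lie in the open time intervals, so those of the two pieces are disjoint and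
their numbers add up. Since no balls touch at the junction, the collision law is vacuous there. -/
theorem Evo.trans {ι : Type*} {d : ℕ} {x v x' v' x'' v'' : ι → EuclideanSpace ℝ (Fin d)}
    {T₁ T₂ : ℝ} {N₁ N₂ : ℕ} (h₁ : Evo x v T₁ N₁ x' v') (h₂ : Evo x' v' T₂ N₂ x'' v'') :
    Evo x v (T₁ + T₂) (N₁ + N₂) x'' v'' := by
  obtain ⟨hT₁, p₁, v₁, b₁, e₁, hp₁, hv₁, hq₁, hb₁, hA, hA', hN₁⟩ := h₁
  obtain ⟨hT₂, p₂, v₂, b₂, e₂, hp₂, hv₂, hq₂, hb₂, -, hA'', hN₂⟩ := h₂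
  obtain ⟨p, P1, P2⟩ : ∃ p : ℝ → ι → EuclideanSpace ℝ (Fin d), (∀ t, t ≤ T₁ → p t = p₁ t) ∧
      ∀ t, T₁ ≤ t → p t = p₂ (t - T₁) := by
    refine ⟨fun t => if t ≤ T₁ then p₁ t else p₂ (t - T₁), fun t ht => if_pos ht, fun t ht => ?_⟩
    rcases ht.eq_or_lt with rfl | h
    · simp [hq₁, hp₂]
    · exact if_neg h.not_ge
  obtain ⟨v, V1, V2⟩ : ∃ v : ℝ → ι → EuclideanSpace ℝ (Fin d), (∀ t, t < T₁ → v t = v₁ t) ∧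
      ∀ t, T₁ ≤ t → v t = v₂ (t - T₁) :=
    ⟨fun t => if t < T₁ then v₁ t else v₂ (t - T₁), fun t ht => if_pos ht,
      fun t ht => if_neg ht.not_gt⟩
  obtain ⟨b, B1, B2⟩ : ∃ b : ℝ → ι → EuclideanSpace ℝ (Fin d), (∀ t, t ≤ T₁ → b t = b₁ t) ∧
      ∀ t, T₁ < t → b t = b₂ (t - T₁) :=
    ⟨fun t => if t ≤ T₁ then b₁ t else b₂ (t - T₁), fun t ht => if_pos ht,
      fun t ht => if_neg ht.not_ge⟩
  refine ⟨by linarith, p, v, b, ⟨?_, ?_, ?_, ?_, ?_, ?_⟩, (P1 0 hT₁.le).trans hp₁,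
    (V1 0 hT₁).trans hv₁, ?_, ?_, hA, hA'', ?_⟩
  rotate_left 6
  · rw [P2 _ (by linarith)]; simpa using hq₂
  · rw [B2 _ (by linarith)]; simpa using hb₂
  · have hsub : collisionTimes T₁ p₁ v₁ b₁ ∪ (fun t => t + T₁) '' collisionTimes T₂ p₂ v₂ b₂ ⊆
        collisionTimes (T₁ + T₂) p v b := by
      rintro t (⟨ht, i, j, h1, h2, h3⟩ | ⟨t, ⟨ht, i, j, h1, h2, h3⟩, rfl⟩)
      · refine ⟨⟨ht.1, by linarith [ht.2]⟩, i, j, ?_, ?_, ?_⟩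
        · rw [P1 _ ht.2.le]; exact h1
        · filter_upwards [h2, nhdsWithin_le_nhds (Iio_mem_nhds ht.2)] with s hs hs'
          rwa [P1 _ (le_of_lt hs')]
        · rw [V1 _ ht.2, B1 _ ht.2.le]; exact h3
      · have hlt : T₁ < t + T₁ := by linarith [ht.1]
        refine ⟨⟨by linarith [ht.1], by linarith [ht.2]⟩, i, j, ?_, ?_, ?_⟩
        · rw [P2 _ hlt.le]; simpa using h1
        · have hc : Tendsto (fun s : ℝ => s - T₁) (𝓝[≠] (t + T₁)) (𝓝[≠] t) := by
            refine tendsto_nhdsWithin_iff.2 ⟨?_, ?_⟩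
            · have : Tendsto (fun s : ℝ => s - T₁) (𝓝 (t + T₁)) (𝓝 (t + T₁ - T₁)) :=
                (continuous_id.sub continuous_const).tendsto _
              rw [add_sub_cancel_right] at this
              exact this.mono_left nhdsWithin_le_nhds
            · filter_upwards [self_mem_nhdsWithin] with s hs
              intro h; apply hs; simp only [mem_singleton_iff] at h ⊢; linarith
          filter_upwards [hc.eventually h2, nhdsWithin_le_nhds (Ioi_mem_nhds hlt)] with s hs hs'
          rwa [P2 _ (le_of_lt hs')]
        · rw [V2 _ hlt.le, B2 _ hlt]; simpa using h3
    refine le_trans ?_ (encard_le_encard hsub)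
    rw [encard_union_eq, (add_left_injective T₁).encard_image]
    · push_cast; exact add_le_add hN₁ hN₂
    · rw [Set.disjoint_left]
      rintro t ht ⟨s, hs, rfl⟩
      have h1 := ht.1.2
      have h2 := hs.1.1
      simp only at h1
      linarith
  · intro t ht i j hij
    rcases le_total t T₁ with h | h
    · rw [P1 _ h]; exact e₁.hard t ⟨ht.1, h⟩ i j hij
    · rw [P2 _ h]; exact e₂.hard _ ⟨by linarith, by linarith [ht.2]⟩ i j hij
  · intro t ht i
    rcases lt_or_ge t T₁ with h | h
    · filter_upwards [e₁.motion_after t ⟨ht.1, h⟩ i, nhdsWithin_le_nhds (Iio_mem_nhds h)]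
        with s hs hs'
      rw [P1 _ h.le, P1 _ (le_of_lt hs'), V1 _ h, hs]
    · have hc : Tendsto (fun s : ℝ => s - T₁) (𝓝[>] t) (𝓝[>] (t - T₁)) := by
        refine tendsto_nhdsWithin_iff.2 ⟨?_, ?_⟩
        · exact ((continuous_id.sub continuous_const).tendsto t).mono_left nhdsWithin_le_nhds
        · filter_upwards [self_mem_nhdsWithin] with s hs
          simp only [mem_Ioi] at hs ⊢; linarith
      filter_upwards [hc.eventually (e₂.motion_after (t - T₁)
        ⟨by linarith, by linarith [ht.2]⟩ i), self_mem_nhdsWithin] with s hs hs'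
      rw [P2 _ h, P2 _ (h.trans (le_of_lt hs')), V2 _ h, hs]
      congr 2; ring
  · intro t ht i
    rcases le_or_gt t T₁ with h | h
    · filter_upwards [e₁.motion_before t ⟨ht.1, h⟩ i, self_mem_nhdsWithin] with s hs hs'
      rw [P1 _ h, P1 _ (h.trans' (le_of_lt hs')), B1 _ h, hs]
    · have hc : Tendsto (fun s : ℝ => s - T₁) (𝓝[<] t) (𝓝[<] (t - T₁)) := by
        refine tendsto_nhdsWithin_iff.2 ⟨?_, ?_⟩
        · exact ((continuous_id.sub continuous_const).tendsto t).mono_left nhdsWithin_le_nhds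
        · filter_upwards [self_mem_nhdsWithin] with s hs
          simp only [mem_Iio] at hs ⊢; linarith
      filter_upwards [hc.eventually (e₂.motion_before (t - T₁)
        ⟨by linarith, by linarith [ht.2]⟩ i), nhdsWithin_le_nhds (Ioi_mem_nhds h)] with s hs hs'
      rw [P2 _ h.le, P2 _ (le_of_lt hs'), B2 _ h, hs]
      congr 2; ring
  · intro t ht i j k hjk
    rcases le_total t T₁ with h | h
    · rw [P1 _ h]; exact e₁.not_simultaneous t ⟨ht.1, h⟩ i j k hjk
    · rw [P2 _ h]; exact e₂.not_simultaneous _ ⟨by linarith, by linarith [ht.2]⟩ i j k hjk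
  · intro t ht i
    rcases lt_trichotomy t T₁ with h | rfl | h
    · rw [P1 _ h.le, V1 _ h, B1 _ h.le]; exact e₁.free t ⟨ht.1, h⟩ i
    -- At the junction the right velocity comes from the second piece and the left velocity from the
    -- first; they agree because both are `v'`.
    · intro _
      rw [V2 _ le_rfl, B1 _ le_rfl, sub_self, hv₂, hb₁]
    · rw [P2 _ h.le, V2 _ h.le, B2 _ h]; exact e₂.free _ ⟨by linarith, by linarith [ht.2]⟩ i
  · intro t ht i j
    rcases lt_trichotomy t T₁ with h | rfl | h
    · rw [P1 _ h.le, V1 _ h, B1 _ h.le]; exact e₁.elastic t ⟨ht.1, h⟩ i j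
    · intro hT
      rw [P1 _ le_rfl, hq₁] at hT
      exact absurd hT (hA'.not_tangent i j)
    · rw [P2 _ h.le, V2 _ h.le, B2 _ h]; exact e₂.elastic _ ⟨by linarith, by linarith [ht.2]⟩ i j

/-- Free flight. -/
theorem Evo.of_apart {ι : Type*} {d : ℕ} {x v : ι → EuclideanSpace ℝ (Fin d)} {T : ℝ} (hT : 0 < T)
    (h : ∀ s ∈ Icc 0 T, Apart fun i => x i + s • v i) :
    Evo x v T 0 (fun i => x i + T • v i) v := by
  refine ⟨hT, fun s i => x i + s • v i, fun _ => v, fun _ => v, ⟨?_, ?_, ?_, ?_, ?_, ?_⟩, by simp,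
    rfl, rfl, rfl, by simpa using h 0 ⟨le_rfl, hT.le⟩, h T ⟨hT.le, le_rfl⟩, by simp⟩
  · exact fun t ht i j hij => (h t ht i j hij).le
  · exact fun t _ i => Eventually.of_forall fun s => by module
  · exact fun t _ i => Eventually.of_forall fun s => by module
  · exact fun t ht i j k _ hT => absurd hT ((h t ht).not_tangent i j)
  · exact fun _ _ _ _ => rfl
  · exact fun t ht i j hT => absurd hT ((h t ⟨ht.1.le, ht.2.le⟩).not_tangent i j)

/-- One collision, with free flight before and after. -/
theorem Evo.of_collision {ι : Type*} {d : ℕ} {x v v' : ι → EuclideanSpace ℝ (Fin d)} {t T : ℝ}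
    (ht : 0 < t) (htT : t < T) {i j : ι} (hij : i ≠ j)
    (hbefore : ∀ s ∈ Ico 0 t, Apart fun k => x k + s • v k)
    (hcontact : dist (x i + t • v i) (x j + t • v j) = 2)
    (hother : ∀ k l, k ≠ l → ¬ (k = i ∧ l = j) → ¬ (k = j ∧ l = i) →
      2 < dist (x k + t • v k) (x l + t • v l))
    (hafter : ∀ s ∈ Ioc 0 (T - t), Apart fun k => x k + t • v k + s • v' k)
    (hvi : v' i = v i - projAlong ((x i + t • v i) - (x j + t • v j)) (v i - v j))
    (hvj : v' j = v j - projAlong ((x j + t • v j) - (x i + t • v i)) (v j - v i))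
    (hvk : ∀ k, k ≠ i → k ≠ j → v' k = v k) (hi : v' i ≠ v i) (hj : v' j ≠ v j) :
    Evo x v T 1 (fun k => x k + t • v k + (T - t) • v' k) v' := by
  obtain ⟨p, P1, P2⟩ : ∃ p : ℝ → ι → EuclideanSpace ℝ (Fin d),
      (∀ s, s ≤ t → p s = fun k => x k + s • v k) ∧
      ∀ s, t ≤ s → p s = fun k => x k + t • v k + (s - t) • v' k := by
    refine ⟨fun s k => if s ≤ t then x k + s • v k else x k + t • v k + (s - t) • v' k,
      fun s hs => funext fun k => if_pos hs, fun s hs => ?_⟩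
    rcases hs.eq_or_lt with rfl | h
    · funext k; simp
    · exact funext fun k => if_neg h.not_ge
  obtain ⟨w, V1, V2⟩ : ∃ w : ℝ → ι → EuclideanSpace ℝ (Fin d), (∀ s, s < t → w s = v) ∧
      ∀ s, t ≤ s → w s = v' :=
    ⟨fun s => if s < t then v else v', fun s hs => if_pos hs, fun s hs => if_neg hs.not_gt⟩
  obtain ⟨b, B1, B2⟩ : ∃ b : ℝ → ι → EuclideanSpace ℝ (Fin d), (∀ s, s ≤ t → b s = v) ∧
      ∀ s, t < s → b s = v' :=
    ⟨fun s => if s ≤ t then v else v', fun s hs => if_pos hs, fun s hs => if_neg hs.not_ge⟩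
  have A1 : ∀ s ∈ Icc 0 T, s ≠ t → Apart (p s) := by
    intro s hs hst
    rcases lt_or_gt_of_ne hst with h | h
    · rw [P1 _ h.le]; exact hbefore s ⟨hs.1, h⟩
    · rw [P2 _ h.le]; exact hafter _ ⟨by linarith, by linarith [hs.2]⟩
  have tan : ∀ k l, Tangent (fun k => x k + t • v k) k l → (k = i ∧ l = j) ∨ (k = j ∧ l = i) := by
    intro k l hkl
    by_contra hcon
    rw [not_or] at hcon
    exact (hother k l hkl.1 hcon.1 hcon.2).ne' hkl.2
  refine ⟨ht.trans htT, p, w, b, ⟨?_, ?_, ?_, ?_, ?_, ?_⟩, ?_, V1 0 ht, P2 T htT.le, B2 T htT, ?_, ?_,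
    ?_⟩
  rotate_left 6
  · rw [P1 _ ht.le]; simp
  · simpa using hbefore 0 ⟨le_rfl, ht⟩
  · exact hafter _ ⟨by linarith, le_rfl⟩
  · have : ({t} : Set ℝ) ⊆ collisionTimes T p w b := by
      rw [singleton_subset_iff]
      refine ⟨⟨ht, htT⟩, i, j, ?_, ?_, ?_⟩
      · rw [P1 _ le_rfl]; exact ⟨hij, hcontact⟩
      · filter_upwards [self_mem_nhdsWithin, nhdsWithin_le_nhds (Ioo_mem_nhds ht htT)] with s hs hs'
        exact (A1 s ⟨hs'.1.le, hs'.2.le⟩ hs).not_tangent i j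
      · rw [V2 _ le_rfl, B1 _ le_rfl]; exact ⟨hi, hj⟩
    simpa using encard_le_encard this
  · intro s hs k l hkl
    by_cases h : s = t
    · subst h
      rw [P1 _ le_rfl]
      by_cases hc : Tangent (fun k => x k + s • v k) k l
      · exact hc.2.ge
      · by_cases h1 : k = i ∧ l = j
        · rw [h1.1, h1.2]; exact hcontact.ge
        by_cases h2 : k = j ∧ l = i
        · rw [h2.1, h2.2, dist_comm]; exact hcontact.ge
        exact (hother k l hkl h1 h2).le
    · exact (A1 s hs h k l hkl).le
  · intro s hs k
    rcases lt_or_ge s t with h | h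
    · filter_upwards [nhdsWithin_le_nhds (Iio_mem_nhds h)] with r hr
      rw [P1 _ h.le, P1 _ (le_of_lt hr), V1 _ h]; module
    · filter_upwards [self_mem_nhdsWithin] with r hr
      rw [P2 _ h, P2 _ (h.trans (le_of_lt hr)), V2 _ h]; module
  · intro s hs k
    rcases le_or_gt s t with h | h
    · filter_upwards [self_mem_nhdsWithin] with r hr
      rw [P1 _ h, P1 _ (h.trans' (le_of_lt hr)), B1 _ h]; module
    · filter_upwards [nhdsWithin_le_nhds (Ioi_mem_nhds h)] with r hr
      rw [P2 _ h.le, P2 _ (le_of_lt hr), B2 _ h]; module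
  · intro s hs a b c hbc
    by_cases h : s = t
    · subst h
      rw [P1 _ le_rfl]
      intro h1 h2
      rcases tan _ _ h1 with ⟨rfl, rfl⟩ | ⟨rfl, rfl⟩ <;> rcases tan _ _ h2 with ⟨h3, h4⟩ | ⟨h3, h4⟩
      · exact hbc h4.symm
      · exact hij h3
      · exact hij h3.symm
      · exact hbc h4.symm
    · exact fun hT => absurd hT ((A1 s hs h).not_tangent a b)
  · intro s hs k
    rcases lt_trichotomy s t with h | rfl | h
    · rw [V1 _ h, B1 _ h.le]; exact fun _ => rfl
    · rw [P1 _ le_rfl, V2 _ le_rfl, B1 _ le_rfl]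
      intro hk
      refine hvk k ?_ ?_
      · rintro rfl; exact hk j ⟨hij, hcontact⟩
      · rintro rfl; exact hk i ⟨hij.symm, (dist_comm _ _).trans hcontact⟩
    · rw [V2 _ h.le, B2 _ h]; exact fun _ => rfl
  · intro s hs k l hT
    by_cases h : s = t
    · subst h
      rw [P1 _ le_rfl] at hT ⊢
      rw [V2 _ le_rfl, B1 _ le_rfl]
      rcases tan _ _ hT with ⟨rfl, rfl⟩ | ⟨rfl, rfl⟩
      · exact hvi
      · exact hvj
    · exact absurd hT ((A1 s ⟨hs.1.le, hs.2.le⟩ h).not_tangent k l)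

/-- Projecting collisions to their times cannot increase their number, so counting times gives a
lower bound. The bijection `e` numbers the balls. -/
theorem Evo.le_maxCollisions {ι : Type*} {n d : ℕ} {x v x' v' : ι → EuclideanSpace ℝ (Fin d)}
    {T : ℝ} {N : ℕ} (h : Evo x v T N x' v') (e : Fin n ≃ ι) : (N : ℕ∞) ≤ maxCollisions n d := by
  obtain ⟨hT, p, w, b, ev, hp, hw, -, -, -, -, hN⟩ := h
  have tan : ∀ t i j, Touching (fun k => p t (e k)) i j ↔ Tangent (p t) (e i) (e j) := by
    intro t i j; simp [Touching, Tangent]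
  let S : BallEvolution n d T :=
    { pos := fun t k => p t (e k)
      vel := fun t k => w t (e k)
      velBefore := fun t k => b t (e k)
      hard := fun t ht i j hij => ev.hard t ht _ _ (e.injective.ne hij)
      motion_after := fun t ht i => ev.motion_after t ht (e i)
      motion_before := fun t ht i => ev.motion_before t ht (e i)
      not_simultaneous := by
        rintro t ht ⟨i, j, k, hjk, h1, h2⟩
        exact ev.not_simultaneous t ht _ _ _ (e.injective.ne hjk) ((tan t i j).1 h1)
          ((tan t i k).1 h2)
      free := fun t ht i hi => ev.free t ht (e i) fun j hj =>
        hi (e.symm j) ((tan t _ _).2 (by simpa using hj))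
      elastic := fun t ht i j hij => ev.elastic t ht _ _ ((tan t i j).1 hij) }
  have h1 : (N : ℕ∞) ≤ S.numCollisions := by
    refine hN.trans ((encard_le_encard ?_).trans (encard_image_le Prod.fst _))
    rintro t ⟨ht, i, j, h1, h2, h3, h4⟩
    have key : ∀ i j, Tangent (p t) i j → (∀ᶠ s in 𝓝[≠] t, ¬ Tangent (p s) i j) →
        w t i ≠ b t i → w t j ≠ b t j → S.Collide t (e.symm i) (e.symm j) := by
      intro i j h1 h2 h3 h4
      refine ⟨ht, (tan t _ _).2 (by simpa using h1), ?_, by simpa [S] using h3,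
        by simpa [S] using h4⟩
      filter_upwards [h2] with s hs hs'
      exact hs (by simpa using (tan s _ _).1 hs')
    have sym : ∀ s, Tangent (p s) i j → Tangent (p s) j i :=
      fun s h => ⟨h.1.symm, (dist_comm _ _).trans h.2⟩
    have sym' : ∀ s, Tangent (p s) j i → Tangent (p s) i j :=
      fun s h => ⟨h.1.symm, (dist_comm _ _).trans h.2⟩
    rcases lt_or_gt_of_ne (e.symm.injective.ne h1.1) with h | h
    · exact ⟨(t, e.symm i, e.symm j), ⟨h, key i j h1 h2 h3 h4⟩, rfl⟩
    · exact ⟨(t, e.symm j, e.symm i), ⟨h, key j i (sym t h1)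
        (h2.mono fun s hs hs' => hs (sym' s hs')) h4 h3⟩, rfl⟩
  refine h1.trans ?_
  refine le_trans ?_ (le_iSup₂ (f := fun x v => totalCollisions (n := n) (d := d) x v)
    (S.pos 0) (S.vel 0))
  exact le_iSup₂_of_le T hT (le_iSup₂_of_le S ⟨rfl, rfl⟩ le_rfl)

/-! ### Discs in a coordinate plane. -/

/-- The state (positions `x, y`, velocities `u, w`) of a family of discs in the plane. -/
structure PlaneState (ι : Type*) where
  x : ι → ℝ
  y : ι → ℝ
  u : ι → ℝ
  w : ι → ℝ

namespace PlaneState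

variable {ι : Type*}

/-- Free flight for time `t`. -/
def fly (S : PlaneState ι) (t : ℝ) : PlaneState ι :=
  ⟨fun i => S.x i + t * S.u i, fun i => S.y i + t * S.w i, S.u, S.w⟩

/-- The square of the distance of two centres. -/
def sq (S : PlaneState ι) (i j : ι) : ℝ := (S.x i - S.x j) ^ 2 + (S.y i - S.y j) ^ 2

/-- The inner product of the relative velocity and the relative position. -/
def slope (S : PlaneState ι) (i j : ι) : ℝ :=
  (S.u i - S.u j) * (S.x i - S.x j) + (S.w i - S.w j) * (S.y i - S.y j)

/-- Elastic collision of the tangent discs `i` and `j`. -/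
noncomputable def coll [DecidableEq ι] (S : PlaneState ι) (i j : ι) : PlaneState ι :=
  ⟨S.x, S.y,
    fun k => if k = i then S.u i - S.slope i j / 4 * (S.x i - S.x j) else
      if k = j then S.u j + S.slope i j / 4 * (S.x i - S.x j) else S.u k,
    fun k => if k = i then S.w i - S.slope i j / 4 * (S.y i - S.y j) else
      if k = j then S.w j + S.slope i j / 4 * (S.y i - S.y j) else S.w k⟩

theorem fly_fly (S : PlaneState ι) (s t : ℝ) : (S.fly s).fly t = S.fly (s + t) := by
  simp only [fly, mk.injEq, and_true]
  constructor <;> funext i <;> ring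

theorem sq_comm (S : PlaneState ι) (i j : ι) : S.sq i j = S.sq j i := by
  unfold sq; ring

theorem sq_fly (S : PlaneState ι) (i j : ι) (s : ℝ) : (S.fly s).sq i j =
    S.sq i j + 2 * s * S.slope i j + s ^ 2 * ((S.u i - S.u j) ^ 2 + (S.w i - S.w j) ^ 2) := by
  simp only [sq, slope, fly]; ring

theorem slope_coll [DecidableEq ι] (S : PlaneState ι) {i j : ι} (hij : i ≠ j)
    (h : S.sq i j = 4) : (S.coll i j).slope i j = - S.slope i j := by
  have : (S.coll i j).slope i j = S.slope i j - S.slope i j / 2 * S.sq i j := by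
    simp only [slope, coll, sq, if_true, hij.symm, if_false]; ring
  rw [this, h]; ring

end PlaneState

/-- A coordinate plane in `ℝᵈ`. -/
noncomputable def planeVec {d : ℕ} (hd : 2 ≤ d) (a b : ℝ) : EuclideanSpace ℝ (Fin d) :=
  a • EuclideanSpace.single (⟨0, by omega⟩ : Fin d) (1 : ℝ) +
    b • EuclideanSpace.single (⟨1, by omega⟩ : Fin d) (1 : ℝ)

theorem planeVec_inner {d : ℕ} (hd : 2 ≤ d) (a b a' b' : ℝ) :
    inner ℝ (planeVec hd a b) (planeVec hd a' b') = a * a' + b * b' := by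
  simp [planeVec, inner_add_left, inner_add_right, inner_smul_left, inner_smul_right,
    EuclideanSpace.inner_single_left]
  ring

theorem planeVec_norm_sq {d : ℕ} (hd : 2 ≤ d) (a b : ℝ) :
    ‖planeVec hd a b‖ ^ 2 = a ^ 2 + b ^ 2 := by
  rw [← real_inner_self_eq_norm_sq, planeVec_inner]; ring

theorem planeVec_add {d : ℕ} (hd : 2 ≤ d) (a b a' b' : ℝ) :
    planeVec hd a b + planeVec hd a' b' = planeVec hd (a + a') (b + b') := by
  unfold planeVec; module

theorem planeVec_sub {d : ℕ} (hd : 2 ≤ d) (a b a' b' : ℝ) :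
    planeVec hd a b - planeVec hd a' b' = planeVec hd (a - a') (b - b') := by
  unfold planeVec; module

theorem planeVec_smul {d : ℕ} (hd : 2 ≤ d) (s a b : ℝ) :
    s • planeVec hd a b = planeVec hd (s * a) (s * b) := by
  unfold planeVec; module

namespace PlaneState

variable {ι : Type*} {d : ℕ}

/-- The centres, as points of `ℝᵈ`. -/
noncomputable def pos (hd : 2 ≤ d) (S : PlaneState ι) (i : ι) : EuclideanSpace ℝ (Fin d) :=
  planeVec hd (S.x i) (S.y i)

/-- The velocities, as vectors of `ℝᵈ`. -/
noncomputable def vel (hd : 2 ≤ d) (S : PlaneState ι) (i : ι) : EuclideanSpace ℝ (Fin d) :=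
  planeVec hd (S.u i) (S.w i)

theorem pos_fly (hd : 2 ≤ d) (S : PlaneState ι) (i : ι) (s : ℝ) :
    (S.fly s).pos hd i = S.pos hd i + s • S.vel hd i := by
  simp only [pos, vel, planeVec_smul, planeVec_add, fly]

theorem dist_sq (hd : 2 ≤ d) (S : PlaneState ι) (i j : ι) :
    dist (S.pos hd i) (S.pos hd j) ^ 2 = S.sq i j := by
  rw [dist_eq_norm, pos, pos, planeVec_sub, planeVec_norm_sq, sq]

theorem two_lt_dist (hd : 2 ≤ d) (S : PlaneState ι) {i j : ι} (h : 4 < S.sq i j) :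
    2 < dist (S.pos hd i) (S.pos hd j) := by
  rw [← dist_sq hd] at h
  nlinarith [dist_nonneg (x := S.pos hd i) (y := S.pos hd j)]

theorem dist_eq_two (hd : 2 ≤ d) (S : PlaneState ι) {i j : ι} (h : S.sq i j = 4) :
    dist (S.pos hd i) (S.pos hd j) = 2 := by
  rw [← dist_sq hd] at h
  nlinarith [dist_nonneg (x := S.pos hd i) (y := S.pos hd j)]

end PlaneState

/-- An evolution of balls whose centres stay in a coordinate plane. -/
def PlaneEvo {ι : Type*} {d : ℕ} (hd : 2 ≤ d) (S : PlaneState ι) (T : ℝ) (N : ℕ)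
    (S' : PlaneState ι) : Prop :=
  Evo (S.pos hd) (S.vel hd) T N (S'.pos hd) (S'.vel hd)

namespace PlaneEvo

variable {ι : Type*} {d : ℕ} {hd : 2 ≤ d} {S S' S'' : PlaneState ι} {T T₁ T₂ : ℝ} {N₁ N₂ : ℕ}

theorem trans (h₁ : PlaneEvo hd S T₁ N₁ S') (h₂ : PlaneEvo hd S' T₂ N₂ S'') :
    PlaneEvo hd S (T₁ + T₂) (N₁ + N₂) S'' := Evo.trans h₁ h₂

theorem free (hT : 0 < T) (h : ∀ s ∈ Icc 0 T, ∀ i j, i ≠ j → 4 < (S.fly s).sq i j) :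
    PlaneEvo hd S T 0 (S.fly T) := by
  have := Evo.of_apart (x := S.pos hd) (v := S.vel hd) hT (fun s hs i j hij => by
    simp only [← PlaneState.pos_fly]
    exact PlaneState.two_lt_dist hd _ (h s hs i j hij))
  unfold PlaneEvo
  rwa [← (funext fun i => PlaneState.pos_fly hd S i T : (S.fly T).pos hd = _)] at this

/-- Only the other pairs need separation hypotheses. The squared distance of `i` and `j` is a
quadratic polynomial in time with nonnegative leading coefficient, equal to 4 at contact with
negative derivative; the collision reverses the derivative. So it exceeds 4 at all other times. -/
theorem single [DecidableEq ι] {t : ℝ} (ht : 0 < t) (htT : t < T) {i j : ι} (hij : i ≠ j)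
    (hcontact : (S.fly t).sq i j = 4) (hslope : (S.fly t).slope i j < 0)
    (hbefore : ∀ s ∈ Icc 0 t, ∀ k l, k ≠ l → ¬ (k = i ∧ l = j) → ¬ (k = j ∧ l = i) →
      4 < (S.fly s).sq k l)
    (hafter : ∀ s ∈ Icc 0 (T - t), ∀ k l, k ≠ l → ¬ (k = i ∧ l = j) → ¬ (k = j ∧ l = i) →
      4 < (((S.fly t).coll i j).fly s).sq k l) :
    PlaneEvo hd S T 1 (((S.fly t).coll i j).fly (T - t)) := by
  set C := (S.fly t).coll i j with hC
  have hb : ∀ s < t, 4 < (S.fly s).sq i j := by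
    intro s hs
    have e : S.fly s = (S.fly t).fly (s - t) := by rw [PlaneState.fly_fly]; congr 1; ring
    rw [e, PlaneState.sq_fly, hcontact]
    have h1 : 0 < (s - t) * (S.fly t).slope i j := mul_pos_of_neg_of_neg (by linarith) hslope
    have h2 : 0 ≤ (s - t) ^ 2 *
      (((S.fly t).u i - (S.fly t).u j) ^ 2 + ((S.fly t).w i - (S.fly t).w j) ^ 2) := by positivity
    linarith
  have ha : ∀ s, 0 < s → 4 < (C.fly s).sq i j := by
    intro s hs
    have e : C.sq i j = 4 := hcontact
    rw [PlaneState.sq_fly, e, hC, PlaneState.slope_coll _ hij hcontact, ← hC]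
    have h1 : 0 < s * -(S.fly t).slope i j := mul_pos hs (by linarith)
    have h2 : 0 ≤ s ^ 2 * ((C.u i - C.u j) ^ 2 + (C.w i - C.w j) ^ 2) := by positivity
    linarith
  have hp : ∀ k, S.pos hd k + t • S.vel hd k = C.pos hd k := fun k =>
    (PlaneState.pos_fly hd S k t).symm
  have hp' : ∀ s k, S.pos hd k + t • S.vel hd k + s • C.vel hd k = (C.fly s).pos hd k := by
    intro s k; rw [hp, PlaneState.pos_fly]
  have hsub : ∀ a b : ι, C.pos hd a - C.pos hd b = planeVec hd (C.x a - C.x b) (C.y a - C.y b) :=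
    fun a b => planeVec_sub _ _ _ _ _
  have hproj : ∀ a b : ι, C.sq a b = 4 →
      projAlong (S.pos hd a + t • S.vel hd a - (S.pos hd b + t • S.vel hd b))
        (S.vel hd a - S.vel hd b) = planeVec hd ((S.fly t).slope a b / 4 * (C.x a - C.x b))
          ((S.fly t).slope a b / 4 * (C.y a - C.y b)) := by
    intro a b hab
    rw [hp, hp, hsub, projAlong, planeVec_norm_sq]
    have : (C.x a - C.x b) ^ 2 + (C.y a - C.y b) ^ 2 = 4 := hab
    rw [this, PlaneState.vel, PlaneState.vel, planeVec_sub, planeVec_inner, planeVec_smul]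
    rfl
  have hgne : ∀ a b : ι, C.sq a b = 4 → (S.fly t).slope a b ≠ 0 →
      planeVec hd ((S.fly t).slope a b / 4 * (C.x a - C.x b))
          ((S.fly t).slope a b / 4 * (C.y a - C.y b)) ≠ 0 := by
    intro a b hab hs h0
    have : ((S.fly t).slope a b / 4) ^ 2 * C.sq a b = 0 := by
      have := planeVec_norm_sq hd ((S.fly t).slope a b / 4 * (C.x a - C.x b))
          ((S.fly t).slope a b / 4 * (C.y a - C.y b))
      rw [h0, norm_zero] at this
      unfold PlaneState.sq
      linarith
    rw [hab] at this
    apply hs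
    have h2 : ((S.fly t).slope a b) ^ 2 = 0 := by linarith
    exact pow_eq_zero_iff (two_ne_zero) |>.1 h2
  have hsji : (S.fly t).slope j i = (S.fly t).slope i j := by unfold PlaneState.slope; ring
  have hvi : C.vel hd i = S.vel hd i -
      projAlong (S.pos hd i + t • S.vel hd i - (S.pos hd j + t • S.vel hd j))
        (S.vel hd i - S.vel hd j) := by
    rw [hproj i j hcontact, PlaneState.vel, PlaneState.vel, planeVec_sub]
    simp [hC, PlaneState.coll, PlaneState.fly]
  have hcontact' : C.sq j i = 4 := by rw [PlaneState.sq_comm]; exact hcontact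
  have hvj : C.vel hd j = S.vel hd j -
      projAlong (S.pos hd j + t • S.vel hd j - (S.pos hd i + t • S.vel hd i))
        (S.vel hd j - S.vel hd i) := by
    rw [hproj j i hcontact', PlaneState.vel, PlaneState.vel, planeVec_sub, hsji]
    simp only [hC, PlaneState.coll, PlaneState.fly, hij.symm, if_true, if_false]
    congr 1 <;> ring
  have key := Evo.of_collision (x := S.pos hd) (v := S.vel hd) (v' := C.vel hd) ht htT hij
    (fun s hs k l hkl => ?_) ?_ (fun k l hkl h1 h2 => ?_) (fun s hs k l hkl => ?_) hvi hvj
    (fun k hki hkj => by simp [hC, PlaneState.vel, PlaneState.coll, PlaneState.fly, hki, hkj])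
    ?_ ?_
  · simp only [hp'] at key
    exact key
  · simp only [← PlaneState.pos_fly]
    apply PlaneState.two_lt_dist
    by_cases h1 : k = i ∧ l = j
    · rw [h1.1, h1.2]; exact hb s hs.2
    by_cases h2 : k = j ∧ l = i
    · rw [h2.1, h2.2, PlaneState.sq_comm]; exact hb s hs.2
    exact hbefore s ⟨hs.1, hs.2.le⟩ k l hkl h1 h2
  · rw [hp, hp]; exact PlaneState.dist_eq_two hd C hcontact
  · rw [hp, hp]; exact PlaneState.two_lt_dist hd C (hbefore t ⟨ht.le, le_rfl⟩ k l hkl h1 h2)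
  · simp only [hp']
    apply PlaneState.two_lt_dist
    by_cases h1 : k = i ∧ l = j
    · rw [h1.1, h1.2]; exact ha s hs.1
    by_cases h2 : k = j ∧ l = i
    · rw [h2.1, h2.2, PlaneState.sq_comm]; exact ha s hs.1
    exact hafter s ⟨hs.1.le, hs.2⟩ k l hkl h1 h2
  · rw [hvi, hproj i j hcontact]
    intro h; exact hgne i j hcontact hslope.ne (by simpa using h)
  · rw [hvj, hproj j i hcontact']
    intro h; exact hgne j i hcontact' (by rw [hsji]; exact hslope.ne) (by simpa using h)

theorem le_maxCollisions {n N : ℕ} (h : PlaneEvo hd S T N S') (e : Fin n ≃ ι) :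
    (N : ℕ∞) ≤ maxCollisions n d := Evo.le_maxCollisions h e

end PlaneEvo

/-! ### Scaling near tangency. -/

namespace PlaneState

variable {ι : Type*}

/-- The configuration in which a state is a perturbation of the centres `(bx, by)`, of size
`lam ^ 2` horizontally and `lam` vertically. -/
def unscale (lam : ℝ) (bx bY : ι → ℝ) (σ : PlaneState ι) : PlaneState ι :=
  ⟨fun i => bx i + lam ^ 2 * σ.x i, fun i => bY i + lam * σ.y i, fun i => lam * σ.u i, σ.w⟩

/-- The gap function of a horizontally adjacent pair; `κ = lam ^ 2`. -/
noncomputable def gap (κ : ℝ) (σ : PlaneState ι) (i j : ι) : ℝ :=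
  (σ.x j - σ.x i) + (σ.y j - σ.y i) ^ 2 / 4 + κ * (σ.x j - σ.x i) ^ 2 / 4

/-- The time derivative of `gap`. -/
noncomputable def gapRate (κ : ℝ) (σ : PlaneState ι) (i j : ι) : ℝ :=
  (σ.u j - σ.u i) * (1 + κ * (σ.x j - σ.x i) / 2) + (σ.w j - σ.w i) * (σ.y j - σ.y i) / 2

/-- Half of the second derivative of `gap`. -/
noncomputable def gapCurv (κ : ℝ) (σ : PlaneState ι) (i j : ι) : ℝ :=
  (σ.w j - σ.w i) ^ 2 / 4 + κ * (σ.u j - σ.u i) ^ 2 / 4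

/-- The elastic collision in scaled coordinates. -/
noncomputable def bounce [DecidableEq ι] (κ : ℝ) (σ : PlaneState ι) (i j : ι) : PlaneState ι :=
  ⟨σ.x, σ.y,
    fun k => if k = i then σ.u i + σ.gapRate κ i j * (1 + κ * (σ.x j - σ.x i) / 2) else
      if k = j then σ.u j - σ.gapRate κ i j * (1 + κ * (σ.x j - σ.x i) / 2) else σ.u k,
    fun k => if k = i then σ.w i + κ * (σ.gapRate κ i j * (σ.y j - σ.y i) / 2) else
      if k = j then σ.w j - κ * (σ.gapRate κ i j * (σ.y j - σ.y i) / 2) else σ.w k⟩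

theorem gap_fly (κ : ℝ) (σ : PlaneState ι) (i j : ι) (s : ℝ) : (σ.fly s).gap κ i j =
    σ.gapCurv κ i j * s ^ 2 + σ.gapRate κ i j * s + σ.gap κ i j := by
  simp only [gap, gapRate, gapCurv, fly]; ring

theorem gapRate_fly (κ : ℝ) (σ : PlaneState ι) (i j : ι) (s : ℝ) : (σ.fly s).gapRate κ i j =
    2 * σ.gapCurv κ i j * s + σ.gapRate κ i j := by
  simp only [gapRate, gapCurv, fly]; ring

theorem unscale_fly (lam : ℝ) (bx bY : ι → ℝ) (σ : PlaneState ι) (s : ℝ) :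
    unscale lam bx bY (σ.fly s) = (unscale lam bx bY σ).fly (lam * s) := by
  simp only [unscale, fly, mk.injEq, and_true]
  constructor <;> funext i <;> ring

/-- This is the reason for the scaling: horizontal displacements of order `lam²` and vertical ones
of order `lam` both change the squared distance at order `lam²`. The identity is exact, and its
right side makes sense in the limit, where the last term of `gap` disappears. -/
theorem sq_unscale {lam : ℝ} {bx bY : ι → ℝ} (σ : PlaneState ι) {i j : ι} (hx : bx j = bx i + 2)
    (hy : bY j = bY i) : (unscale lam bx bY σ).sq i j = 4 + 4 * lam ^ 2 * σ.gap (lam ^ 2) i j := by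
  simp only [unscale, sq, gap, hx, hy]; ring

theorem slope_unscale {lam : ℝ} {bx bY : ι → ℝ} (σ : PlaneState ι) {i j : ι} (hx : bx j = bx i + 2)
    (hy : bY j = bY i) :
    (unscale lam bx bY σ).slope i j = 2 * lam * σ.gapRate (lam ^ 2) i j := by
  simp only [unscale, slope, gapRate, hx, hy]; ring

/-- Exact for every `lam`, so the true collision is a continuous perturbation of the limiting one.
In `bounce` the vertical impulse carries the factor `κ` and vanishes in the limit. -/
theorem unscale_bounce [DecidableEq ι] {lam : ℝ} {bx bY : ι → ℝ} (σ : PlaneState ι) {i j : ι}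
    (hx : bx j = bx i + 2) (hy : bY j = bY i) :
    unscale lam bx bY (σ.bounce (lam ^ 2) i j) = (unscale lam bx bY σ).coll i j := by
  have h := slope_unscale σ hx hy (lam := lam)
  simp only [coll, h]
  simp only [unscale, bounce, mk.injEq, hx, hy, true_and]
  constructor <;> funext k <;> split_ifs <;> ring

/-- Pointwise convergence of states. -/
def Conv {P : Type*} (S : P → PlaneState ι) (F : Filter P) (σ : PlaneState ι) : Prop :=
  ∀ i, Tendsto (fun p => (S p).x i) F (𝓝 (σ.x i)) ∧ Tendsto (fun p => (S p).y i) F (𝓝 (σ.y i)) ∧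
    Tendsto (fun p => (S p).u i) F (𝓝 (σ.u i)) ∧ Tendsto (fun p => (S p).w i) F (𝓝 (σ.w i))

section Conv
variable {P : Type*} {F : Filter P} {S : P → PlaneState ι} {σ : PlaneState ι} {κ : P → ℝ} {k : ℝ}

theorem Conv.fly (h : Conv S F σ) {τ : P → ℝ} {t : ℝ} (hτ : Tendsto τ F (𝓝 t)) :
    Conv (fun p => (S p).fly (τ p)) F (σ.fly t) := fun i =>
  ⟨(h i).1.add (hτ.mul (h i).2.2.1), (h i).2.1.add (hτ.mul (h i).2.2.2), (h i).2.2.1, (h i).2.2.2⟩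

theorem Conv.gap (h : Conv S F σ) (hκ : Tendsto κ F (𝓝 k)) (i j : ι) :
    Tendsto (fun p => (S p).gap (κ p) i j) F (𝓝 (σ.gap k i j)) :=
  (((h j).1.sub (h i).1).add ((((h j).2.1.sub (h i).2.1).pow 2).div_const 4)).add
    ((hκ.mul (((h j).1.sub (h i).1).pow 2)).div_const 4)

theorem Conv.gapRate (h : Conv S F σ) (hκ : Tendsto κ F (𝓝 k)) (i j : ι) :
    Tendsto (fun p => (S p).gapRate (κ p) i j) F (𝓝 (σ.gapRate k i j)) :=
  (((h j).2.2.1.sub (h i).2.2.1).mul (tendsto_const_nhds.add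
    ((hκ.mul ((h j).1.sub (h i).1)).div_const 2))).add
    ((((h j).2.2.2.sub (h i).2.2.2).mul ((h j).2.1.sub (h i).2.1)).div_const 2)

theorem Conv.gapCurv (h : Conv S F σ) (hκ : Tendsto κ F (𝓝 k)) (i j : ι) :
    Tendsto (fun p => (S p).gapCurv (κ p) i j) F (𝓝 (σ.gapCurv k i j)) :=
  ((((h j).2.2.2.sub (h i).2.2.2).pow 2).div_const 4).add
    ((hκ.mul (((h j).2.2.1.sub (h i).2.2.1).pow 2)).div_const 4)

theorem Conv.bounce [DecidableEq ι] (h : Conv S F σ) (hκ : Tendsto κ F (𝓝 k)) (i j : ι) :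
    Conv (fun p => (S p).bounce (κ p) i j) F (σ.bounce k i j) := by
  have hf : Tendsto (fun p => (S p).gapRate (κ p) i j * (1 + κ p * ((S p).x j - (S p).x i) / 2)) F
      (𝓝 (σ.gapRate k i j * (1 + k * (σ.x j - σ.x i) / 2))) :=
    (h.gapRate hκ i j).mul (tendsto_const_nhds.add ((hκ.mul ((h j).1.sub (h i).1)).div_const 2))
  have hg : Tendsto (fun p => κ p * ((S p).gapRate (κ p) i j * ((S p).y j - (S p).y i) / 2)) F
      (𝓝 (k * (σ.gapRate k i j * (σ.y j - σ.y i) / 2))) :=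
    hκ.mul (((h.gapRate hκ i j).mul ((h j).2.1.sub (h i).2.1)).div_const 2)
  intro l
  refine ⟨(h l).1, (h l).2.1, ?_, ?_⟩
  · by_cases hi : l = i
    · simpa [PlaneState.bounce, hi] using (h i).2.2.1.add hf
    by_cases hj : l = j
    · simpa [PlaneState.bounce, hi, hj, hj ▸ hi] using (h j).2.2.1.sub hf
    · simpa [PlaneState.bounce, hi, hj] using (h l).2.2.1
  · by_cases hi : l = i
    · simpa [PlaneState.bounce, hi] using (h i).2.2.2.add hg
    by_cases hj : l = j
    · simpa [PlaneState.bounce, hi, hj, hj ▸ hi] using (h j).2.2.2.sub hg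
    · simpa [PlaneState.bounce, hi, hj] using (h l).2.2.2

end Conv

end PlaneState

/-! ### Stability, the limiting system and its shadowing by hard balls. -/

/-- By compactness of the interval, an open condition that holds for all `θ` persists near `x₀`. The
interval is normalised because in the applications its length varies with the parameter. -/
theorem eventually_pos_Icc {P X : Type*} [TopologicalSpace X] {F : Filter P} {h : X → ℝ → ℝ}
    (hc : Continuous (Function.uncurry h)) {x : P → X} {x₀ : X} (hx : Tendsto x F (𝓝 x₀))
    (h₀ : ∀ θ ∈ Icc (0 : ℝ) 1, 0 < h x₀ θ) : ∀ᶠ p in F, ∀ θ ∈ Icc (0 : ℝ) 1, 0 < h (x p) θ := by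
  refine hx.eventually (isCompact_Icc.eventually_forall_of_forall_eventually
    (P := fun x θ => 0 < h x θ) fun θ hθ => ?_)
  exact hc.continuousAt.eventually (lt_mem_nhds (h₀ θ hθ))

/-- Positivity of a quadratic polynomial on `[0, t]` is stable. -/
theorem eventually_quadratic_pos {P : Type*} {F : Filter P} {A B C τ : P → ℝ} {a b c t : ℝ}
    (hA : Tendsto A F (𝓝 a)) (hB : Tendsto B F (𝓝 b)) (hC : Tendsto C F (𝓝 c))
    (hτ : Tendsto τ F (𝓝 t)) (ht : 0 < t) (h : ∀ s ∈ Icc 0 t, 0 < a * s ^ 2 + b * s + c) :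
    ∀ᶠ p in F, ∀ s ∈ Icc 0 (τ p), 0 < A p * s ^ 2 + B p * s + C p := by
  have key := eventually_pos_Icc (X := ℝ × ℝ × ℝ × ℝ)
    (h := fun x θ => x.1 * (θ * x.2.2.2) ^ 2 + x.2.1 * (θ * x.2.2.2) + x.2.2.1)
    (by unfold Function.uncurry; fun_prop)
    (hA.prodMk_nhds (hB.prodMk_nhds (hC.prodMk_nhds hτ)))
    (fun θ hθ => h _ ⟨mul_nonneg hθ.1 ht.le, by nlinarith [hθ.2]⟩)
  filter_upwards [key, hτ.eventually (lt_mem_nhds ht)] with p hp hpos s hs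
  have := hp (s / τ p) ⟨div_nonneg hs.1 hpos.le, (div_le_one hpos).2 hs.2⟩
  rwa [div_mul_cancel₀ _ hpos.ne'] at this

/-- A simple root of a quadratic polynomial is stable. -/
theorem exists_quadratic_root {P : Type*} {F : Filter P} {A B C : P → ℝ} {a b c t : ℝ}
    (hA : Tendsto A F (𝓝 a)) (hB : Tendsto B F (𝓝 b)) (hC : Tendsto C F (𝓝 c))
    (h₀ : a * t ^ 2 + b * t + c = 0) (h₁ : 2 * a * t + b < 0) :
    ∃ τ : P → ℝ, Tendsto τ F (𝓝 t) ∧ ∀ᶠ p in F, A p * τ p ^ 2 + B p * τ p + C p = 0 := by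
  have hm : Tendsto (fun p => -(2 * A p * t + B p)) F (𝓝 (-(2 * a * t + b))) :=
    (((hA.const_mul 2).mul_const t).add hB).neg
  have hc : Tendsto (fun p => A p * t ^ 2 + B p * t + C p) F (𝓝 0) := by
    rw [← h₀]; exact ((hA.mul_const _).add (hB.mul_const _)).add hC
  set m := fun p => -(2 * A p * t + B p) with hm_def
  set e := fun p => A p * t ^ 2 + B p * t + C p with he_def
  have hD : Tendsto (fun p => m p ^ 2 - 4 * A p * e p) F (𝓝 ((-(2 * a * t + b)) ^ 2)) := by
    simpa using (hm.pow 2).sub ((hA.const_mul 4).mul hc)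
  have hmpos : 0 < -(2 * a * t + b) := by linarith
  -- The smaller root of `A x² - m x + e`, with rationalised numerator: its denominator stays near
  -- twice the positive limit of `m`, even when `A` tends to 0 as it does for two balls without
  -- relative vertical motion.
  refine ⟨fun p => t + 2 * e p / (m p + √(m p ^ 2 - 4 * A p * e p)), ?_, ?_⟩
  · have := (tendsto_const_nhds (x := t)).add ((hc.const_mul 2).div (hm.add hD.sqrt) ?_)
    · simpa using this
    · have := Real.sqrt_nonneg ((-(2 * a * t + b)) ^ 2)
      positivity
  · filter_upwards [hm.eventually (lt_mem_nhds hmpos),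
      hD.eventually (lt_mem_nhds (pow_pos hmpos 2))] with p h1 h2
    have hs := Real.sq_sqrt h2.le
    have hs0 := Real.sqrt_nonneg (m p ^ 2 - 4 * A p * e p)
    set D := √(m p ^ 2 - 4 * A p * e p)
    have hne : m p + D ≠ 0 := by positivity
    have e1 : A p * (t + 2 * e p / (m p + D)) ^ 2 + B p * (t + 2 * e p / (m p + D)) + C p =
        A p * (2 * e p / (m p + D)) ^ 2 - m p * (2 * e p / (m p + D)) + e p := by
      simp only [hm_def, he_def]; ring
    rw [e1]
    field_simp
    linear_combination e p * hs

/-- Evolutions of the limiting system `lam = 0`, in which only the pairs in `adj` interact. -/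
inductive LimitEvo {ι : Type*} [DecidableEq ι] (adj : ι → ι → Prop) :
    PlaneState ι → ℝ → ℕ → PlaneState ι → Prop
  | free {σ : PlaneState ι} {T : ℝ} (hT : 0 < T)
      (h : ∀ i j, adj i j → ∀ s ∈ Icc 0 T, 0 < (σ.fly s).gap 0 i j) :
      LimitEvo adj σ T 0 (σ.fly T)
  | single {σ : PlaneState ι} {t T : ℝ} {i j : ι} (ht : 0 < t) (htT : t < T) (hij : adj i j)
      (hcontact : (σ.fly t).gap 0 i j = 0) (hrate : (σ.fly t).gapRate 0 i j < 0)
      (hbefore : ∀ k l, adj k l → ¬ (k = i ∧ l = j) → ∀ s ∈ Icc 0 t, 0 < (σ.fly s).gap 0 k l)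
      (hafter : ∀ k l, adj k l → ¬ (k = i ∧ l = j) → ∀ s ∈ Icc 0 (T - t),
        0 < (((σ.fly t).bounce 0 i j).fly s).gap 0 k l) :
      LimitEvo adj σ T 1 (((σ.fly t).bounce 0 i j).fly (T - t))
  | trans {σ σ' σ'' : PlaneState ι} {T₁ T₂ : ℝ} {N₁ N₂ : ℕ} (h₁ : LimitEvo adj σ T₁ N₁ σ')
      (h₂ : LimitEvo adj σ' T₂ N₂ σ'') : LimitEvo adj σ (T₁ + T₂) (N₁ + N₂) σ''

namespace PlaneState

variable {ι P : Type*} {F : Filter P}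

theorem Conv.eventually_gap_pos {S : P → PlaneState ι} {σ : PlaneState ι} (h : Conv S F σ)
    {κ τ : P → ℝ} {t : ℝ} (hκ : Tendsto κ F (𝓝 0)) (hτ : Tendsto τ F (𝓝 t)) (ht : 0 < t)
    {i j : ι} (hpos : ∀ s ∈ Icc 0 t, 0 < (σ.fly s).gap 0 i j) :
    ∀ᶠ p in F, ∀ s ∈ Icc 0 (τ p), 0 < ((S p).fly s).gap (κ p) i j := by
  simp only [gap_fly] at hpos ⊢
  exact eventually_quadratic_pos (h.gapCurv hκ i j) (h.gapRate hκ i j) (h.gap hκ i j) hτ ht hpos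

theorem Conv.eventually_far {S : P → PlaneState ι} {σ : PlaneState ι} (h : Conv S F σ)
    {lam τ : P → ℝ} {t : ℝ} (hlam : Tendsto lam F (𝓝 0)) (hτ : Tendsto τ F (𝓝 t)) (ht : 0 < t)
    {bx bY : P → ι → ℝ} {cx cy : ι → ℝ} (hbx : ∀ i, Tendsto (fun p => bx p i) F (𝓝 (cx i)))
    (hbY : ∀ i, Tendsto (fun p => bY p i) F (𝓝 (cy i))) {i j : ι}
    (hfar : 4 < (cx i - cx j) ^ 2 + (cy i - cy j) ^ 2) :
    ∀ᶠ p in F, ∀ s ∈ Icc 0 (τ p), 4 < (unscale (lam p) (bx p) (bY p) ((S p).fly s)).sq i j := by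
  have key := eventually_pos_Icc (X := (ℝ × ℝ) × (ℝ × ℝ × ℝ × ℝ) × ℝ × ℝ)
    (h := fun x θ =>
      (x.1.1 + x.2.2.1 ^ 2 * (x.2.1.1 + θ * x.2.2.2 * x.2.1.2.1)) ^ 2 +
      (x.1.2 + x.2.2.1 * (x.2.1.2.2.1 + θ * x.2.2.2 * x.2.1.2.2.2)) ^ 2 - 4)
    (by unfold Function.uncurry; fun_prop)
    ((((hbx i).sub (hbx j)).prodMk_nhds ((hbY i).sub (hbY j))).prodMk_nhds
      ((((h i).1.sub (h j).1).prodMk_nhds (((h i).2.2.1.sub (h j).2.2.1).prodMk_nhds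
        (((h i).2.1.sub (h j).2.1).prodMk_nhds ((h i).2.2.2.sub (h j).2.2.2)))).prodMk_nhds
        (hlam.prodMk_nhds hτ)))
    (fun θ hθ => by simp only; nlinarith [hfar])
  filter_upwards [key, hτ.eventually (lt_mem_nhds ht)] with p hp hpos s hs
  have := hp (s / τ p) ⟨div_nonneg hs.1 hpos.le, (div_le_one hpos).2 hs.2⟩
  simp only [div_mul_cancel₀ _ hpos.ne'] at this
  simp only [unscale, sq, PlaneState.fly]
  linarith

end PlaneState

open PlaneState in
/-- Evolutions of the limiting system are shadowed by evolutions of hard balls. -/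
theorem LimitEvo.exists_planeEvo {ι P : Type*} [DecidableEq ι] [Finite ι] {F : Filter P} {d : ℕ}
    (hd : 2 ≤ d) {adj : ι → ι → Prop} {lam : P → ℝ} (hlam : Tendsto lam F (𝓝 0))
    (hlam' : ∀ᶠ p in F, 0 < lam p) {bx bY : P → ι → ℝ} {cx cy : ι → ℝ}
    (hbx : ∀ i, Tendsto (fun p => bx p i) F (𝓝 (cx i)))
    (hbY : ∀ i, Tendsto (fun p => bY p i) F (𝓝 (cy i)))
    (hadj : ∀ i j, adj i j → ∀ p, bx p j = bx p i + 2 ∧ bY p j = bY p i)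
    (hne : ∀ i j, adj i j → i ≠ j)
    (hfar : ∀ i j, i ≠ j → ¬ adj i j → ¬ adj j i → 4 < (cx i - cx j) ^ 2 + (cy i - cy j) ^ 2)
    {σ σ' : PlaneState ι} {T : ℝ} {N : ℕ} (h : LimitEvo adj σ T N σ') :
    ∀ S : P → PlaneState ι, Conv S F σ → ∃ S' : P → PlaneState ι, Conv S' F σ' ∧
      (∀ k, (∀ j, ¬ adj k j ∧ ¬ adj j k) → ∀ p, (S' p).x k = (S p).x k + T * (S p).u k ∧
        (S' p).y k = (S p).y k + T * (S p).w k ∧ (S' p).u k = (S p).u k ∧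
        (S' p).w k = (S p).w k) ∧
      (∀ k, Tendsto (fun p => ((S' p).w k - (S p).w k) / lam p) F (𝓝 0)) ∧
      ∀ᶠ p in F, PlaneEvo hd (unscale (lam p) (bx p) (bY p) (S p)) (lam p * T) N
        (unscale (lam p) (bx p) (bY p) (S' p)) := by
  have hκ : Tendsto (fun p => lam p ^ 2) F (𝓝 0) := by simpa using hlam.pow 2
  -- Neighbours are separated by stability of the limiting gap; all other pairs have base points at
  -- distance more than 2 and are moved by little.
  have sep : ∀ {S : P → PlaneState ι} {σ : PlaneState ι}, Conv S F σ → ∀ {τ : P → ℝ} {t : ℝ},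
      Tendsto τ F (𝓝 t) → 0 < t → ∀ i j, i ≠ j →
      (adj i j → ∀ s ∈ Icc 0 t, 0 < (σ.fly s).gap 0 i j) →
      (adj j i → ∀ s ∈ Icc 0 t, 0 < (σ.fly s).gap 0 j i) →
      ∀ᶠ p in F, ∀ s ∈ Icc 0 (lam p * τ p),
        4 < ((unscale (lam p) (bx p) (bY p) (S p)).fly s).sq i j := by
    intro S σ hS τ t hτ ht i j hij h1 h2
    have main : ∀ᶠ p in F, ∀ s ∈ Icc 0 (τ p),
        4 < (unscale (lam p) (bx p) (bY p) ((S p).fly s)).sq i j := by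
      by_cases hA : adj i j
      · filter_upwards [hS.eventually_gap_pos hκ hτ ht (h1 hA), hlam'] with p hp hp' s hs
        rw [sq_unscale _ (hadj i j hA p).1 (hadj i j hA p).2]
        have := hp s hs
        have : 0 < 4 * lam p ^ 2 * ((S p).fly s).gap (lam p ^ 2) i j := by positivity
        linarith
      by_cases hB : adj j i
      · filter_upwards [hS.eventually_gap_pos hκ hτ ht (h2 hB), hlam'] with p hp hp' s hs
        rw [sq_comm, sq_unscale _ (hadj j i hB p).1 (hadj j i hB p).2]
        have := hp s hs
        have : 0 < 4 * lam p ^ 2 * ((S p).fly s).gap (lam p ^ 2) j i := by positivity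
        linarith
      · exact hS.eventually_far hlam hτ ht hbx hbY (hfar i j hij hA hB)
    filter_upwards [main, hlam'] with p hp hp' s hs
    have := hp (s / lam p) ⟨div_nonneg hs.1 hp'.le, by rw [div_le_iff₀ hp']; linarith [hs.2]⟩
    rwa [unscale_fly, mul_div_cancel₀ _ hp'.ne'] at this
  induction h with
  | @free σ T hT h =>
    intro S hS
    refine ⟨fun p => (S p).fly T, hS.fly tendsto_const_nhds, fun k _ p => ⟨rfl, rfl, rfl, rfl⟩,
      fun k => by simpa [PlaneState.fly] using tendsto_const_nhds, ?_⟩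
    have h1 : ∀ᶠ p in F, ∀ i j, i ≠ j → ∀ s ∈ Icc 0 (lam p * T),
        4 < ((unscale (lam p) (bx p) (bY p) (S p)).fly s).sq i j := by
      rw [eventually_all]; intro i
      rw [eventually_all]; intro j
      rw [eventually_imp_distrib_left]; intro hij
      exact sep hS (τ := fun _ => T) tendsto_const_nhds hT i j hij (h i j) (h j i)
    filter_upwards [h1, hlam'] with p hp hp'
    rw [unscale_fly]
    exact PlaneEvo.free (by positivity) fun s hs i j hij => hp i j hij s hs
  | @single σ t T i j ht htT hij hcontact hrate hbefore hafter =>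
    intro S hS
    rw [gap_fly] at hcontact
    rw [gapRate_fly] at hrate
    obtain ⟨τ, hτ, hroot⟩ := exists_quadratic_root (hS.gapCurv hκ i j) (hS.gapRate hκ i j)
      (hS.gap hκ i j) hcontact hrate
    have hS1 := hS.fly hτ
    have hS2 := hS1.bounce hκ i j
    have hTt : Tendsto (fun p => T - τ p) F (𝓝 (T - t)) := tendsto_const_nhds.sub hτ
    refine ⟨_, hS2.fly hTt, ?_, ?_, ?_⟩
    · intro k hk p
      have hki : k ≠ i := by rintro rfl; exact (hk j).1 hij
      have hkj : k ≠ j := by rintro rfl; exact (hk i).2 hij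
      simp only [PlaneState.fly, PlaneState.bounce, hki, hkj, if_false, and_self, and_true]
      constructor <;> ring
    · intro k
      -- The vertical impulse is `lam²` times a convergent quantity, hence negligible even after
      -- division by `lam`. The next passage needs this precision.
      have hg : Tendsto (fun p => lam p * ((((S p).fly (τ p)).gapRate (lam p ^ 2) i j *
          (((S p).fly (τ p)).y j - ((S p).fly (τ p)).y i) / 2))) F (𝓝 0) := by
        simpa using hlam.mul (((hS1.gapRate hκ i j).mul
          ((hS1 j).2.1.sub (hS1 i).2.1)).div_const 2)
      by_cases hki : k = i
      · refine hg.congr' ?_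
        filter_upwards [hlam'] with p hp
        simp only [PlaneState.fly, PlaneState.bounce, hki, if_true]
        field_simp
        ring
      by_cases hkj : k = j
      · refine (neg_zero (G := ℝ) ▸ hg.neg).congr' ?_
        filter_upwards [hlam'] with p hp
        simp only [PlaneState.fly, PlaneState.bounce, hkj, if_true, if_neg (hkj ▸ hki)]
        field_simp
        ring
      · simpa [PlaneState.fly, PlaneState.bounce, hki, hkj] using tendsto_const_nhds
    · have h1 : ∀ᶠ p in F, ∀ k l, k ≠ l → ¬ (k = i ∧ l = j) → ¬ (k = j ∧ l = i) →
          (∀ s ∈ Icc 0 (lam p * τ p),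
            4 < ((unscale (lam p) (bx p) (bY p) (S p)).fly s).sq k l) ∧
          ∀ s ∈ Icc 0 (lam p * (T - τ p)), 4 < ((unscale (lam p) (bx p) (bY p)
            (((S p).fly (τ p)).bounce (lam p ^ 2) i j)).fly s).sq k l := by
        rw [eventually_all]; intro k
        rw [eventually_all]; intro l
        rw [eventually_imp_distrib_left]; intro hkl
        rw [eventually_imp_distrib_left]; intro h1
        rw [eventually_imp_distrib_left]; intro h2
        have h2' : ¬ (l = i ∧ k = j) := fun h => h2 ⟨h.2, h.1⟩
        exact (sep hS hτ ht k l hkl (fun h => hbefore k l h h1) (fun h => hbefore l k h h2')).and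
          (sep hS2 hTt (by linarith) k l hkl (fun h => hafter k l h h1)
            (fun h => hafter l k h h2'))
      have hr := (hS1.gapRate hκ i j).eventually (gt_mem_nhds (by rwa [gapRate_fly]))
      filter_upwards [h1, hlam', hroot, hr, hτ.eventually (lt_mem_nhds ht),
        hτ.eventually (gt_mem_nhds htT)] with p hp hp' hroot hr h3 h4
      obtain ⟨hx, hy⟩ := hadj i j hij p
      have e1 : lam p * (T - τ p) = lam p * T - lam p * τ p := by ring
      rw [unscale_fly, unscale_bounce _ hx hy, unscale_fly, e1]
      refine PlaneEvo.single (by positivity) (by nlinarith) (hne i j hij) ?_ ?_ ?_ ?_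
      · rw [← unscale_fly, sq_unscale _ hx hy, gap_fly, hroot]; ring
      · rw [← unscale_fly, slope_unscale _ hx hy]
        exact mul_neg_of_pos_of_neg (by positivity) hr
      · exact fun s hs k l hkl h1 h2 => (hp k l hkl h1 h2).1 s hs
      · intro s hs k l hkl h1 h2
        rw [← e1] at hs
        have := (hp k l hkl h1 h2).2 s hs
        rwa [unscale_bounce _ hx hy, unscale_fly] at this
  | @trans σ σ' σ'' T₁ T₂ N₁ N₂ _ _ ih₁ ih₂ =>
    intro S hS
    obtain ⟨S', hS', hiso', hw', hev'⟩ := ih₁ S hS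
    obtain ⟨S'', hS'', hiso'', hw'', hev''⟩ := ih₂ S' hS'
    refine ⟨S'', hS'', fun k hk p => ?_, fun k => ?_, ?_⟩
    · obtain ⟨a1, a2, a3, a4⟩ := hiso' k hk p
      obtain ⟨b1, b2, b3, b4⟩ := hiso'' k hk p
      rw [b1, b2, b3, b4, a1, a2, a3, a4]
      refine ⟨by ring, by ring, rfl, rfl⟩
    · have := (hw' k).add (hw'' k)
      rw [add_zero] at this
      exact this.congr fun p => by ring
    · filter_upwards [hev', hev''] with p h1 h2
      rw [mul_add]; exact h1.trans h2

/-! ### The limiting system of two chains and a falling ball. -/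

/-- The sign of a side: `true` is the right, `false` the left. -/
def sideSign (b : Bool) : ℝ := if b then 1 else -1

theorem sideSign_mul_self (b : Bool) : sideSign b * sideSign b = 1 := by
  cases b <;> simp [sideSign]

theorem sideSign_not (b : Bool) : sideSign (!b) = -sideSign b := by
  cases b <;> simp [sideSign]

/-- The balls: two horizontal chains of `m` balls, and `c` balls falling between them. -/
abbrev Ball (m c : ℕ) := (Bool × Fin m) ⊕ Fin c

namespace Ball

variable {m c : ℕ}

/-- The falling ball `a`, followed by the balls of a chain. -/
def node (a : Fin c) (b : Bool) : ℕ → Ball m c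
  | 0 => Sum.inr a
  -- The value beyond the end of the chain is a default; `Adj` only uses `j < m`.
  | j + 1 => if h : j < m then Sum.inl (b, ⟨j, h⟩) else Sum.inr a

/-- The left ball of a pair of neighbours. -/
def leftOf (a : Fin c) (b : Bool) (j : ℕ) : Ball m c := if b then node a b j else node a b (j + 1)

/-- The right ball of a pair of neighbours. -/
def rightOf (a : Fin c) (b : Bool) (j : ℕ) : Ball m c := if b then node a b (j + 1) else node a b j

/-- Neighbours, when the ball `a` is between the chains. -/
def Adj (a : Fin c) (k l : Ball m c) : Prop :=
  ∃ b j, j < m ∧ k = leftOf a b j ∧ l = rightOf a b j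

/-- The state in which the balls of the chains have displacements `z` and velocities `s`
(in outward direction), and the ball `a` is at `(X, Y)` with velocity `(w, -1)`. -/
def conf (a : Fin c) (z s : Bool → ℕ → ℝ) (X w Y : ℝ) : PlaneState (Ball m c) where
  x := Sum.elim (fun k => sideSign k.1 * z k.1 k.2) fun k => if k = a then X else 0
  -- A falling ball other than `a` is measured from its own position at the start of the passage.
  -- There `Y = 2`, so it has moved by `Y - 2`.
  y := Sum.elim (fun _ => 0) fun k => if k = a then Y else Y - 2
  u := Sum.elim (fun k => sideSign k.1 * s k.1 k.2) fun k => if k = a then w else 0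
  w := Sum.elim (fun _ => 0) fun _ => -1

/-- The gap of the `j`-th pair of neighbours on a side. -/
noncomputable def gapAt (z : Bool → ℕ → ℝ) (X Y : ℝ) (b : Bool) : ℕ → ℝ
  | 0 => z b 0 - sideSign b * X + Y ^ 2 / 4
  | j + 1 => z b (j + 1) - z b j

/-- The rate of the gap of the `j`-th pair of neighbours on a side. -/
noncomputable def rateAt (s : Bool → ℕ → ℝ) (w Y : ℝ) (b : Bool) : ℕ → ℝ
  | 0 => s b 0 - sideSign b * w - Y / 2
  | j + 1 => s b (j + 1) - s b j

theorem conf_fly (a : Fin c) (z s : Bool → ℕ → ℝ) (X w Y t : ℝ) :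
    (conf a z s X w Y : PlaneState (Ball m c)).fly t =
      conf a (fun b j => z b j + t * s b j) s (X + t * w) w (Y - t) := by
  simp only [conf, PlaneState.fly, PlaneState.mk.injEq, and_true]
  constructor <;> funext k <;> rcases k with ⟨b, j⟩ | k
  · simp only [Sum.elim_inl]; ring
  · simp only [Sum.elim_inr]; split_ifs <;> ring
  · simp only [Sum.elim_inl]; ring
  · simp only [Sum.elim_inr]; split_ifs <;> ring

theorem gap_conf (a : Fin c) (z s : Bool → ℕ → ℝ) (X w Y : ℝ) (b : Bool) {j : ℕ} (hj : j < m) :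
    (conf a z s X w Y : PlaneState (Ball m c)).gap 0 (leftOf a b j) (rightOf a b j) =
      gapAt z X Y b j := by
  rcases j with _ | j
  · cases b <;> simp [PlaneState.gap, leftOf, rightOf, conf, node, hj, gapAt, sideSign]
    ring
  · have : j < m := by omega
    cases b <;> simp [PlaneState.gap, leftOf, rightOf, conf, node, hj, this, gapAt, sideSign]
    ring

theorem rate_conf (a : Fin c) (z s : Bool → ℕ → ℝ) (X w Y : ℝ) (b : Bool) {j : ℕ} (hj : j < m) :
    (conf a z s X w Y : PlaneState (Ball m c)).gapRate 0 (leftOf a b j) (rightOf a b j) =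
      rateAt s w Y b j := by
  rcases j with _ | j
  · cases b <;> simp [PlaneState.gapRate, leftOf, rightOf, conf, node, hj, rateAt, sideSign] <;> ring
  · have : j < m := by omega
    cases b <;> simp [PlaneState.gapRate, leftOf, rightOf, conf, node, hj, this, rateAt, sideSign]
    ring

/-- The outward velocities of the two balls are exchanged, up to the correction `Y / 2`, which is
the speed at which the parabola `Y² / 4` moves past a ball falling with speed 1. -/
theorem bounce_tip (hm : 0 < m) (a : Fin c) (z s : Bool → ℕ → ℝ) (X w Y : ℝ) (b : Bool)
    {s' : Bool → ℕ → ℝ} {w' : ℝ} (hs : ∀ e j, s' e j = if e = b ∧ j = 0 then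
      sideSign b * w + Y / 2 else s e j)
    (hw : w' = sideSign b * (s b 0 - Y / 2)) :
    (conf a z s X w Y : PlaneState (Ball m c)).bounce 0 (leftOf a b 0) (rightOf a b 0) =
      conf a z s' X w' Y := by
  have hr := rate_conf a z s X w Y b hm
  simp only [PlaneState.bounce, hr]
  subst hw
  simp only [conf, PlaneState.mk.injEq, true_and]
  constructor <;> funext k <;> rcases k with ⟨e, j, hj⟩ | k <;> cases b <;> (try cases e) <;>
    simp [leftOf, rightOf, node, hm, rateAt, sideSign, hs] <;> split_ifs <;> simp_all <;> ring

theorem bounce_chain (a : Fin c) (z s : Bool → ℕ → ℝ) (X w Y : ℝ) (b : Bool) {i : ℕ}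
    (hi : i + 1 < m) {s' : Bool → ℕ → ℝ} (hs : ∀ e j, s' e j = if e = b ∧ j = i then s b (i + 1) else
      if e = b ∧ j = i + 1 then s b i else s e j) :
    (conf a z s X w Y : PlaneState (Ball m c)).bounce 0 (leftOf a b (i + 1)) (rightOf a b (i + 1)) =
      conf a z s' X w Y := by
  have hr := rate_conf a z s X w Y b hi
  have hi' : i < m := by omega
  simp only [PlaneState.bounce, hr]
  simp only [conf, PlaneState.mk.injEq, true_and]
  constructor <;> funext k <;> rcases k with ⟨e, j, hj⟩ | k <;> cases b <;> (try cases e) <;>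
    simp [leftOf, rightOf, node, hi, hi', rateAt, sideSign, hs] <;> split_ifs <;> simp_all <;>
    ring_nf

theorem leftOf_ne_rightOf (a : Fin c) (b : Bool) {j : ℕ} (hj : j < m) :
    (leftOf a b j : Ball m c) ≠ rightOf a b j := by
  rcases j with _ | j
  · cases b <;> simp [leftOf, rightOf, node, hj]
  · have : j < m := by omega
    cases b <;> simp [leftOf, rightOf, node, hj, this]

/-- A collision in the limiting system, described by the state at the time of contact. -/
theorem limitEvo_single {a : Fin c} {z s s' : Bool → ℕ → ℝ} {X w w' Y t T : ℝ} (ht : 0 < t)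
    (hT : 0 < T) {b : Bool} {j : ℕ} (hj : j < m) (hcontact : gapAt z X Y b j = 0)
    (hrate : rateAt s w Y b j < 0)
    (hbounce : (conf a z s X w Y : PlaneState (Ball m c)).bounce 0 (leftOf a b j) (rightOf a b j) =
      conf a z s' X w' Y)
    (hbefore : ∀ r ∈ Icc (-t) 0, ∀ e i, i < m → ¬ (e = b ∧ i = j) →
      0 < gapAt (fun b j => z b j + r * s b j) (X + r * w) (Y - r) e i)
    (hafter : ∀ r ∈ Icc 0 T, ∀ e i, i < m → ¬ (e = b ∧ i = j) →
      0 < gapAt (fun b j => z b j + r * s' b j) (X + r * w') (Y - r) e i) :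
    LimitEvo (Adj a) (conf a (fun b j => z b j + (-t) * s b j) s (X + (-t) * w) w (Y - (-t)) :
        PlaneState (Ball m c)) (t + T) 1
      (conf a (fun b j => z b j + T * s' b j) s' (X + T * w') w' (Y - T)) := by
  have e1 : ∀ r, (conf a (fun b j => z b j + (-t) * s b j) s (X + (-t) * w) w (Y - (-t)) :
      PlaneState (Ball m c)).fly r =
      conf a (fun b j => z b j + (r - t) * s b j) s (X + (r - t) * w) w (Y - (r - t)) := by
    intro r
    rw [← conf_fly, ← conf_fly, PlaneState.fly_fly]; congr 1; ring
  have e2 : (conf a (fun b j => z b j + (-t) * s b j) s (X + (-t) * w) w (Y - (-t)) :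
      PlaneState (Ball m c)).fly t = conf a z s X w Y := by
    rw [e1]; simp
  have e3 : (conf a (fun b j => z b j + T * s' b j) s' (X + T * w') w' (Y - T) :
      PlaneState (Ball m c)) = (conf a z s' X w' Y).fly (t + T - t) := by
    rw [conf_fly, add_sub_cancel_left]
  have hne : ∀ (e : Bool) (i : ℕ), ¬ ((leftOf a e i : Ball m c) = leftOf a b j ∧
      (rightOf a e i : Ball m c) = rightOf a b j) → ¬ (e = b ∧ i = j) := by
    rintro e i h ⟨rfl, rfl⟩; exact h ⟨rfl, rfl⟩
  have key := LimitEvo.single (adj := Adj a) (σ := (conf a (fun b j => z b j + (-t) * s b j) s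
    (X + (-t) * w) w (Y - (-t)) : PlaneState (Ball m c))) (t := t) (T := t + T)
    (i := leftOf a b j) (j := rightOf a b j) ht (by linarith) ⟨b, j, hj, rfl, rfl⟩
    (by rw [e2, gap_conf a _ _ _ _ _ b hj, hcontact])
    (by rw [e2, rate_conf a _ _ _ _ _ b hj]; exact hrate) ?_ ?_
  · rwa [e2, hbounce, ← e3] at key
  · rintro k l ⟨e, i, hi, rfl, rfl⟩ h r hr
    rw [e1, gap_conf a _ _ _ _ _ e hi]
    exact hbefore _ ⟨by linarith [hr.1], by linarith [hr.2]⟩ e i hi (hne e i h)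
  · rintro k l ⟨e, i, hi, rfl, rfl⟩ h r hr
    rw [e2, hbounce, conf_fly, gap_conf a _ _ _ _ _ e hi]
    exact hafter _ ⟨hr.1, by linarith [hr.2]⟩ e i hi (hne e i h)

end Ball

namespace Ball

variable {m c : ℕ}

set_option maxHeartbeats 600000 in
/-- The ball `a` hits a chain whose first `q + 1` balls are at rest; the resulting kick runs through
these balls. -/
theorem limitEvo_sweep (a : Fin c) (β : Bool) {q : ℕ} (hq : q < m) {z s : Bool → ℕ → ℝ}
    {X w Y τ K : ℝ} (hY : 0 < Y) (hτ : 0 < τ)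
    (hz : ∀ b j, j + 1 < m → z b j + (-τ) * s b j < z b (j + 1) + (-τ) * s b (j + 1))
    (hs : ∀ b j, j + 1 < m → s b j ≤ s b (j + 1)) (hs0 : ∀ j, j ≤ q → s β j = 0)
    (hcontact : gapAt z X Y β 0 = 0) (hw : 0 ≤ sideSign β * w)
    (hother : ∀ t ∈ Icc (-τ) 0,
      0 < gapAt (fun b j => z b j + t * s b j) (X + t * w) (Y - t) (!β) 0)
    (hK : K = sideSign β * w + Y / 2) (hmov : ∀ j, q < j → j < m → K < s β j)
    (hsweep : z β q < z β 0 + K * (Y / 2)) (hz0 : ∀ b, 0 ≤ z b 0) (hsn : 0 ≤ s (!β) 0) :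
    LimitEvo (Adj a) (conf a (fun b j => z b j + (-τ) * s b j) s (X + (-τ) * w) w (Y - (-τ)) :
        PlaneState (Ball m c)) (τ + Y / 2) (q + 1)
      (conf a (fun b j => if b = β then (if j < q then z β (j + 1) else
        if j = q then z β 0 + K * (Y / 2) else z β j + Y / 2 * s β j) else z b j + Y / 2 * s b j)
        (fun b j => if b = β then (if j < q then 0 else if j = q then K else s β j) else s b j)
        (X + Y / 2 * (-(sideSign β * (Y / 2)))) (-(sideSign β * (Y / 2))) (Y - Y / 2)) := by
  have hKpos : 0 < K := by rw [hK]; positivity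
  have hss := sideSign_mul_self β
  have ord : ∀ t, -τ ≤ t → ∀ b j, j + 1 < m → z b j + t * s b j < z b (j + 1) + t * s b (j + 1) := by
    intro t ht b j hj
    nlinarith [hz b j hj, hs b j hj]
  have ord0 : ∀ b j, j + 1 < m → z b j < z b (j + 1) := fun b j hj => by
    simpa using ord 0 (by linarith) b j hj
  have first : ∀ j, j + 1 < m → z β 0 < z β (j + 1) := by
    intro j
    induction j with
    | zero => exact ord0 β 0
    | succ j ih => exact fun hj => (ih (by omega)).trans (ord0 β (j + 1) hj)
  -- Positions at time `t` after contact, when the kick has reached ball `i`. The carrier of the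
  -- kick moves like a single particle with speed `K` started at `z β 0`; each earlier ball has
  -- stopped where it hit its neighbour, at the former place of that neighbour.
  set D : ℕ → ℝ → Bool → ℕ → ℝ := fun i t b j => if b = β then (if j < i then z β (j + 1) else
        if j = i then z β 0 + K * t else z β j + t * s β j) else z b j + t * s b j with hD
  set V : ℕ → Bool → ℕ → ℝ := fun i b j =>
    if b = β then (if j < i then 0 else if j = i then K else s β j) else s b j with hV
  have line : ∀ i t t' b j, D i t b j = D i t' b j + (t - t') * V i b j := by
    intro i t t' b j
    simp only [hD, hV]; split_ifs <;> ring
  have pos : ∀ i, i ≤ q → ∀ t, 0 ≤ t → t ≤ Y / 2 → (i < q → z β 0 + K * t ≤ z β (i + 1)) →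
      ∀ e k, k < m → (e = β → k = 0 → 0 < t) → (e = β → k = i → i ≠ 0 → z β i < z β 0 + K * t) →
      (e = β → k = i + 1 → i < q → z β 0 + K * t < z β (i + 1)) →
      0 < gapAt (D i t) (X + t * (-(sideSign β * (Y / 2)))) (Y - t) e k := by
    intro i hi t ht htY hle e k hk h1 h2 h3
    by_cases he : e = β
    · subst he
      rcases k with _ | k
      -- The tip never returns behind `z β 0`, and relative to that fixed place the falling ball
      -- leaves along the tangent of the parabola, so the gap is at least `t² / 4`.
      · have : z e 0 ≤ D i t e 0 := by
          simp only [hD, if_true]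
          split_ifs with h4 h5
          · exact (ord0 e 0 (by omega)).le
          · nlinarith
          · omega
        simp only [gapAt] at hcontact ⊢
        have h4 := h1 rfl rfl
        have : sideSign e * (X + t * -(sideSign e * (Y / 2))) = sideSign e * X - t * (Y / 2) := by
          linear_combination (-(t * (Y / 2))) * hss
        rw [this]
        linarith [mul_pos h4 h4]
      · simp only [gapAt, hD, if_true]
        rcases lt_trichotomy (k + 1) i with h | h | h
        · rw [if_pos h, if_pos (by omega)]
          linarith [ord0 e (k + 1) (by omega)]
        · rw [if_neg (by omega), if_pos h, if_pos (by omega)]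
          have := h2 rfl h (by omega)
          subst h; linarith
        · rw [if_neg (by omega), if_neg (by omega), if_neg (by omega)]
          by_cases hki : k = i
          · subst hki
            rw [if_pos rfl]
            rcases hi.lt_or_eq with h' | h'
            · rw [hs0 (k + 1) (by omega)]
              linarith [h3 rfl rfl h']
            · nlinarith [first k hk, hmov (k + 1) (by omega) hk]
          · rw [if_neg hki]
            linarith [ord t (by linarith) e k hk]
    · have hDe : ∀ j, D i t e j = z e j + t * s e j := fun j => by simp [hD, he]
      have heb : e = !β := Bool.eq_not.2 he
      rcases k with _ | k
      · simp only [gapAt, hDe] at hcontact ⊢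
        subst heb
        rw [sideSign_not]
        have : -sideSign β * (X + t * -(sideSign β * (Y / 2))) =
            -(sideSign β * X) + t * (Y / 2) := by
          linear_combination ((t * (Y / 2))) * hss
        rw [this]
        -- By the contact equation the opposite gap is at least `((2 * Y - t) ^ 2 - 2 * Y ^ 2) / 4`,
        -- which is positive for `t ≤ Y / 2`.
        have h5 : (3 / 2 * Y) ^ 2 ≤ (2 * Y - t) ^ 2 :=
          pow_le_pow_left₀ (by positivity) (by linarith) 2
        have h6 : 0 < Y ^ 2 := by positivity
        linarith [hz0 β, hz0 (!β), mul_nonneg ht hsn]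
      · simp only [gapAt, hDe]
        linarith [ord t (by linarith) e k hk]
  have step : ∀ i, i ≤ q → ∀ t, z β i < z β 0 + K * t → (i < q → z β 0 + K * t < z β (i + 1)) →
      0 < t → t ≤ Y / 2 →
      LimitEvo (Adj a) (conf a (fun b j => z b j + (-τ) * s b j) s (X + (-τ) * w) w (Y - (-τ)) :
        PlaneState (Ball m c)) (τ + t) (i + 1)
        (conf a (D i t) (V i) (X + t * (-(sideSign β * (Y / 2)))) (-(sideSign β * (Y / 2)))
          (Y - t)) := by
    intro i
    induction i with
    | zero =>
      intro _ t h1 h2 ht htY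
      have hs' : ∀ e j, V 0 e j = if e = β ∧ j = 0 then sideSign β * w + Y / 2 else s e j := by
        intro e j
        simp only [hV, ← hK]
        by_cases he : e = β <;> by_cases hj : j = 0 <;> simp [he, hj]
      have hD0 : ∀ t e j, z e j + t * V 0 e j = D 0 t e j := by
        intro t e j
        rw [line 0 t 0]
        simp only [hD, mul_zero, add_zero, zero_mul, Nat.not_lt_zero, if_false]
        rw [sub_zero]
        by_cases he : e = β <;> by_cases hj : j = 0 <;> simp [he, hj]
      have key := limitEvo_single (a := a) (z := z) (s := s) (s' := V 0) (X := X) (w := w)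
        (w' := -(sideSign β * (Y / 2))) (Y := Y) hτ ht (b := β) (j := 0) (by omega) hcontact
        (by simp only [rateAt, hs0 0 (Nat.zero_le q)]; linarith)
        (bounce_tip (Nat.zero_lt_of_lt hq) a z s X w Y β hs' (by rw [hs0 0 (Nat.zero_le q)]; ring)) ?_ ?_
      · simpa only [hD0] using key
      · intro r hr e i hi hne
        rcases i with _ | i
        · have heb : e = !β := Bool.eq_not.2 fun h => hne ⟨h, rfl⟩
          rw [heb]; exact hother r hr
        · simp only [gapAt]
          linarith [ord r hr.1 e i hi]
      · intro r hr e i hi hne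
        simp only [hD0]
        refine pos 0 (by omega) r hr.1 (hr.2.trans htY) ?_ e i hi ?_ ?_ ?_
        · intro hq0
          nlinarith [h2 hq0, hr.2]
        · exact fun h h' => absurd ⟨h, h'⟩ hne
        · exact fun _ _ h => absurd rfl h
        · exact fun _ _ hq0 => by nlinarith [h2 hq0, hr.2]
    | succ i ih =>
      intro hi t h1 h2 ht htY
      have hs1 : z β i < z β (i + 1) := ord0 β i (by omega)
      have hi0 : z β 0 ≤ z β i := by
        rcases i with _ | i
        · exact le_rfl
        · exact (first i (by omega)).le
      -- The evolution is cut at `t'`, when the carrier is halfway between the places of balls `i`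
      -- and `i + 1`; `tc` is the time at which it hits ball `i + 1`.
      obtain ⟨t', ht'⟩ : ∃ t', K * t' = (z β i + z β (i + 1)) / 2 - z β 0 :=
        ⟨((z β i + z β (i + 1)) / 2 - z β 0) / K, by field_simp⟩
      obtain ⟨tc, htc⟩ : ∃ tc, K * tc = z β (i + 1) - z β 0 :=
        ⟨(z β (i + 1) - z β 0) / K, by field_simp⟩
      have a1 : 0 < t' := by
        by_contra! h; nlinarith
      have a2 : t' < tc := by
        by_contra! h; nlinarith
      have a3 : tc < t := by
        by_contra! h; nlinarith
      have start := ih (by omega) t' (by linarith) (fun _ => by linarith) a1 (by linarith)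
      have hDD : ∀ e j, D (i + 1) tc e j = D i tc e j := by
        intro e j
        simp only [hD]
        by_cases he : e = β
        · simp only [he, if_true]
          rcases lt_trichotomy j i with h | h | h
          · rw [if_pos (by omega), if_pos h]
          · rw [if_pos (by omega), if_neg (by omega), if_pos h, h]; linarith
          · by_cases h' : j = i + 1
            · subst h'
              simp [hs0 (i + 1) hi]; linarith
            · rw [if_neg (by omega), if_neg h', if_neg (by omega), if_neg (by omega)]
        · simp [he]
      have hVi : V i β i = K := by simp [hV]
      have hVi' : V i β (i + 1) = 0 := by simp [hV, hs0 (i + 1) hi]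
      have hs' : ∀ e j, V (i + 1) e j = if e = β ∧ j = i then V i β (i + 1) else
          if e = β ∧ j = i + 1 then V i β i else V i e j := by
        intro e j
        rw [hVi, hVi']
        simp only [hV]
        by_cases he : e = β
        · simp only [he, if_true, true_and]
          rcases lt_trichotomy j i with h | h | h
          · simp [h, h.ne, show j < i + 1 by omega, show j ≠ i + 1 by omega]
          · simp [h]
          · by_cases h' : j = i + 1
            · simp [h']
            · simp [show ¬ j < i + 1 by omega, h', h.ne', show ¬ j < i by omega]
        · simp [he]
      have key := limitEvo_single (a := a) (z := D i tc) (s := V i) (s' := V (i + 1))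
        (X := X + tc * (-(sideSign β * (Y / 2)))) (w := -(sideSign β * (Y / 2)))
        (w' := -(sideSign β * (Y / 2))) (Y := Y - tc) (t := tc - t') (T := t - tc) (by linarith)
        (by linarith) (b := β) (j := i + 1) (by omega)
        (by simp only [gapAt, hD]
            simp [hs0 (i + 1) hi]; linarith)
        (by simp only [rateAt, hVi, hVi']; linarith)
        (bounce_chain a _ _ _ _ _ β (i := i) (lt_of_le_of_lt hi hq) hs') ?_ ?_
      · have e1 : ∀ b j, D i tc b j + (-(tc - t')) * V i b j = D i t' b j := by
          intro b j; rw [line i t' tc]; ring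
        have e2 : ∀ b j, D i tc b j + (t - tc) * V (i + 1) b j = D (i + 1) t b j := by
          intro b j; rw [line (i + 1) t tc, hDD]
        have e3 : X + tc * (-(sideSign β * (Y / 2))) + (-(tc - t')) * (-(sideSign β * (Y / 2))) =
          X + t' * (-(sideSign β * (Y / 2))) := by ring
        have e4 : X + tc * (-(sideSign β * (Y / 2))) + (t - tc) * (-(sideSign β * (Y / 2))) =
          X + t * (-(sideSign β * (Y / 2))) := by ring
        have e5 : Y - tc - -(tc - t') = Y - t' := by ring
        have e6 : Y - tc - (t - tc) = Y - t := by ring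
        simp only [e1, e2, e3, e4, e5, e6] at key
        have := start.trans key
        rwa [show τ + t' + (tc - t' + (t - tc)) = τ + t by ring] at this
      · intro r hr e k hk hne
        have e1 : ∀ b j, D i tc b j + r * V i b j = D i (tc + r) b j := by
          intro b j; rw [line i (tc + r) tc]; ring
        have e3 : X + tc * (-(sideSign β * (Y / 2))) + r * (-(sideSign β * (Y / 2))) =
          X + (tc + r) * (-(sideSign β * (Y / 2))) := by ring
        simp only [e1, e3, sub_sub]
        refine pos i (by omega) (tc + r) (by linarith [hr.1]) (by linarith [hr.2]) ?_ e k hk ?_ ?_ ?_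
        · exact fun _ => by nlinarith [hr.2]
        · exact fun _ _ => by linarith [hr.1]
        · intro _ _ _
          nlinarith [hr.1]
        · exact fun h h' => absurd ⟨h, h'⟩ hne
      · intro r hr e k hk hne
        have e1 : ∀ b j, D i tc b j + r * V (i + 1) b j = D (i + 1) (tc + r) b j := by
          intro b j; rw [line (i + 1) (tc + r) tc, hDD]; ring
        have e3 : X + tc * (-(sideSign β * (Y / 2))) + r * (-(sideSign β * (Y / 2))) =
          X + (tc + r) * (-(sideSign β * (Y / 2))) := by ring
        simp only [e1, e3, sub_sub]
        refine pos (i + 1) hi (tc + r) (by linarith [hr.1]) (by linarith [hr.2]) ?_ e k hk ?_ ?_ ?_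
        · exact fun h => by nlinarith [hr.2, h2 h]
        · exact fun _ _ => by linarith [hr.1]
        · exact fun h h' => absurd ⟨h, h'⟩ hne
        · exact fun _ _ h => by nlinarith [hr.2, h2 h]
  exact step q le_rfl (Y / 2) hsweep (fun h => absurd h (lt_irrefl q)) (by linarith) le_rfl

end Ball

/-! ### Repeated bounces between the chains. -/

namespace Ball

variable {m c : ℕ}

/-- The ball between the chains moves towards the side `b`, on which `r` balls are at rest; on the
other side `r'` balls are at rest.  The other balls of the chains move away, too fast to be hit. -/
structure Ready (m : ℕ) (ε : ℝ) (b : Bool) (r r' : ℕ) (z s : Bool → ℕ → ℝ) (X w Y : ℝ) :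
    Prop where
  height_pos : 0 < Y
  speed : sideSign b * w = Y
  offset_le : -(sideSign b * X) ≤ ε
  offset_nonneg : 0 ≤ -(sideSign b * X)
  ordered : ∀ e j, j + 1 < m → z e j < z e (j + 1)
  mono : ∀ e j, j + 1 < m → s e j ≤ s e (j + 1)
  strict : ∀ e j, j + 1 < m → 0 < s e (j + 1) → s e j < s e (j + 1)
  nonneg : ∀ e, 0 ≤ z e 0
  rest : ∀ j, j < r → s b j = 0 ∧ z b j ≤ ε
  rest' : ∀ j, j < r' → s (!b) j = 0 ∧ z (!b) j ≤ ε
  fast : ∀ j, r ≤ j → j < m → 2 * Y ≤ s b j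
  fast' : ∀ j, r' ≤ j → j < m → Y ≤ s (!b) j

/-- With `H = Y - τ` the height at contact, the ball leaves with horizontal speed `H / 2`. After a
further time `H / 2` its height is `H / 2` as well, and its distance from the axis has dropped from
`z β 0 + H ^ 2 / 4` to `z β 0 ≤ ε`. This is the normal form `Ready` with the sides exchanged and one
resting ball fewer on the side just hit. Since the new height is half of `H`, the bound `H` for the
escaped balls of the other side becomes the factor 2 in `Ready.fast`. The hypotheses do not require
`Ready`, because the first bounce starts without horizontal velocity. -/
theorem exists_sweep (a : Fin c) (β : Bool) {q r' : ℕ} (hq : q < m) {z s : Bool → ℕ → ℝ}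
    {X w Y τ ε : ℝ} (hτ : 0 < τ) (hτY : τ < Y) (hw : 0 ≤ sideSign β * w)
    (hcontact : z β 0 - sideSign β * X - τ * (sideSign β * w) + (Y - τ) ^ 2 / 4 = 0)
    (ordered : ∀ e j, j + 1 < m → z e j < z e (j + 1))
    (mono : ∀ e j, j + 1 < m → s e j ≤ s e (j + 1))
    (strict : ∀ e j, j + 1 < m → 0 < s e (j + 1) → s e j < s e (j + 1))
    (nonneg : ∀ e, 0 ≤ z e 0) (rest : ∀ j, j < q + 1 → s β j = 0 ∧ z β j ≤ ε)
    (rest' : ∀ j, j < r' → s (!β) j = 0 ∧ z (!β) j ≤ ε)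
    (fast : ∀ j, q + 1 ≤ j → j < m → sideSign β * w + (Y - τ) / 2 < s β j)
    (fast' : ∀ j, r' ≤ j → j < m → Y - τ ≤ s (!β) j) (hsn : 0 ≤ s (!β) 0)
    (hother : ∀ t ∈ Icc 0 τ, 0 < gapAt (fun b j => z b j + t * s b j) (X + t * w) (Y - t) (!β) 0)
    (hε : ε < (sideSign β * w + (Y - τ) / 2) * ((Y - τ) / 2)) :
    ∃ z' s' X' w', LimitEvo (Adj a) (conf a z s X w Y : PlaneState (Ball m c)) (τ + (Y - τ) / 2)
        (q + 1) (conf a z' s' X' w' ((Y - τ) / 2)) ∧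
      Ready m ε (!β) r' q z' s' X' w' ((Y - τ) / 2) := by
  have hss := sideSign_mul_self β
  set H := Y - τ with hH
  have hHpos : 0 < H := by linarith
  set K := sideSign β * w + H / 2 with hK
  have hKpos : 0 < K := by positivity
  have hr0 := rest 0 (by omega)
  have sweep := limitEvo_sweep a β hq (z := fun b j => z b j + τ * s b j) (s := s)
    (X := X + τ * w) (w := w) (Y := H) (τ := τ) (K := K) hHpos hτ
    (fun b j hj => by simpa using ordered b j hj) mono (fun j hj => (rest j (by omega)).1)
    (by simp only [gapAt, hr0.1]; linear_combination hcontact) hw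
    (fun t ht => by
      have := hother (t + τ) ⟨by linarith [ht.1], by linarith [ht.2]⟩
      convert this using 2
      · funext b j; ring
      · ring
      · simp only [hH]; ring) hK (fun j h1 h2 => fast j h1 h2)
    (by
      simp only [hr0.1, (rest q (by omega)).1]
      linarith [(rest q (by omega)).2, nonneg β])
    (fun b => by
      by_cases hb : b = β
      · subst hb; simp only [hr0.1]; linarith [nonneg b]
      · rw [Bool.eq_not.2 hb]; nlinarith [nonneg (!β)]) hsn
  have e1 : ∀ b j, z b j + τ * s b j + (-τ) * s b j = z b j := fun b j => by ring
  simp only [e1] at sweep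
  rw [show X + τ * w + (-τ) * w = X by ring, show H - -τ = Y by rw [hH]; ring,
    show H - H / 2 = H / 2 by ring] at sweep
  refine ⟨_, _, _, _, sweep, ⟨by positivity, ?_, ?_, ?_, ?_, ?_, ?_, ?_, ?_, ?_, ?_, ?_⟩⟩
  · rw [sideSign_not]; linear_combination (H / 2) * hss
  · have : -(sideSign (!β) * (X + τ * w + H / 2 * -(sideSign β * (H / 2)))) = z β 0 := by
      rw [sideSign_not]; linear_combination (-(H ^ 2 / 4)) * hss - hcontact
    rw [this]; exact hr0.2
  · have : -(sideSign (!β) * (X + τ * w + H / 2 * -(sideSign β * (H / 2)))) = z β 0 := by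
      rw [sideSign_not]; linear_combination (-(H ^ 2 / 4)) * hss - hcontact
    rw [this]; exact nonneg β
  · intro e j hj
    have ho := ordered e j hj
    have hm := mono e j hj
    by_cases he : e = β
    · subst he
      simp only [if_true]
      rcases lt_trichotomy (j + 1) q with h | h | h
      · rw [if_pos h, if_pos (show j < q by omega), (rest (j + 1) (by omega)).1,
          (rest (j + 1 + 1) (by omega)).1]
        simpa using ordered e (j + 1) (by omega)
      · rw [if_neg (show ¬ j + 1 < q by omega), if_pos h, if_pos (show j < q by omega), hr0.1,
          (rest (j + 1) (by omega)).1]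
        linarith [(rest (j + 1) (by omega)).2, nonneg e]
      · rw [if_neg (show ¬ j < q by omega), if_neg (show ¬ j + 1 < q by omega),
          if_neg (show ¬ j + 1 = q by omega)]
        by_cases hjq : j = q
        · rw [if_pos hjq, hr0.1]
          have h1 := fast (j + 1) (by omega) hj
          have h2 : z e 0 ≤ z e j := by
            clear h1 ho hm h hjq
            induction j with
            | zero => exact le_rfl
            | succ j ih => exact (ih (by omega)).trans (ordered e j (by omega)).le
          have h3 : H / 2 * K ≤ H / 2 * s e (j + 1) := by gcongr
          have h4 : 0 ≤ τ * s e (j + 1) := mul_nonneg hτ.le (hKpos.trans h1).le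
          linarith
        · rw [if_neg hjq]; nlinarith
    · simp only [if_neg he]; nlinarith
  · intro e j hj
    have hm := mono e j hj
    by_cases he : e = β
    · subst he
      simp only [if_true]
      rcases lt_trichotomy (j + 1) q with h | h | h
      · rw [if_pos h, if_pos (show j < q by omega)]
      · rw [if_pos (show j < q by omega), if_neg (show ¬ j + 1 < q by omega), if_pos h]; exact hKpos.le
      · rw [if_neg (show ¬ j < q by omega), if_neg (show ¬ j + 1 < q by omega),
          if_neg (show ¬ j + 1 = q by omega)]
        by_cases hjq : j = q
        · rw [if_pos hjq]; exact (fast (j + 1) (by omega) hj).le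
        · rw [if_neg hjq]; exact hm
    · simp only [if_neg he]; exact hm
  · intro e j hj
    have hm := strict e j hj
    by_cases he : e = β
    · subst he
      simp only [if_true]
      rcases lt_trichotomy (j + 1) q with h | h | h
      · rw [if_pos h, if_pos (show j < q by omega)]; exact fun h => h
      · rw [if_pos (show j < q by omega), if_neg (show ¬ j + 1 < q by omega), if_pos h]; exact fun h => h
      · rw [if_neg (show ¬ j < q by omega), if_neg (show ¬ j + 1 < q by omega),
          if_neg (show ¬ j + 1 = q by omega)]
        by_cases hjq : j = q
        · rw [if_pos hjq]; exact fun _ => fast (j + 1) (by omega) hj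
        · rw [if_neg hjq]; exact hm
    · simp only [if_neg he]; exact hm
  · intro e
    by_cases he : e = β
    · subst he
      simp only [if_true]
      split_ifs with h1 h2
      · rw [(rest (0 + 1) (by omega)).1]
        linarith [ordered e 0 (by omega), nonneg e]
      · rw [hr0.1]; nlinarith [nonneg e]
      · omega
    · rw [Bool.eq_not.2 he]
      simp only [Bool.not_eq_self, if_false]
      nlinarith [nonneg (!β), mul_nonneg hτ.le hsn, mul_nonneg hHpos.le hsn]
  · intro j hj
    have := rest' j hj
    simp only [Bool.not_eq_self, if_false, this.1]
    exact ⟨trivial, by linarith [this.2]⟩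
  · intro j hj
    have := rest (j + 1) (by omega)
    simp only [Bool.not_not, if_true, if_pos hj, this.1]
    exact ⟨trivial, by linarith [this.2]⟩
  · intro j h1 h2
    simp only [Bool.not_eq_self, if_false]
    linarith [fast' j h1 h2]
  · intro j h1 h2
    simp only [Bool.not_not, if_true, if_neg (show ¬ j < q by omega)]
    have : H / 2 ≤ K := by rw [hK]; linarith
    split_ifs with h3
    · exact this
    · linarith [fast j (by omega) h2]

/-- The height `H` at contact solves `Z - Y ^ 2 + Y * H + H ^ 2 / 4 = 0`, where `Z` collects the
displacements of tip and ball; hence `H = √(8 * Y ^ 2 - 4 * Z) - 2 * Y`. For `Z = 0` the new height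
is `(√2 - 1) * Y`; the tolerance on `ε` leaves at least `2 / 5 * Y`. The kick has speed `Y + H / 2 <
2 * Y`, so escaped balls are not caught. -/
theorem Ready.exists_sweep {a : Fin c} {ε : ℝ} {b : Bool} {q r' : ℕ} {z s : Bool → ℕ → ℝ}
    {X w Y : ℝ} (h : Ready m ε b (q + 1) r' z s X w Y) (hq : q < m) (hε : ε ≤ Y ^ 2 / 50) :
    ∃ T z' s' X' w' Y', LimitEvo (Adj a) (conf a z s X w Y : PlaneState (Ball m c)) T (q + 1)
        (conf a z' s' X' w' Y') ∧ Ready m ε (!b) r' q z' s' X' w' Y' ∧ 2 / 5 * Y ≤ Y' := by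
  have hY := h.height_pos
  have hss := sideSign_mul_self b
  set Z := z b 0 + -(sideSign b * X) with hZ
  have hZ0 : 0 ≤ Z := add_nonneg (h.nonneg b) h.offset_nonneg
  have hZ1 : Z ≤ Y ^ 2 / 25 := by linarith [(h.rest 0 (by omega)).2, h.offset_le]
  have hD2 : √(8 * Y ^ 2 - 4 * Z) ^ 2 = 8 * Y ^ 2 - 4 * Z := Real.sq_sqrt (by nlinarith)
  have hD0 := Real.sqrt_nonneg (8 * Y ^ 2 - 4 * Z)
  set D := √(8 * Y ^ 2 - 4 * Z)
  have hD1 : 14 / 5 * Y ≤ D := by nlinarith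
  have hD3 : D < 29 / 10 * Y := by nlinarith
  have hH : Y - (3 * Y - D) = D - 2 * Y := by ring
  have hsn : ∀ e j, j < m → 0 ≤ s e j := by
    intro e j hj
    by_cases he : e = b
    · subst he
      by_cases hj' : j < q + 1
      · exact (h.rest j hj').1.ge
      · linarith [h.fast j (by omega) hj]
    · rw [Bool.eq_not.2 he]
      by_cases hj' : j < r'
      · exact (h.rest' j hj').1.ge
      · linarith [h.fast' j (by omega) hj]
  obtain ⟨z', s', X', w', h1, h2⟩ := Ball.exists_sweep a b hq (z := z) (s := s) (X := X) (w := w)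
    (Y := Y) (τ := 3 * Y - D) (ε := ε) (r' := r') (by linarith) (by linarith)
    (by rw [h.speed]; exact hY.le)
    (by rw [h.speed, hH]
        have : z b 0 - sideSign b * X = Z := by rw [hZ]; ring
        rw [this]; linear_combination hD2 / 4)
    h.ordered h.mono h.strict h.nonneg h.rest h.rest'
    (fun j h1 h2 => by rw [h.speed, hH]; linarith [h.fast j h1 h2])
    (fun j h1 h2 => by rw [hH]; linarith [h.fast' j h1 h2]) (hsn _ 0 (by omega))
    (fun t ht => by
      simp only [gapAt]
      rw [sideSign_not]
      have e1 : -sideSign b * (X + t * w) = -(sideSign b * X) - t * (sideSign b * w) := by ring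
      rw [e1, h.speed]
      have := h.nonneg (!b)
      have := mul_nonneg ht.1 (hsn (!b) 0 (by omega))
      have := h.offset_le
      have e2 : (Y - t) ^ 2 / 4 = Y ^ 2 / 4 - t * Y / 2 + t ^ 2 / 4 := by ring
      have e3 : 0 < Y ^ 2 := by positivity
      linarith [mul_nonneg ht.1 hY.le, sq_nonneg t])
    (by rw [h.speed, hH]; nlinarith)
  exact ⟨_, z', s', X', w', _, h1, h2, by linarith⟩

/-- The `2 * k + 1` remaining sweeps meet `k + 1, k, k, ..., 1, 1` resting balls, and two successive
sweeps give an odd number of collisions: the sum of the first `k + 1` odd numbers is a square. The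
hypothesis on `ε` allows for a factor `2 / 5` in the height at each sweep. -/
theorem Ready.exists_pass {a : Fin c} (k : ℕ) : ∀ {ε : ℝ} {z s : Bool → ℕ → ℝ} {X w Y : ℝ}, k < m →
    Ready m ε true (k + 1) k z s X w Y → ε ≤ ((2 / 5) ^ (2 * k + 1) * Y) ^ 2 / 50 →
    ∃ T z' s' X' w' Y', LimitEvo (Adj a) (conf a z s X w Y : PlaneState (Ball m c)) T
      ((k + 1) * (k + 1)) (conf a z' s' X' w' Y') ∧ Ready m ε false 0 0 z' s' X' w' Y' ∧
        ε ≤ Y' ^ 2 / 50 := by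
  induction k with
  | zero =>
    intro ε z s X w Y hk h hε
    have hY := h.height_pos
    obtain ⟨T, z', s', X', w', Y', h1, h2, h3⟩ := h.exists_sweep (a := a) hk (by
      rw [mul_pow] at hε; norm_num at hε; nlinarith)
    refine ⟨T, z', s', X', w', Y', h1, h2, hε.trans ?_⟩
    simp only [mul_zero, zero_add, pow_one]
    gcongr
  | succ k ih =>
    intro ε z s X w Y hk h hε
    have hY := h.height_pos
    have hp : ((2 / 5 : ℝ)) ^ (2 * k + 1) ≤ 1 := pow_le_one₀ (by norm_num) (by norm_num)
    have hp0 : (0 : ℝ) < (2 / 5 : ℝ) ^ (2 * k + 1) := by positivity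
    have hε1 : ε ≤ ((2 / 5) ^ (2 * k + 1) * (4 / 25 * Y)) ^ 2 / 50 := by
      refine hε.trans (le_of_eq ?_); ring
    have hε2 : ε ≤ (4 / 25 * Y) ^ 2 / 50 := hε1.trans
      (div_le_div_of_nonneg_right (pow_le_pow_left₀ (by positivity)
        (mul_le_of_le_one_left (by positivity) hp) 2) (by norm_num))
    obtain ⟨T, z', s', X', w', Y', h1, h2, h3⟩ := h.exists_sweep (a := a) hk (by nlinarith)
    obtain ⟨T', z'', s'', X'', w'', Y'', h1', h2', h3'⟩ := h2.exists_sweep (a := a) (by omega)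
      (hε2.trans (by gcongr; linarith))
    obtain ⟨T₃, z₃, s₃, X₃, w₃, Y₃, h₃, h₄, h₅⟩ := ih (by omega) h2'
      (hε1.trans (by gcongr; linarith))
    refine ⟨T + T' + T₃, z₃, s₃, X₃, w₃, Y₃, ?_, h₄, h₅⟩
    have := (h1.trans h1').trans h₃
    rwa [show k + 1 + 1 + (k + 1) + (k + 1) * (k + 1) = (k + 1 + 1) * (k + 1 + 1) by ring] at this

/-- A ball that falls between two chains of `m` balls nearly at contact bounces `m` times on each
chain and causes `m * (m + 1)` collisions. -/
theorem exists_pass (hm : 0 < m) : ∃ ε : ℝ, 0 < ε ∧ ∀ (a : Fin c) (ρ : Bool → ℕ → ℝ),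
    (∀ b j, j + 1 < m → ρ b j < ρ b (j + 1)) → (∀ b, 0 ≤ ρ b 0) → (∀ b j, j < m → ρ b j ≤ ε) →
    ∃ T z s X w Y, LimitEvo (Adj a) (conf a ρ (fun _ _ => 0) (-(1 / 4 + ρ false 0)) 0 2 :
        PlaneState (Ball m c)) T (m * (m + 1)) (conf a z s X w Y) ∧
      (∀ b j, j < m → 0 < s b j) ∧ (∀ b j, j + 1 < m → s b j < s b (j + 1)) ∧
      (∀ b j, j + 1 < m → z b j < z b (j + 1)) ∧
      ∀ b, 0 ≤ z b 0 ∧ 0 < gapAt z X Y b 0 ∧ 0 < rateAt s w Y b 0 := by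
  obtain ⟨k, rfl⟩ : ∃ k, m = k + 1 := ⟨m - 1, by omega⟩
  -- The first contact takes place at height 1 and leaves the ball in normal form at height `1 / 2`;
  -- then `2 * k + 1` sweeps follow.
  refine ⟨((2 / 5) ^ (2 * k + 1) * (1 / 2)) ^ 2 / 50, by positivity, fun a ρ h1 h2 h3 => ?_⟩
  set ε : ℝ := ((2 / 5) ^ (2 * k + 1) * (1 / 2)) ^ 2 / 50 with hε
  have hp : ((2 / 5 : ℝ)) ^ (2 * k + 1) ≤ 1 := pow_le_one₀ (by norm_num) (by norm_num)
  have hε1 : ε ≤ (1 / 2) ^ 2 / 50 := by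
    exact div_le_div_of_nonneg_right (pow_le_pow_left₀ (by positivity)
      (mul_le_of_le_one_left (by positivity) hp) 2) (by norm_num)
  have hs : sideSign false = -1 := rfl
  obtain ⟨z, s, X, w, e1, e2⟩ := exists_sweep a false (q := k) (r' := k + 1) (by omega) (z := ρ)
    (s := fun _ _ => 0) (X := -(1 / 4 + ρ false 0)) (w := 0) (Y := 2) (τ := 1) (ε := ε) one_pos
    (by norm_num) (by simp) (by rw [hs]; ring) h1 (fun _ _ _ => le_rfl)
    (fun _ _ _ h => absurd h (lt_irrefl 0)) h2 (fun j hj => ⟨rfl, h3 false j hj⟩)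
    (fun j hj => ⟨rfl, h3 _ j hj⟩) (fun j h h' => by omega) (fun j h h' => by omega) le_rfl
    (fun t ht => by
      simp only [gapAt, Bool.not_false, sideSign, if_true]
      nlinarith [h2 true, h2 false, sq_nonneg (2 - t)])
    (by rw [hs]; norm_num; linarith)
  obtain ⟨T, z', s', X', w', Y', e3, e4, e5⟩ := e2.exists_pass (a := a) k (by omega)
    (by rw [hε]; norm_num)
  have hY := e4.height_pos
  have hsp : ∀ b j, j < k + 1 → Y' ≤ s' b j := by
    intro b j hj
    cases b
    · linarith [e4.fast j (by omega) hj]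
    · exact e4.fast' j (by omega) hj
  refine ⟨1 + (2 - 1) / 2 + T, z', s', X', w', Y', ?_, fun b j hj => hY.trans_le (hsp b j hj), fun b j hj =>
    e4.strict b j hj (hY.trans_le (hsp b _ hj)), e4.ordered, fun b => ⟨e4.nonneg b, ?_⟩⟩
  · have := e1.trans e3
    rwa [show k + 1 + (k + 1) * (k + 1) = (k + 1) * (k + 1 + 1) by ring] at this
  · have e6 := e4.speed
    have e7 := e4.offset_le
    have e8 := e4.offset_nonneg
    have e9 := e4.nonneg b
    cases b
    · have := e4.fast 0 (by omega) (by omega)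
      simp only [gapAt, rateAt]
      exact ⟨by nlinarith, by linarith⟩
    · have := hsp true 0 (by omega)
      simp only [sideSign, Bool.false_eq_true, if_false] at e6 e7 e8
      simp only [gapAt, rateAt, sideSign, if_true]
      exact ⟨by nlinarith, by linarith⟩

end Ball

/-! ### Successive passages, each on its own scale. -/

namespace PlaneState

variable {ι P : Type*} {F : Filter P}

/-- The inverse of `unscale`. -/
noncomputable def rescale (lam : ℝ) (bx bY : ι → ℝ) (S : PlaneState ι) : PlaneState ι :=
  ⟨fun i => (S.x i - bx i) / lam ^ 2, fun i => (S.y i - bY i) / lam, fun i => S.u i / lam, S.w⟩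

theorem unscale_rescale {lam : ℝ} (h : lam ≠ 0) (bx bY : ι → ℝ) (S : PlaneState ι) :
    unscale lam bx bY (rescale lam bx bY S) = S := by
  cases S
  simp only [unscale, rescale, mk.injEq, and_true]
  refine ⟨?_, ?_, ?_⟩ <;> funext i <;> field_simp <;> ring

theorem Conv.eventually_sq {S : P → PlaneState ι} {σ : PlaneState ι} (h : Conv S F σ)
    {τ : P → ℝ} {t : ℝ} (hτ : Tendsto τ F (𝓝 t)) (ht : 0 < t) {i j : ι}
    (hpos : ∀ s ∈ Icc 0 t, 4 < (σ.fly s).sq i j) :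
    ∀ᶠ p in F, ∀ s ∈ Icc 0 (τ p), 4 < ((S p).fly s).sq i j := by
  have hx := (h i).1.sub (h j).1
  have hy := (h i).2.1.sub (h j).2.1
  have hu := (h i).2.2.1.sub (h j).2.2.1
  have hw := (h i).2.2.2.sub (h j).2.2.2
  have key := eventually_quadratic_pos ((hu.pow 2).add (hw.pow 2))
    (((hu.mul hx).add (hw.mul hy)).const_mul 2) (((hx.pow 2).add (hy.pow 2)).sub_const 4) hτ ht
    (fun s hs => by
      have := hpos s hs
      rw [sq_fly] at this
      simp only [sq, slope] at this
      linarith)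
  filter_upwards [key] with p hp s hs
  have := hp s hs
  rw [sq_fly]
  simp only [sq, slope]
  linarith

end PlaneState

namespace Ball

open PlaneState

variable {m c : ℕ} {P : Type*} {F : Filter P}

theorem adj_right (a : Fin c) {i : ℕ} (hi : i + 1 < m) :
    Adj a (Sum.inl (true, ⟨i, by omega⟩) : Ball m c) (Sum.inl (true, ⟨i + 1, hi⟩)) :=
  ⟨true, i + 1, hi, by simp [leftOf, node, show i < m by omega], by simp [rightOf, node, hi]⟩

theorem adj_left (a : Fin c) {i : ℕ} (hi : i + 1 < m) :
    Adj a (Sum.inl (false, ⟨i + 1, hi⟩) : Ball m c) (Sum.inl (false, ⟨i, by omega⟩)) :=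
  ⟨false, i + 1, hi, by simp [leftOf, node, hi], by simp [rightOf, node, show i < m by omega]⟩

theorem adj_tip_right (a : Fin c) (hm : 0 < m) :
    Adj a (Sum.inr a : Ball m c) (Sum.inl (true, ⟨0, hm⟩)) :=
  ⟨true, 0, hm, by simp [leftOf, node], by simp [rightOf, node, hm]⟩

theorem adj_tip_left (a : Fin c) (hm : 0 < m) :
    Adj a (Sum.inl (false, ⟨0, hm⟩) : Ball m c) (Sum.inr a) :=
  ⟨false, 0, hm, by simp [leftOf, node, hm], by simp [rightOf, node]⟩

/-- The limiting abscissae of the centres. -/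
noncomputable def centreX : Ball m c → ℝ :=
  Sum.elim (fun k => sideSign k.1 * (2 * ((k.2 : ℕ) + 1))) fun _ => 0

/-- The limiting ordinates of the centres, when the ball number `a` is between the chains. -/
noncomputable def centreY (a : ℕ) : Ball m c → ℝ :=
  Sum.elim (fun _ => 0) fun k => 10 * ((k : ℕ) - a)

theorem four_lt_centre_chain (a : Fin c) {b b' : Bool} {i i' : Fin m}
    (hne : (Sum.inl (b, i) : Ball m c) ≠ Sum.inl (b', i'))
    (h : ¬ Adj a (Sum.inl (b, i) : Ball m c) (Sum.inl (b', i')))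
    (h' : ¬ Adj a (Sum.inl (b', i') : Ball m c) (Sum.inl (b, i))) :
    4 < ((centreX (Sum.inl (b, i) : Ball m c) : ℝ) - centreX (Sum.inl (b', i') : Ball m c)) ^ 2 := by
  obtain ⟨i, hi⟩ := i
  obtain ⟨i', hi'⟩ := i'
  simp only [centreX, Sum.elim_inl]
  have key : b = b' → ((i : ℝ) + 2 ≤ i' ∨ (i' : ℝ) + 2 ≤ i) := by
    rintro rfl
    have : i + 2 ≤ i' ∨ i' + 2 ≤ i := by
      by_contra! hcon
      obtain h1 | h1 | h1 : i = i' ∨ i' = i + 1 ∨ i = i' + 1 := by omega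
      · subst h1; exact hne rfl
      · subst h1
        cases b
        · exact h' (adj_left a hi')
        · exact h (adj_right a hi')
      · subst h1
        cases b
        · exact h (adj_left a hi)
        · exact h' (adj_right a hi)
    exact_mod_cast this
  have h0 : (0 : ℝ) ≤ i := Nat.cast_nonneg i
  have h0' : (0 : ℝ) ≤ i' := Nat.cast_nonneg i'
  by_cases hb : b = b'
  · have e : (sideSign b * (2 * ((i : ℝ) + 1)) - sideSign b' * (2 * ((i' : ℝ) + 1))) ^ 2 =
        (sideSign b * sideSign b) * 4 * ((i : ℝ) - i') ^ 2 := by subst hb; ring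
    rw [e, sideSign_mul_self]
    rcases key hb with h1 | h1 <;> nlinarith
  · rw [Bool.eq_not.2 (Ne.symm hb), sideSign_not]
    have e : (sideSign b * (2 * ((i : ℝ) + 1)) - -sideSign b * (2 * ((i' : ℝ) + 1))) ^ 2 =
        (sideSign b * sideSign b) * 4 * ((i : ℝ) + i' + 2) ^ 2 := by ring
    rw [e, sideSign_mul_self]
    nlinarith

theorem centre_tip_sq (b : Bool) (i : Fin m) (k : Fin c) :
    ((centreX (Sum.inl (b, i) : Ball m c) : ℝ) - centreX (Sum.inr k : Ball m c)) ^ 2 =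
      4 * ((i : ℝ) + 1) ^ 2 := by
  simp only [centreX, Sum.elim_inl, Sum.elim_inr]
  have := sideSign_mul_self b
  linear_combination (4 * ((i : ℝ) + 1) ^ 2) * this

theorem natCast_sub_sq {k a : ℕ} (h : k ≠ a) : (1 : ℝ) ≤ ((k : ℝ) - a) ^ 2 := by
  have : (1 : ℤ) ≤ ((k : ℤ) - a) ^ 2 := by
    have : (k : ℤ) - a ≠ 0 := by omega
    have := sq_pos_of_ne_zero this  
    omega
  exact_mod_cast this

theorem adj_tip_cases (a : Fin c) {b : Bool} {i : Fin m} (hi : (i : ℕ) = 0) :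
    Adj a (Sum.inl (b, i) : Ball m c) (Sum.inr a) ∨ Adj a (Sum.inr a : Ball m c) (Sum.inl (b, i)) := by
  obtain ⟨i, hi'⟩ := i
  obtain rfl : i = 0 := hi
  cases b
  · exact Or.inl (adj_tip_left a hi')
  · exact Or.inr (adj_tip_right a hi')

/-- Only neighbours are tangent in the limiting configuration: the tips are at distance 4 from each
other, and the falling balls are spaced by 10. Hence only neighbours need the limiting system. -/
theorem four_lt_centre (a : Fin c) {k l : Ball m c} (hne : k ≠ l) (h : ¬ Adj a k l)
    (h' : ¬ Adj a l k) :
    4 < ((centreX k : ℝ) - centreX l) ^ 2 + (centreY a k - centreY a l) ^ 2 := by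
  have mixed : ∀ (b : Bool) (i : Fin m) (k : Fin c), ¬ Adj a (Sum.inl (b, i) : Ball m c) (Sum.inr k) →
      ¬ Adj a (Sum.inr k : Ball m c) (Sum.inl (b, i)) →
      4 < 4 * ((i : ℝ) + 1) ^ 2 + (10 * ((k : ℝ) - a)) ^ 2 := by
    intro b i k h h'
    have h0 : (0 : ℝ) ≤ (i : ℕ) := Nat.cast_nonneg _
    by_cases hk : k = a
    · subst hk
      have : (i : ℕ) ≠ 0 := fun hi => (adj_tip_cases k (b := b) hi).elim h h'
      have : (1 : ℝ) ≤ (i : ℕ) := by exact_mod_cast Nat.one_le_iff_ne_zero.2 this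
      nlinarith [sq_nonneg (10 * ((k : ℝ) - k))]
    · have := natCast_sub_sq (Fin.val_ne_of_ne hk)
      nlinarith
  rcases k with ⟨b, i⟩ | k <;> rcases l with ⟨b', i'⟩ | l
  · have := four_lt_centre_chain a hne h h'
    nlinarith [sq_nonneg ((centreY a (Sum.inl (b, i) : Ball m c) : ℝ) -
      centreY a (Sum.inl (b', i') : Ball m c))]
  · rw [centre_tip_sq]
    simp only [centreY, Sum.elim_inl, Sum.elim_inr]
    have := mixed b i l h h'
    linarith
  · rw [← neg_sub, neg_sq, centre_tip_sq]
    simp only [centreY, Sum.elim_inl, Sum.elim_inr, sub_zero]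
    exact mixed b' i' k h' h
  · have hkl : k ≠ l := fun h => hne (by rw [h])
    have := natCast_sub_sq (Fin.val_ne_of_ne hkl)
    simp only [centreX, centreY, Sum.elim_inr]
    nlinarith

/-- The base points of the scaling for the passage of the ball `a`: the balls that do not take part
are based at their own positions. -/
noncomputable def baseX (a : Fin c) (S : PlaneState (Ball m c)) : Ball m c → ℝ :=
  Sum.elim (fun k => centreX (Sum.inl k : Ball m c)) fun k => if k = a then 0 else S.x (Sum.inr k)

/-- See `baseX`. -/
noncomputable def baseY (a : Fin c) (S : PlaneState (Ball m c)) : Ball m c → ℝ :=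
  Sum.elim (fun _ => 0) fun k => if k = a then 0 else S.y (Sum.inr k)

theorem base_of_adj (a : Fin c) (S : PlaneState (Ball m c)) {k l : Ball m c} (h : Adj a k l) :
    baseX a S l = baseX a S k + 2 ∧ baseY a S l = baseY a S k := by
  obtain ⟨b, j, hj, rfl, rfl⟩ := h
  rcases j with _ | j
  · cases b <;> simp [leftOf, rightOf, node, hj, baseX, baseY, centreX, sideSign]
  · have : j < m := by omega
    cases b <;> simp [leftOf, rightOf, node, hj, this, baseX, baseY, centreX, sideSign] <;> ring

theorem ne_of_adj {a : Fin c} {k l : Ball m c} (h : Adj a k l) : k ≠ l := by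
  obtain ⟨b, j, hj, rfl, rfl⟩ := h
  exact leftOf_ne_rightOf a b hj

theorem not_adj_inr {a k : Fin c} (hk : k ≠ a) (l : Ball m c) :
    ¬ Adj a (Sum.inr k) l ∧ ¬ Adj a l (Sum.inr k) := by
  have key : ∀ b j, j ≤ m → (Sum.inr k : Ball m c) ≠ node a b j := by
    intro b j hj
    rcases j with _ | j
    · simpa [node] using hk
    · simp [node, show j < m by omega]
  constructor <;> rintro ⟨b, j, hj, h1, h2⟩
  · cases b
    · exact key _ _ hj h1
    · exact key _ _ hj.le h1
  · cases b
    · exact key _ _ hj.le h2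
    · exact key _ _ hj h2

/-- The situation before the passage of the ball number `a`, as a parameter tends to its limit: the
chains are near their limiting positions, with distances of order `ν ^ 2`. -/
structure Stage (F : Filter P) (a : ℕ) (ν : P → ℝ) (κ : Bool → ℕ → ℝ) (off : Fin c → P → ℝ)
    (h : P → ℝ) (S : P → PlaneState (Ball m c)) : Prop where
  chain_x : ∀ b (i : Fin m), Tendsto (fun p =>
    (sideSign b * (S p).x (Sum.inl (b, i)) - 2 * ((i : ℕ) + 1)) / ν p ^ 2) F (𝓝 (κ b i))
  chain_y : ∀ k, Tendsto (fun p => (S p).y (Sum.inl k) / ν p) F (𝓝 0)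
  chain_u : ∀ k, Tendsto (fun p => (S p).u (Sum.inl k) / ν p) F (𝓝 0)
  chain_w : ∀ k, Tendsto (fun p => (S p).w (Sum.inl k) / ν p) F (𝓝 0)
  next : ∀ k : Fin c, a ≤ k → ∀ᶠ p in F, (S p).x (Sum.inr k) = off k p ∧
    (S p).y (Sum.inr k) = 10 * ((k : ℕ) - a) + h p ∧ (S p).u (Sum.inr k) = 0 ∧
    (S p).w (Sum.inr k) = -1
  past : ∀ k : Fin c, (k : ℕ) < a → Tendsto (fun p => (S p).x (Sum.inr k)) F (𝓝 0) ∧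
    Tendsto (fun p => (S p).y (Sum.inr k)) F (𝓝 (10 * ((k : ℕ) - a))) ∧
    Tendsto (fun p => (S p).u (Sum.inr k) / ν p) F (𝓝 0) ∧
    Tendsto (fun p => (S p).w (Sum.inr k)) F (𝓝 (-1))

/-- The limiting system of the passage of the ball `a` describes hard balls. -/
theorem Stage.exists_pass {d : ℕ} (hd : 2 ≤ d) {a : Fin c} {ν : P → ℝ} {κ ρ : Bool → ℕ → ℝ}
    {off : Fin c → P → ℝ} {h : P → ℝ} {S : P → PlaneState (Ball m c)} (hS : Stage F a ν κ off h S)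
    (hν : Tendsto ν F (𝓝 0)) (hν' : ∀ᶠ p in F, 0 < ν p) {L : ℝ} (hL : 0 < L)
    (hρ : ∀ b i, ρ b i = κ b i / L ^ 2) (hoff : ∀ k, Tendsto (off k) F (𝓝 0))
    (hh : ∀ p, h p = 2 * (L * ν p)) (hoffa : ∀ p, off a p = -(1 / 4 + ρ false 0) * (L * ν p) ^ 2)
    {T : ℝ} {N : ℕ} {σ : PlaneState (Ball m c)}
    (hev : LimitEvo (Adj a) (conf a ρ (fun _ _ => 0) (-(1 / 4 + ρ false 0)) 0 2) T N σ) :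
    ∃ S' : P → PlaneState (Ball m c), Conv S' F σ ∧
      (∀ᶠ p in F, ∀ k, k ≠ a →
        (unscale (L * ν p) (baseX a (S p)) (baseY a (S p)) (S' p)).x (Sum.inr k) =
          (S p).x (Sum.inr k) + (L * ν p) * T * (S p).u (Sum.inr k) ∧
        (unscale (L * ν p) (baseX a (S p)) (baseY a (S p)) (S' p)).y (Sum.inr k) =
          (S p).y (Sum.inr k) + (L * ν p) * T * (S p).w (Sum.inr k) ∧
        (L * ν p) * (S' p).u (Sum.inr k) = (S p).u (Sum.inr k) ∧
        (S' p).w (Sum.inr k) = (S p).w (Sum.inr k)) ∧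
      (∀ k, Tendsto (fun p => ((S' p).w k - (S p).w k) / (L * ν p)) F (𝓝 0)) ∧
      ∀ᶠ p in F, PlaneEvo hd (S p) (L * ν p * T) N
        (unscale (L * ν p) (baseX a (S p)) (baseY a (S p)) (S' p)) := by
  have hlam : Tendsto (fun p => L * ν p) F (𝓝 0) := by simpa using hν.const_mul L
  have hlam' : ∀ᶠ p in F, 0 < L * ν p := hν'.mono fun p hp => mul_pos hL hp
  have hh0 : Tendsto h F (𝓝 0) := by
    rw [funext hh]; simpa using hlam.const_mul 2
  have hdiv : ∀ f : P → ℝ, Tendsto (fun p => f p / ν p) F (𝓝 0) →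
      Tendsto (fun p => f p / (L * ν p)) F (𝓝 0) := by
    intro f hf
    have := hf.div_const L
    rw [zero_div] at this
    exact this.congr fun p => by rw [div_div, mul_comm]
  have hsmall : ∀ f : P → ℝ, Tendsto (fun p => f p / ν p) F (𝓝 0) → Tendsto f F (𝓝 0) := by
    intro f hf
    have := hf.mul hν
    rw [zero_mul] at this
    refine this.congr' ?_
    filter_upwards [hν'] with p hp
    field_simp
  have hbx : ∀ i, Tendsto (fun p => baseX a (S p) i) F (𝓝 (centreX i)) := by
    rintro (k | k)
    · exact tendsto_const_nhds
    · simp only [baseX, centreX, Sum.elim_inr]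
      by_cases hk : k = a
      · simpa [hk] using tendsto_const_nhds
      · simp only [if_neg hk]
        rcases lt_or_ge (k : ℕ) a with h1 | h1
        · exact (hS.past k h1).1
        · exact (hoff k).congr' ((hS.next k h1).mono fun p hp => hp.1.symm)
  have hbY : ∀ i, Tendsto (fun p => baseY a (S p) i) F (𝓝 (centreY a i)) := by
    rintro (k | k)
    · exact tendsto_const_nhds
    · simp only [baseY, centreY, Sum.elim_inr]
      by_cases hk : k = a
      · simpa [hk] using tendsto_const_nhds
      · simp only [if_neg hk]
        rcases lt_or_ge (k : ℕ) a with h1 | h1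
        · exact (hS.past k h1).2.1
        · have := hh0.const_add (10 * ((k : ℝ) - a))
          rw [add_zero] at this
          exact this.congr' ((hS.next k h1).mono fun p hp => hp.2.1.symm)
  -- On the scale `L * ν` the chains are at rest with displacements `κ / L ^ 2`, and the choice of
  -- `off` and `h` puts ball `a` exactly at its starting point in the limiting system.
  have hconv : Conv (fun p => rescale (L * ν p) (baseX a (S p)) (baseY a (S p)) (S p)) F
      (conf a ρ (fun _ _ => 0) (-(1 / 4 + ρ false 0)) 0 2) := by
    rintro (⟨b, i⟩ | k)
    · refine ⟨?_, ?_, ?_, ?_⟩ <;>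
        simp only [rescale, baseX, baseY, centreX, conf, Sum.elim_inl, mul_zero, sub_zero]
      · have := ((hS.chain_x b i).div_const (L ^ 2)).const_mul (sideSign b)
        rw [← hρ] at this
        refine this.congr fun p => ?_
        rw [div_div, ← mul_div_assoc, mul_pow, mul_comm (L ^ 2)]
        congr 1
        linear_combination (S p).x (Sum.inl (b, i)) * sideSign_mul_self b
      · exact hdiv _ (hS.chain_y _)
      · exact hdiv _ (hS.chain_u _)
      · exact hsmall _ (hS.chain_w _)
    · by_cases hk : k = a
      · subst hk
        have hn := hS.next k le_rfl
        refine ⟨?_, ?_, ?_, ?_⟩ <;>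
          simp only [rescale, baseX, baseY, conf, Sum.elim_inr, if_true, sub_zero]
        · refine tendsto_const_nhds.congr' ?_
          filter_upwards [hlam', hn] with p hp hq
          rw [hq.1, hoffa, mul_div_assoc, div_self (pow_ne_zero 2 hp.ne'), mul_one]
        · refine tendsto_const_nhds.congr' ?_
          filter_upwards [hlam', hn] with p hp hq
          rw [hq.2.1, hh, sub_self, mul_zero, zero_add, mul_div_assoc, div_self hp.ne', mul_one]
        · exact tendsto_const_nhds.congr' (hn.mono fun p hq => by simp [hq.2.2.1])
        · exact tendsto_const_nhds.congr' (hn.mono fun p hq => hq.2.2.2.symm)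
      · refine ⟨?_, ?_, ?_, ?_⟩ <;>
          simp only [rescale, baseX, baseY, conf, Sum.elim_inr, if_neg hk, sub_self, zero_div]
        · exact tendsto_const_nhds
        · exact tendsto_const_nhds
        · rcases lt_or_ge (k : ℕ) a with h1 | h1
          · exact hdiv _ (hS.past k h1).2.2.1
          · exact tendsto_const_nhds.congr' ((hS.next k h1).mono fun p hq => by
              simp [hq.2.2.1])
        · rcases lt_or_ge (k : ℕ) a with h1 | h1
          · exact (hS.past k h1).2.2.2
          · exact tendsto_const_nhds.congr' ((hS.next k h1).mono fun p hq => hq.2.2.2.symm)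
  obtain ⟨S', h1, h2, h3, h4⟩ := hev.exists_planeEvo hd hlam hlam' hbx hbY
    (fun i j hij p => base_of_adj a (S p) hij) (fun i j => ne_of_adj)
    (fun i j hne h h' => four_lt_centre a hne h h') _ hconv
  refine ⟨S', h1, ?_, h3, ?_⟩
  · filter_upwards [hlam'] with p hp k hk
    obtain ⟨e1, e2, e3, e4⟩ := h2 (Sum.inr k) (not_adj_inr hk) p
    simp only [rescale, baseX, baseY, Sum.elim_inr, if_neg hk, sub_self, zero_div, zero_add] at e1 e2 e3 e4
    simp only [unscale, e1, e2, e3, e4, baseX, baseY, Sum.elim_inr, if_neg hk]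
    refine ⟨?_, by ring, ?_, trivial⟩
    · have := hp.ne'
      field_simp
    · rw [mul_div_cancel₀ _ hp.ne']
  · filter_upwards [h4, hlam'] with p h5 h6
    rwa [unscale_rescale h6.ne'] at h5

end Ball

namespace Ball

open PlaneState

variable {m c : ℕ} {P : Type*} {F : Filter P}

/-- The chain balls leave with velocities near `lam * s`, and the flight lasts about 10 time units.
Displacements near `10 * lam * s` have a limit after division by the square of the new scale `√lam`.
Velocities of order `lam` vanish on that scale, so the chains are at rest again. -/
theorem Stage.flight {a : Fin c} {ν lam : P → ℝ} {κ : Bool → ℕ → ℝ} {off : Fin c → P → ℝ}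
    {h h' : P → ℝ} {S S' : P → PlaneState (Ball m c)} (hS : Stage F a ν κ off h S) {L : ℝ}
    (hlam : ∀ p, lam p = L * ν p) (hlam0 : Tendsto lam F (𝓝 0))
    (hlam' : ∀ᶠ p in F, 0 < lam p) (hh : Tendsto h F (𝓝 0)) (hh' : Tendsto h' F (𝓝 0))
    {z s : Bool → ℕ → ℝ} {X w Y T : ℝ} (hS' : Conv S' F (conf a z s X w Y))
    (hiso : ∀ᶠ p in F, ∀ k, k ≠ a →
        (unscale (lam p) (baseX a (S p)) (baseY a (S p)) (S' p)).x (Sum.inr k) =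
          (S p).x (Sum.inr k) + (lam p) * T * (S p).u (Sum.inr k) ∧
        (unscale (lam p) (baseX a (S p)) (baseY a (S p)) (S' p)).y (Sum.inr k) =
          (S p).y (Sum.inr k) + (lam p) * T * (S p).w (Sum.inr k) ∧
        (lam p) * (S' p).u (Sum.inr k) = (S p).u (Sum.inr k) ∧
        (S' p).w (Sum.inr k) = (S p).w (Sum.inr k))
    (hw : ∀ k, Tendsto (fun p => (S' p).w (Sum.inl k) / lam p) F (𝓝 0)) :
    Stage F (a + 1) (fun p => √(lam p)) (fun b i => 10 * s b i) off h' (fun p =>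
      (unscale (lam p) (baseX a (S p)) (baseY a (S p)) (S' p)).fly
        (10 + h p - lam p * T - h' p)) := by
  set r : P → ℝ := fun p => √(lam p) with hr
  set t : P → ℝ := fun p => 10 + h p - lam p * T - h' p with ht_def
  change Stage F (a + 1) r (fun b i => 10 * s b i) off h' fun p =>
    (unscale (lam p) (baseX a (S p)) (baseY a (S p)) (S' p)).fly (t p)
  have ht : Tendsto t F (𝓝 10) := by
    simpa using ((hh.const_add 10).sub (hlam0.mul_const T)).sub hh'
  have hr0 : Tendsto r F (𝓝 0) := by simpa using hlam0.sqrt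
  have hr' : ∀ᶠ p in F, 0 < r p ∧ lam p = r p ^ 2 := by
    filter_upwards [hlam'] with p hp
    exact ⟨Real.sqrt_pos.2 hp, (Real.sq_sqrt hp.le).symm⟩
  have hur : ∀ f : P → ℝ, ∀ y : ℝ, Tendsto f F (𝓝 y) → Tendsto (fun p => lam p * f p / r p) F (𝓝 0) := by
    intro f y hf
    have := hr0.mul hf
    rw [zero_mul] at this
    refine this.congr' ?_
    filter_upwards [hr'] with p hp
    rw [hp.2]
    have := hp.1.ne'
    field_simp
  have hwr : ∀ f : P → ℝ, Tendsto (fun p => f p / lam p) F (𝓝 0) →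
      Tendsto (fun p => f p / r p) F (𝓝 0) := by
    intro f hf
    have := hf.mul hr0
    rw [zero_mul] at this
    refine this.congr' ?_
    filter_upwards [hr'] with p hp
    rw [hp.2]
    have := hp.1.ne'
    field_simp
  have hSu : ∀ k : Fin c, (k : ℕ) < a → Tendsto (fun p => (S p).u (Sum.inr k) / lam p) F (𝓝 0) := by
    intro k hk
    have := (hS.past k hk).2.2.1.div_const L
    rw [zero_div] at this
    exact this.congr fun p => by rw [div_div, hlam, mul_comm]
  have hSu0 : ∀ k : Fin c, (k : ℕ) < a → Tendsto (fun p => (S p).u (Sum.inr k)) F (𝓝 0) := by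
    intro k hk
    have := (hSu k hk).mul hlam0
    rw [zero_mul] at this
    refine this.congr' ?_
    filter_upwards [hlam'] with p hp
    field_simp
  refine ⟨?_, ?_, ?_, ?_, ?_, ?_⟩
  · intro b i
    obtain ⟨h1, -, h3, -⟩ := hS' (Sum.inl (b, i))
    simp only [conf, Sum.elim_inl] at h1 h3
    have := (hlam0.mul (h1.const_mul (sideSign b))).add (ht.mul (h3.const_mul (sideSign b)))
    rw [zero_mul, zero_add, ← mul_assoc (sideSign b), sideSign_mul_self, one_mul] at this
    refine this.congr' ?_
    filter_upwards [hr'] with p hp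
    simp only [unscale, PlaneState.fly, baseX, centreX, Sum.elim_inl]
    rw [hp.2]
    have := hp.1.ne'
    field_simp
    linear_combination (-(2 * ((i : ℝ) + 1))) * sideSign_mul_self b
  · intro k
    obtain ⟨-, h2, -, -⟩ := hS' (Sum.inl k)
    have := (hur _ _ h2).add (ht.mul (hwr _ (hw k)))
    rw [mul_zero, zero_add] at this
    refine this.congr fun p => ?_
    simp only [unscale, PlaneState.fly, baseY, Sum.elim_inl]
    ring
  · intro k
    exact hur _ _ (hS' (Sum.inl k)).2.2.1
  · intro k
    exact hwr _ (hw k)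
  · intro k hk
    have hka : k ≠ a := fun h => by subst h; omega
    filter_upwards [hS.next k (by omega), hiso] with p h1 h2
    obtain ⟨e1, e2, e3, e4⟩ := h2 k hka
    have e3' : (unscale (lam p) (baseX a (S p)) (baseY a (S p)) (S' p)).u (Sum.inr k) =
        (S p).u (Sum.inr k) := e3
    have e4' : (unscale (lam p) (baseX a (S p)) (baseY a (S p)) (S' p)).w (Sum.inr k) =
        (S p).w (Sum.inr k) := e4
    simp only [PlaneState.fly, e1, e2, e3', e4', h1.1, h1.2.1, h1.2.2.1, h1.2.2.2]
    refine ⟨by ring, ?_, trivial, trivial⟩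
    push_cast; ring
  · intro k hk
    by_cases hka : k = a
    · subst hka
      obtain ⟨h1, h2, h3, h4⟩ := hS' (Sum.inr k)
      simp only [PlaneState.fly, unscale, baseX, baseY, Sum.elim_inr, if_true, zero_add]
      refine ⟨?_, ?_, hur _ _ h3, by simpa [conf] using h4⟩
      · simpa using ((hlam0.pow 2).mul h1).add (ht.mul (hlam0.mul h3))
      · have := (hlam0.mul h2).add (ht.mul h4)
        simp only [conf, Sum.elim_inr] at this
        convert this using 2
        push_cast; ring
    · have hk' : (k : ℕ) < a := by
        have := Fin.val_ne_of_ne hka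
        omega
      obtain ⟨h1, h2, -, h4⟩ := hS.past k hk'
      have h3 := hSu0 k hk'
      have e : ∀ᶠ p in F, ((unscale (lam p) (baseX a (S p)) (baseY a (S p)) (S' p)).fly (t p)).x
            (Sum.inr k) = (S p).x (Sum.inr k) + lam p * T * (S p).u (Sum.inr k) +
              t p * (S p).u (Sum.inr k) ∧
          ((unscale (lam p) (baseX a (S p)) (baseY a (S p)) (S' p)).fly (t p)).y
            (Sum.inr k) = (S p).y (Sum.inr k) + lam p * T * (S p).w (Sum.inr k) +
              t p * (S p).w (Sum.inr k) ∧
          ((unscale (lam p) (baseX a (S p)) (baseY a (S p)) (S' p)).fly (t p)).u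
            (Sum.inr k) = (S p).u (Sum.inr k) ∧
          ((unscale (lam p) (baseX a (S p)) (baseY a (S p)) (S' p)).fly (t p)).w
            (Sum.inr k) = (S p).w (Sum.inr k) := by
        filter_upwards [hiso] with p hp
        obtain ⟨e1, e2, e3, e4⟩ := hp k hka
        rw [← e1, ← e2, ← e4, ← e3]
        exact ⟨rfl, rfl, rfl, rfl⟩
      refine ⟨?_, ?_, ?_, ?_⟩
      · have := (h1.add ((hlam0.mul_const T).mul h3)).add (ht.mul h3)
        simp only [zero_mul, mul_zero, add_zero] at this
        exact this.congr' (e.mono fun p hp => hp.1.symm)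
      · have := (h2.add ((hlam0.mul_const T).mul h4)).add (ht.mul h4)
        have e5 : (10 * ((k : ℕ) - (a : ℕ)) : ℝ) + 0 * T * -1 + 10 * -1 =
            10 * (((k : ℕ) : ℝ) - ((a + 1 : ℕ) : ℝ)) := by push_cast; ring
        rw [e5] at this
        exact this.congr' (e.mono fun p hp => hp.2.1.symm)
      · exact (hwr _ (hSu k hk')).congr' (e.mono fun p hp =>
          congrArg (· / r p) hp.2.2.1.symm)
      · exact h4.congr' (e.mono fun p hp => hp.2.2.2.symm)

/-- After the passage all gaps between neighbours are positive with positive rates, and the second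
derivative of a gap is never negative, so these gaps stay positive forever. -/
theorem eventually_adj_sq {a : Fin c} {lam : P → ℝ} {S S' : P → PlaneState (Ball m c)}
    (hlam0 : Tendsto lam F (𝓝 0)) (hlam' : ∀ᶠ p in F, 0 < lam p) {z s : Bool → ℕ → ℝ}
    {X w Y : ℝ} (hS' : Conv S' F (conf a z s X w Y))
    (hs : ∀ b j, j + 1 < m → s b j < s b (j + 1)) (hz : ∀ b j, j + 1 < m → z b j < z b (j + 1))
    (htip : ∀ b, 0 < gapAt z X Y b 0 ∧ 0 < rateAt s w Y b 0) {k l : Ball m c} (hkl : Adj a k l) :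
    ∀ᶠ p in F, ∀ r, 0 ≤ r →
      4 < ((unscale (lam p) (baseX a (S p)) (baseY a (S p)) (S' p)).fly r).sq k l := by
  have hκ : Tendsto (fun p => lam p ^ 2) F (𝓝 0) := by simpa using hlam0.pow 2
  have hgap := hS'.gap hκ k l
  have hrate := hS'.gapRate hκ k l
  have hpos : 0 < (conf a z s X w Y).gap 0 k l ∧ 0 < (conf a z s X w Y).gapRate 0 k l := by
    obtain ⟨b, j, hj, rfl, rfl⟩ := hkl
    rw [gap_conf a _ _ _ _ _ b hj, rate_conf a _ _ _ _ _ b hj]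
    rcases j with _ | j
    · exact htip b
    · exact ⟨sub_pos.2 (hz b j hj), sub_pos.2 (hs b j hj)⟩
  filter_upwards [hlam', hgap.eventually (lt_mem_nhds hpos.1),
    hrate.eventually (lt_mem_nhds hpos.2)] with p h1 h2 h3 r hr
  have hb := base_of_adj a (S p) hkl
  have e : (unscale (lam p) (baseX a (S p)) (baseY a (S p)) (S' p)).fly r =
      unscale (lam p) (baseX a (S p)) (baseY a (S p)) ((S' p).fly (r / lam p)) := by
    rw [unscale_fly, mul_div_cancel₀ _ h1.ne']
  rw [e, sq_unscale _ hb.1 hb.2, gap_fly]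
  have h4 : 0 ≤ gapCurv (lam p ^ 2) (S' p) k l := by unfold gapCurv; positivity
  have h5 : 0 ≤ r / lam p := div_nonneg hr h1.le
  have : 0 < gapCurv (lam p ^ 2) (S' p) k l * (r / lam p) ^ 2 +
      gapRate (lam p ^ 2) (S' p) k l * (r / lam p) + gap (lam p ^ 2) (S' p) k l := by positivity
  have : 0 < 4 * lam p ^ 2 * (gapCurv (lam p ^ 2) (S' p) k l * (r / lam p) ^ 2 +
      gapRate (lam p ^ 2) (S' p) k l * (r / lam p) + gap (lam p ^ 2) (S' p) k l) := by positivity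
  linarith

/-- The horizontal distance misses 2 by at most `lam ^ 2 + o`, which costs at most `4 * (lam ^ 2 +
o)` in the square. This is at most a fraction of `h ^ 2` that the height, at least `9 / 10 * h`,
makes up for. -/
theorem four_lt_of_offset {D B y h lam o : ℝ} (hB : B ≤ D) (hB0 : 0 ≤ B)
    (hBo : B = 2 - lam ^ 2 - o) (ho : 4 * o ≤ h ^ 2 / 2) (hlam : 0 ≤ lam) (hlh : lam ≤ h / 10)
    (hh : 0 < h) (hy : h - lam ≤ y) : 4 < D ^ 2 + y ^ 2 := by
  have h1 : B ^ 2 ≤ D ^ 2 := pow_le_pow_left₀ hB0 hB 2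
  have h2 : (9 / 10 * h) ^ 2 ≤ y ^ 2 := pow_le_pow_left₀ (by positivity) (by linarith) 2
  have h3 : lam ^ 2 ≤ (h / 10) ^ 2 := pow_le_pow_left₀ hlam hlh 2
  have h4 : 4 - 4 * (lam ^ 2 + o) ≤ B ^ 2 := by
    rw [hBo]; nlinarith [sq_nonneg (lam ^ 2 + o)]
  nlinarith [mul_pos hh hh]

/-- The next ball comes down to height `h'`, which tends to 0, above tips that are nearly in its
way. Contact is avoided because its offset is small against `h' ^ 2`, the tips move outwards, and
their vertical displacement is at most `lam`, small against `h'`. -/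
theorem Stage.eventually_next_sq {a : Fin c} {ν lam : P → ℝ} {κ : Bool → ℕ → ℝ}
    {off : Fin c → P → ℝ} {h h' : P → ℝ} {S S' : P → PlaneState (Ball m c)}
    (hS : Stage F a ν κ off h S) (hlam0 : Tendsto lam F (𝓝 0)) (hlam' : ∀ᶠ p in F, 0 < lam p)
    (hh : Tendsto h F (𝓝 0)) (hh' : Tendsto h' F (𝓝 0)) (hh'0 : ∀ᶠ p in F, 0 < h' p)
    (hlh : Tendsto (fun p => lam p / h' p) F (𝓝 0)) (hoff0 : ∀ k, Tendsto (off k) F (𝓝 0))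
    {z s : Bool → ℕ → ℝ} {X w Y T : ℝ} (hS' : Conv S' F (conf a z s X w Y))
    (hiso : ∀ᶠ p in F, ∀ k, k ≠ a →
        (unscale (lam p) (baseX a (S p)) (baseY a (S p)) (S' p)).x (Sum.inr k) =
          (S p).x (Sum.inr k) + (lam p) * T * (S p).u (Sum.inr k) ∧
        (unscale (lam p) (baseX a (S p)) (baseY a (S p)) (S' p)).y (Sum.inr k) =
          (S p).y (Sum.inr k) + (lam p) * T * (S p).w (Sum.inr k) ∧
        (lam p) * (S' p).u (Sum.inr k) = (S p).u (Sum.inr k) ∧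
        (S' p).w (Sum.inr k) = (S p).w (Sum.inr k))
    (hw : ∀ k, Tendsto (fun p => (S' p).w (Sum.inl k) / lam p) F (𝓝 0))
    (hsp : ∀ b j, j < m → 0 < s b j) (hz0 : ∀ b, 0 ≤ z b 0) {k : Fin c} (hk : (k : ℕ) = a + 1)
    (hoff : ∀ᶠ p in F, 4 * |off k p| ≤ h' p ^ 2 / 2) (b : Bool) (i : Fin m) (hi : (i : ℕ) = 0) :
    ∀ᶠ p in F, ∀ r ∈ Icc 0 (10 + h p - lam p * T - h' p),
      4 < ((unscale (lam p) (baseX a (S p)) (baseY a (S p)) (S' p)).fly r).sq (Sum.inl (b, i))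
        (Sum.inr k) := by
  have hka : k ≠ a := fun h => by subst h; omega
  have ht : Tendsto (fun p => 10 + h p - lam p * T - h' p) F (𝓝 10) := by
    simpa using ((hh.const_add 10).sub (hlam0.mul_const T)).sub hh'
  obtain ⟨h1, h2, h3, -⟩ := hS' (Sum.inl (b, i))
  simp only [conf, Sum.elim_inl, hi] at h1 h2 h3
  have h1' := h1.const_mul (sideSign b)
  have h3' := h3.const_mul (sideSign b)
  rw [← mul_assoc, sideSign_mul_self, one_mul] at h1' h3'
  have hB : Tendsto (fun p => 2 - lam p ^ 2 - |off k p|) F (𝓝 2) := by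
    simpa using ((hlam0.pow 2).const_sub 2).sub (hoff0 k).abs
  filter_upwards [hlam', hh'0, hoff, hiso, hS.next k (by omega),
    ht.eventually (gt_mem_nhds (show (10 : ℝ) < 11 by norm_num)),
    h1'.eventually (lt_mem_nhds (show (-1 : ℝ) < z b 0 by linarith [hz0 b])),
    h3'.eventually (lt_mem_nhds (hi ▸ hsp b i i.2 : (0 : ℝ) < s b 0)),
    hB.eventually (lt_mem_nhds two_pos), hlh.eventually (gt_mem_nhds (show (0 : ℝ) < 1 / 10 by norm_num)),
    h2.abs.eventually (gt_mem_nhds (show |(0 : ℝ)| < 1 / 2 by norm_num)),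
    (hw (b, i)).abs.eventually (gt_mem_nhds (show |(0 : ℝ)| < 1 / 40 by norm_num))] with
    p g1 g2 g3 g4 g5 g6 g7 g8 g9 g10 g11 g12 r hr
  obtain ⟨e1, e2, e3, e4⟩ := g4 k hka
  have e3' : (unscale (lam p) (baseX a (S p)) (baseY a (S p)) (S' p)).u (Sum.inr k) =
      (S p).u (Sum.inr k) := e3
  have e4' : (unscale (lam p) (baseX a (S p)) (baseY a (S p)) (S' p)).w (Sum.inr k) =
      (S p).w (Sum.inr k) := e4
  rw [div_lt_iff₀ g2] at g10
  rw [abs_div, abs_of_pos g1, div_lt_iff₀ g1] at g12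
  have hss := sideSign_mul_self b
  have hsq : ∀ A : ℝ, A ^ 2 = (sideSign b * A) ^ 2 := fun A => by
    linear_combination (-A ^ 2) * hss
  have hso : sideSign b * off k p ≤ |off k p| := by
    cases b
    · simpa [sideSign] using neg_le_abs (off k p)
    · simpa [sideSign] using le_abs_self (off k p)
  rw [PlaneState.sq]
  simp only [PlaneState.fly, e1, e2, e3', e4', g5.1, g5.2.1, g5.2.2.1, g5.2.2.2, hk]
  simp only [unscale, baseX, baseY, centreX, Sum.elim_inl, hi]
  rw [hsq, ← neg_sq (_ - (_ + r * (-1)))]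
  refine four_lt_of_offset (B := 2 - lam p ^ 2 - |off k p|) (o := |off k p|) (h := h' p)
    (lam := lam p) ?_ (by linarith) rfl g3 g1.le (by linarith) g2 ?_
  · have e5 : sideSign b * (sideSign b * (2 * ((0 : ℕ) + 1)) + lam p ^ 2 * (S' p).x (Sum.inl (b, i)) +
        r * (lam p * (S' p).u (Sum.inl (b, i))) - (off k p + lam p * T * 0 + r * 0)) =
        2 + lam p ^ 2 * (sideSign b * (S' p).x (Sum.inl (b, i))) +
          r * lam p * (sideSign b * (S' p).u (Sum.inl (b, i))) - sideSign b * off k p := by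
      push_cast
      linear_combination 2 * hss
    rw [e5]
    have : 0 ≤ r * lam p * (sideSign b * (S' p).u (Sum.inl (b, i))) :=
      mul_nonneg (mul_nonneg hr.1 g1.le) g8.le
    have : lam p ^ 2 * (-1) ≤ lam p ^ 2 * (sideSign b * (S' p).x (Sum.inl (b, i))) := by
      gcongr
    linarith
  · have e6 : r * (S' p).w (Sum.inl (b, i)) ≤ lam p / 2 := by
      have := le_abs_self ((S' p).w (Sum.inl (b, i)))
      have : r * (S' p).w (Sum.inl (b, i)) ≤ r * (1 / 40 * lam p) := by
        have := hr.1
        gcongr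
        linarith
      have : r * (1 / 40 * lam p) ≤ 11 * (1 / 40 * lam p) := by
        gcongr
        linarith [hr.2]
      linarith
    have e7 : lam p * (S' p).y (Sum.inl (b, i)) ≤ lam p / 2 := by
      have : (S' p).y (Sum.inl (b, i)) ≤ 1 / 2 := (le_abs_self _).trans g11.le
      have : lam p * (S' p).y (Sum.inl (b, i)) ≤ lam p * (1 / 2) := by gcongr
      linarith
    push_cast
    linarith [hr.2]

end Ball

namespace Ball

open PlaneState

variable {m c : ℕ} {P : Type*} {F : Filter P}

/-- After the passage of the ball `a`, the balls fly freely until the next ball arrives. -/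
theorem Stage.eventually_separated {a : Fin c} {ν lam : P → ℝ} {κ : Bool → ℕ → ℝ}
    {off : Fin c → P → ℝ} {h h' : P → ℝ} {S S' : P → PlaneState (Ball m c)}
    (hS : Stage F a ν κ off h S) (hν : Tendsto ν F (𝓝 0)) (hν' : ∀ᶠ p in F, 0 < ν p)
    (hlam0 : Tendsto lam F (𝓝 0)) (hlam' : ∀ᶠ p in F, 0 < lam p)
    (hh : Tendsto h F (𝓝 0)) (hh' : Tendsto h' F (𝓝 0)) (hh'0 : ∀ᶠ p in F, 0 < h' p)
    (hlh : Tendsto (fun p => lam p / h' p) F (𝓝 0)) (hoff0 : ∀ k, Tendsto (off k) F (𝓝 0))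
    {z s : Bool → ℕ → ℝ} {X w Y T : ℝ} (hS' : Conv S' F (conf a z s X w Y))
    (hiso : ∀ᶠ p in F, ∀ k, k ≠ a →
        (unscale (lam p) (baseX a (S p)) (baseY a (S p)) (S' p)).x (Sum.inr k) =
          (S p).x (Sum.inr k) + (lam p) * T * (S p).u (Sum.inr k) ∧
        (unscale (lam p) (baseX a (S p)) (baseY a (S p)) (S' p)).y (Sum.inr k) =
          (S p).y (Sum.inr k) + (lam p) * T * (S p).w (Sum.inr k) ∧
        (lam p) * (S' p).u (Sum.inr k) = (S p).u (Sum.inr k) ∧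
        (S' p).w (Sum.inr k) = (S p).w (Sum.inr k))
    (hw : ∀ k, Tendsto (fun p => (S' p).w (Sum.inl k) / lam p) F (𝓝 0))
    (hsp : ∀ b j, j < m → 0 < s b j) (hs : ∀ b j, j + 1 < m → s b j < s b (j + 1))
    (hz : ∀ b j, j + 1 < m → z b j < z b (j + 1))
    (htip : ∀ b, 0 ≤ z b 0 ∧ 0 < gapAt z X Y b 0 ∧ 0 < rateAt s w Y b 0)
    (hoff : ∀ k : Fin c, (k : ℕ) = a + 1 → ∀ᶠ p in F, 4 * |off k p| ≤ h' p ^ 2 / 2) :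
    ∀ᶠ p in F, ∀ k l, k ≠ l → ∀ r ∈ Icc 0 (10 + h p - lam p * T - h' p),
      4 < ((unscale (lam p) (baseX a (S p)) (baseY a (S p)) (S' p)).fly r).sq k l := by
  have ht : Tendsto (fun p => 10 + h p - lam p * T - h' p) F (𝓝 10) := by
    simpa using ((hh.const_add 10).sub (hlam0.mul_const T)).sub hh'
  have hSk : ∀ k : Fin c, k ≠ a → Tendsto (fun p => (S p).x (Sum.inr k)) F (𝓝 0) ∧
      Tendsto (fun p => (S p).y (Sum.inr k)) F (𝓝 (10 * ((k : ℕ) - (a : ℕ)))) ∧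
      Tendsto (fun p => (S p).u (Sum.inr k)) F (𝓝 0) ∧
      Tendsto (fun p => (S p).w (Sum.inr k)) F (𝓝 (-1)) := by
    intro k hk
    rcases lt_or_ge (k : ℕ) a with h1 | h1
    · obtain ⟨e1, e2, e3, e4⟩ := hS.past k h1
      refine ⟨e1, e2, ?_, e4⟩
      have := e3.mul hν
      rw [zero_mul] at this
      refine this.congr' ?_
      filter_upwards [hν'] with p hp
      field_simp
    · have hn := hS.next k h1
      refine ⟨(hoff0 k).congr' (hn.mono fun p hp => hp.1.symm), ?_,
        tendsto_const_nhds.congr' (hn.mono fun p hp => hp.2.2.1.symm),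
        tendsto_const_nhds.congr' (hn.mono fun p hp => hp.2.2.2.symm)⟩
      have := hh.const_add (10 * (((k : ℕ) : ℝ) - (a : ℕ)))
      rw [add_zero] at this
      exact this.congr' (hn.mono fun p hp => hp.2.1.symm)
  have conv : Conv (fun p => unscale (lam p) (baseX a (S p)) (baseY a (S p)) (S' p)) F
      ⟨centreX, centreY a, fun _ => 0, Sum.elim (fun _ => 0) fun _ => -1⟩ := by
    rintro (k | k)
    · obtain ⟨e1, e2, e3, e4⟩ := hS' (Sum.inl k)
      refine ⟨?_, ?_, ?_, e4⟩ <;> simp only [unscale, baseX, baseY, centreY, Sum.elim_inl]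
      · simpa using ((hlam0.pow 2).mul e1).const_add (centreX (Sum.inl k : Ball m c))
      · simpa using hlam0.mul e2
      · simpa using hlam0.mul e3
    · by_cases hk : k = a
      · subst hk
        obtain ⟨e1, e2, e3, e4⟩ := hS' (Sum.inr k)
        refine ⟨?_, ?_, ?_, by simpa [conf, unscale] using e4⟩ <;>
          simp only [unscale, baseX, baseY, centreX, centreY, Sum.elim_inr, if_true]
        · simpa using (hlam0.pow 2).mul e1
        · simpa using hlam0.mul e2
        · simpa using hlam0.mul e3
      · obtain ⟨e1, e2, e3, e4⟩ := hSk k hk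
        refine ⟨?_, ?_, ?_, ?_⟩ <;> simp only [centreX, centreY, Sum.elim_inr]
        · have := e1.add ((hlam0.mul_const T).mul e3)
          simp only [zero_mul, add_zero] at this
          exact this.congr' (hiso.mono fun p hp => (hp k hk).1.symm)
        · have := e2.add ((hlam0.mul_const T).mul e4)
          simp only [zero_mul, add_zero] at this
          exact this.congr' (hiso.mono fun p hp => (hp k hk).2.1.symm)
        · exact e3.congr' (hiso.mono fun p hp => (hp k hk).2.2.1.symm)
        · exact e4.congr' (hiso.mono fun p hp => (hp k hk).2.2.2.symm)
  have hadj : ∀ k l, Adj a k l → ∀ᶠ p in F, ∀ r ∈ Icc 0 (10 + h p - lam p * T - h' p),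
      4 < ((unscale (lam p) (baseX a (S p)) (baseY a (S p)) (S' p)).fly r).sq k l :=
    fun k l hkl => (eventually_adj_sq hlam0 hlam' hS' hs hz (fun b => (htip b).2) hkl).mono
      fun p hp r hr => hp r hr.1
  have hsymm : ∀ k l, (∀ᶠ p in F, ∀ r ∈ Icc 0 (10 + h p - lam p * T - h' p),
      4 < ((unscale (lam p) (baseX a (S p)) (baseY a (S p)) (S' p)).fly r).sq k l) →
      ∀ᶠ p in F, ∀ r ∈ Icc 0 (10 + h p - lam p * T - h' p),
      4 < ((unscale (lam p) (baseX a (S p)) (baseY a (S p)) (S' p)).fly r).sq l k :=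
    fun k l hkl => hkl.mono fun p hp r hr => by rw [sq_comm]; exact hp r hr
  have hmixed : ∀ b i k, ∀ᶠ p in F, ∀ r ∈ Icc 0 (10 + h p - lam p * T - h' p),
      4 < ((unscale (lam p) (baseX a (S p)) (baseY a (S p)) (S' p)).fly r).sq (Sum.inl (b, i))
        (Sum.inr k) := by
    intro b i k
    by_cases hi : (i : ℕ) = 0
    · by_cases hka : k = a
      · subst hka
        rcases adj_tip_cases k (b := b) hi with h1 | h1
        · exact hadj _ _ h1
        · exact hsymm _ _ (hadj _ _ h1)
      -- This is the only further ball whose limiting height reaches 0 during the flight; for the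
      -- others convergence suffices.
      by_cases hk : (k : ℕ) = a + 1
      · exact hS.eventually_next_sq hlam0 hlam' hh hh' hh'0 hlh hoff0 hS' hiso hw hsp
          (fun b => (htip b).1) hk (hoff k hk) b i hi
      · refine conv.eventually_sq ht (by norm_num) fun r hr => ?_
        have e := centre_tip_sq b i k
        simp only [PlaneState.sq, PlaneState.fly, mul_zero, add_zero, e, hi, centreY, Sum.elim_inl,
          Sum.elim_inr]
        have : (k : ℝ) + 1 ≤ (a : ℕ) ∨ ((a : ℕ) : ℝ) + 2 ≤ k := by
          have := Fin.val_ne_of_ne hka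
          have : (k : ℕ) + 1 ≤ a ∨ (a : ℕ) + 2 ≤ k := by omega
          exact_mod_cast this
        have h2 : (0 : ℝ) < (10 * ((k : ℝ) - (a : ℕ)) - r) ^ 2 := by
          refine sq_pos_of_ne_zero fun h0 => ?_
          rcases this with h3 | h3 <;> linarith [hr.1, hr.2]
        push_cast
        nlinarith
    · refine conv.eventually_sq ht (by norm_num) fun r hr => ?_
      have e := centre_tip_sq b i k
      simp only [PlaneState.sq, PlaneState.fly, mul_zero, add_zero, e]
      have : (1 : ℝ) ≤ (i : ℕ) := by exact_mod_cast Nat.one_le_iff_ne_zero.2 hi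
      nlinarith [sq_nonneg ((centreY a (Sum.inl (b, i) : Ball m c) : ℝ) +
        r * Sum.elim (fun _ => 0) (fun _ => -1) (Sum.inl (b, i) : Ball m c) -
        (centreY a (Sum.inr k : Ball m c) +
          r * Sum.elim (fun _ => 0) (fun _ => -1) (Sum.inr k : Ball m c)))]
  rw [eventually_all]; intro k
  rw [eventually_all]; intro l
  rw [eventually_imp_distrib_left]; intro hkl
  by_cases hA : Adj a k l
  · exact hadj k l hA
  by_cases hB : Adj a l k
  · exact hsymm l k (hadj l k hB)
  have hc := four_lt_centre a hkl hA hB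
  rcases k with ⟨b, i⟩ | k <;> rcases l with ⟨b', i'⟩ | l
  · refine conv.eventually_sq ht (by norm_num) fun r hr => ?_
    simpa [PlaneState.sq, PlaneState.fly] using hc
  · exact hmixed b i l
  · exact hsymm _ _ (hmixed b' i' k)
  · refine conv.eventually_sq ht (by norm_num) fun r hr => ?_
    simpa [PlaneState.sq, PlaneState.fly] using hc

/-- The passages of the last `j` balls. -/
theorem exists_stages {d : ℕ} (hd : 2 ≤ d) (hm : 0 < m) (j : ℕ) : ∀ (a : ℕ) (κ : Bool → ℕ → ℝ)
    (ν : P → ℝ), a + j = c → (∀ b, 0 ≤ κ b 0) → (∀ b i, i + 1 < m → κ b i < κ b (i + 1)) →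
    Tendsto ν F (𝓝 0) → (∀ᶠ p in F, 0 < ν p) →
    ∃ (off : Fin c → P → ℝ) (h : P → ℝ), (∀ k, Tendsto (off k) F (𝓝 0)) ∧ Tendsto h F (𝓝 0) ∧
      (∀ᶠ p in F, 0 < h p) ∧ Tendsto (fun p => ν p ^ 2 / h p) F (𝓝 0) ∧
      (∀ k : Fin c, (k : ℕ) = a → ∀ᶠ p in F, 4 * |off k p| ≤ h p ^ 2 / 2) ∧
      ∀ S : P → PlaneState (Ball m c), Stage F a ν κ off h S → ∀ᶠ p in F, ∀ S₀ T₀ N₀,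
        PlaneEvo hd S₀ T₀ N₀ (S p) →
        ∃ T S₁, PlaneEvo hd S₀ T (N₀ + j * (m * (m + 1))) S₁ := by
  induction j with
  | zero =>
    intro a κ ν ha _ _ hν hν'
    -- With no ball left, `h` only has to tend to 0 more slowly than `ν ^ 2`. The given evolution is
    -- returned as it is; a conclusion about an added evolution would need positive duration.
    refine ⟨fun _ _ => 0, ν, fun _ => tendsto_const_nhds, hν, hν', hν.congr' ?_, fun k hk => ?_,
      fun S _ => Eventually.of_forall fun p S₀ T₀ N₀ h0 => ⟨T₀, S p, by simpa using h0⟩⟩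
    · filter_upwards [hν'] with p hp
      field_simp
    · omega
  | succ j ih =>
    intro a κ ν ha hκ0 hκ hν hν'
    obtain ⟨ε, hε, pass⟩ := exists_pass (c := c) hm
    obtain ⟨M, hM⟩ : ∃ M, ∀ b (i : Fin m), κ b i ≤ M := by
      obtain ⟨M, hM⟩ := (Set.finite_range fun k : Bool × Fin m => κ k.1 k.2).bddAbove
      exact ⟨M, fun b i => hM ⟨(b, i), rfl⟩⟩
    -- A large factor `L` in the scale makes the rescaled displacements `κ / L ^ 2` as small as the
    -- passage requires. The bound `1 / 4` serves the estimate of the offset of ball `a`.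
    obtain ⟨L, hL, hL1⟩ : ∃ L : ℝ, 0 < L ∧ |M| ≤ min ε (1 / 4) * L ^ 2 := by
      have h0 : 0 < min ε (1 / 4) := lt_min hε (by norm_num)
      refine ⟨√(|M| / min ε (1 / 4) + 1), Real.sqrt_pos.2 (by positivity), ?_⟩
      rw [Real.sq_sqrt (by positivity), mul_add, mul_div_cancel₀ _ h0.ne']
      linarith
    set ρ : Bool → ℕ → ℝ := fun b i => κ b i / L ^ 2 with hρ
    have hL2 : 0 < L ^ 2 := by positivity
    have hρε : ∀ b i, i < m → ρ b i ≤ min ε (1 / 4) := by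
      intro b i hi
      rw [hρ]
      simp only
      rw [div_le_iff₀ hL2]
      exact (hM b ⟨i, hi⟩).trans ((le_abs_self M).trans hL1)
    have hρ0 : ∀ b, 0 ≤ ρ b 0 := fun b => div_nonneg (hκ0 b) hL2.le
    obtain ⟨T, z, s, X, w, Y, hev, hsp, hs, hz, htip⟩ := pass ⟨a, by omega⟩ ρ
      (fun b i hi => by simp only [hρ]; gcongr; exact hκ b i hi) hρ0
      (fun b i hi => (hρε b i hi).trans (min_le_left _ _))
    set lam : P → ℝ := fun p => L * ν p with hlam
    have hlam0 : Tendsto lam F (𝓝 0) := by simpa using hν.const_mul L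
    have hlam' : ∀ᶠ p in F, 0 < lam p := hν'.mono fun p hp => mul_pos hL hp
    -- The limiting velocities `s` depend only on `κ` and `L`, not on the states `S`. So the offsets
    -- of all later balls can be fixed before any evolution is considered, which is why `off` and
    -- `h` precede `S` in the statement.
    obtain ⟨off, h', ho1, ho2, ho3, ho4, ho5, ho6⟩ := ih (a + 1) (fun b i => 10 * s b i)
      (fun p => √(lam p)) (by omega) (fun b => by linarith [hsp b 0 hm])
      (fun b i hi => by linarith [hs b i hi]) (by simpa using hlam0.sqrt)
      (hlam'.mono fun p hp => Real.sqrt_pos.2 hp)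
    have hlh : Tendsto (fun p => lam p / h' p) F (𝓝 0) := by
      refine ho4.congr' ?_
      filter_upwards [hlam'] with p hp
      rw [Real.sq_sqrt hp.le]
    set off' : Fin c → P → ℝ := fun k p =>
      if (k : ℕ) = a then -(1 / 4 + ρ false 0) * (L * ν p) ^ 2 else off k p with hoff'
    have hoffne : ∀ k : Fin c, (k : ℕ) ≠ a → off' k = off k := fun k hk => by
      funext p; simp [hoff', hk]
    have hoffa : ∀ k : Fin c, (k : ℕ) = a →
        off' k = fun p => -(1 / 4 + ρ false 0) * (L * ν p) ^ 2 := fun k hk => by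
      funext p; simp [hoff', hk]
    have hoff0 : ∀ k, Tendsto (off' k) F (𝓝 0) := by
      intro k
      by_cases hk : (k : ℕ) = a
      · rw [hoffa k hk]
        simpa using (hlam0.pow 2).const_mul (-(1 / 4 + ρ false 0))
      · rw [hoffne k hk]; exact ho1 k
    have hh0 : Tendsto (fun p => 2 * (L * ν p)) F (𝓝 0) := by simpa using hlam0.const_mul 2
    refine ⟨off', fun p => 2 * (L * ν p), hoff0, hh0, ?_, ?_, ?_, ?_⟩
    · filter_upwards [hlam'] with p hp
      exact mul_pos two_pos hp
    · have := hν.div_const (2 * L)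
      rw [zero_div] at this
      refine this.congr' ?_
      filter_upwards [hν'] with p hp
      field_simp
    · intro k hk
      rw [hoffa k hk]
      refine Eventually.of_forall fun p => ?_
      have h1 := hρ0 false
      have h2 : ρ false 0 ≤ 1 / 4 := (hρε false 0 hm).trans (min_le_right _ _)
      rw [abs_mul, abs_neg, abs_of_nonneg (by linarith), abs_of_nonneg (sq_nonneg _)]
      nlinarith [sq_nonneg (L * ν p)]
    · intro S hS
      have hS₁ : Stage F ((⟨a, by omega⟩ : Fin c) : ℕ) ν κ off' (fun p => 2 * (L * ν p)) S := hS
      obtain ⟨S', c1, c2, c3, c4⟩ := hS₁.exists_pass hd hν hν' hL (fun _ _ => rfl) hoff0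
        (fun _ => rfl) (fun p => by rw [hoffa _ rfl]) hev
      have hw : ∀ k, Tendsto (fun p => (S' p).w (Sum.inl k) / lam p) F (𝓝 0) := by
        intro k
        have h1 := (hS.chain_w k).div_const L
        have := (c3 (Sum.inl k)).add h1
        rw [zero_div, add_zero] at this
        refine this.congr fun p => ?_
        rw [div_div, mul_comm (ν p), sub_div, sub_add_cancel]
      have flight := hS₁.flight (L := L) (lam := lam) (T := T) (fun _ => rfl) hlam0 hlam' hh0 ho2 c1
        c2 hw
      have sep := hS₁.eventually_separated hν hν' hlam0 hlam' hh0 ho2 ho3 hlh hoff0 c1 c2 hw hsp hs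
        hz htip (fun k hk => by rw [hoffne k (by simp only at hk; omega)]; exact ho5 k hk)
      have ht : Tendsto (fun p => 10 + 2 * (L * ν p) - lam p * T - h' p) F (𝓝 10) := by
        simpa using ((hh0.const_add 10).sub (hlam0.mul_const T)).sub ho2
      have flight' : Stage F (a + 1) (fun p => √(lam p)) (fun b i => 10 * s b i) off h' _ :=
        ⟨flight.chain_x, flight.chain_y, flight.chain_u, flight.chain_w, fun k hk => by
          rw [← hoffne k (by omega)]; exact flight.next k hk, flight.past⟩
      filter_upwards [ho6 _ flight', c4, sep, ht.eventually (lt_mem_nhds (show (0 : ℝ) < 10 by norm_num))] with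
        p q1 q2 q3 q4 S₀ T₀ N₀ h0
      have q5 := (h0.trans q2).trans (PlaneEvo.free (hd := hd) q4 fun r hr k l hkl => q3 k l hkl r hr)
      obtain ⟨T₁, S₁, h1⟩ := q1 _ _ _ q5
      refine ⟨T₁, S₁, ?_⟩
      rwa [show N₀ + m * (m + 1) + 0 + j * (m * (m + 1)) = N₀ + (j + 1) * (m * (m + 1)) by ring] at h1

end Ball

/-! ### The one-dimensional gas formed by the two chains. -/

namespace Ball

open PlaneState

variable {m c : ℕ}

/-- The numbering of the balls of the two chains from left to right. -/
def chainIndex (k : Bool × Fin m) : ℤ := if k.1 then (k.2 : ℤ) else -(k.2 : ℤ) - 1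

theorem chainIndex_injective : Function.Injective (chainIndex (m := m)) := by
  rintro ⟨b, i⟩ ⟨b', i'⟩ h
  cases b <;> cases b' <;> simp only [chainIndex, if_true, Bool.false_eq_true, if_false] at h
  · congr 1; ext; omega
  · omega
  · omega
  · congr 1; ext; omega

theorem exists_chainIndex {β β' : Bool × Fin m} (h : chainIndex β < chainIndex β') :
    ∃ γ : Bool × Fin m, chainIndex γ = chainIndex β + 1 := by
  obtain ⟨b, i, hi⟩ := β
  obtain ⟨b', i', hi'⟩ := β'
  cases b
  · rcases i with _ | i
    · exact ⟨(true, ⟨0, by omega⟩), by simp [chainIndex]⟩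
    · exact ⟨(false, ⟨i, by omega⟩), by simp [chainIndex]; ring⟩
  · cases b'
    · simp [chainIndex] at h; omega
    · simp only [chainIndex, if_true] at h
      exact ⟨(true, ⟨i + 1, by omega⟩), by simp [chainIndex]⟩

/-- The trajectory of a point particle with velocity `v`. -/
def line (v q t : ℝ) : ℝ := v * t + v ^ 2 + q

/-- The term `v ^ 2` in `line` makes two lines meet at minus the sum of their velocities. Different
meeting times thus amount to different pair sums. -/
theorem line_sub (v v' q t : ℝ) : line v q t - line v' q t = (v - v') * (t + (v + v')) := by
  unfold line; ring

/-- The chain balls move on the axis, and, up to the diameters of the balls, the ball `k` follows the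
line number `π k`; the other balls fall. -/
noncomputable def gas (v : Bool × Fin m → ℝ) (q : ℝ) (off Y : Fin c → ℝ)
    (π : Equiv.Perm (Bool × Fin m)) (t : ℝ) : PlaneState (Ball m c) where
  x := Sum.elim (fun k => 2 * chainIndex k + 1 + line (v (π k)) q t) off
  y := Sum.elim (fun _ => 0) fun k => Y k - t
  u := Sum.elim (fun k => v (π k)) fun _ => 0
  w := Sum.elim (fun _ => 0) fun _ => -1

/-- The point particles are in the order of the balls that follow them. -/
def InOrder (v : Bool × Fin m → ℝ) (q : ℝ) (π : Equiv.Perm (Bool × Fin m)) (t : ℝ) : Prop :=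
  ∀ k l, chainIndex k < chainIndex l → line (v (π k)) q t < line (v (π l)) q t

section gas

variable {v : Bool × Fin m → ℝ} {q : ℝ} {off Y : Fin c → ℝ} {π : Equiv.Perm (Bool × Fin m)} {t T : ℝ}

theorem gas_fly (s : ℝ) : (gas v q off Y π t).fly s = gas v q off Y π (t + s) := by
  simp only [gas, PlaneState.fly, PlaneState.mk.injEq, and_true]
  constructor <;> funext k <;> rcases k with k | k <;> simp [line] <;> ring

theorem gas_sq_chain {k l : Bool × Fin m} (h : chainIndex k < chainIndex l)
    (hl : line (v (π k)) q t < line (v (π l)) q t) :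
    4 < (gas v q off Y π t).sq (Sum.inl k) (Sum.inl l) := by
  have h' : (chainIndex k : ℝ) + 1 ≤ chainIndex l := by exact_mod_cast h
  simp only [PlaneState.sq, gas, Sum.elim_inl]
  nlinarith

theorem gas_sq (hY : ∀ k, 3 ≤ Y k - t) (hYY : ∀ k l, k ≠ l → 4 < (Y k - Y l) ^ 2) {a b : Ball m c}
    (hab : a ≠ b) (h : ∀ k l, ((a = Sum.inl k ∧ b = Sum.inl l) ∨ (b = Sum.inl k ∧ a = Sum.inl l)) →
      chainIndex k < chainIndex l → line (v (π k)) q t < line (v (π l)) q t) :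
    4 < (gas v q off Y π t).sq a b := by
  rcases a with k | k <;> rcases b with l | l
  · have hkl : chainIndex k ≠ chainIndex l := fun e => hab (congrArg _ (chainIndex_injective e))
    rcases lt_or_gt_of_ne hkl with h1 | h1
    · exact gas_sq_chain h1 (h k l (Or.inl ⟨rfl, rfl⟩) h1)
    · rw [sq_comm]; exact gas_sq_chain h1 (h l k (Or.inr ⟨rfl, rfl⟩) h1)
  · simp only [PlaneState.sq, gas, Sum.elim_inl, Sum.elim_inr]
    nlinarith [hY l, sq_nonneg (2 * chainIndex k + 1 + line (v (π k)) q t - off l)]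
  · simp only [PlaneState.sq, gas, Sum.elim_inl, Sum.elim_inr]
    nlinarith [hY k, sq_nonneg (off k - (2 * chainIndex l + 1 + line (v (π l)) q t))]
  · have := hYY k l fun e => hab (congrArg _ e)
    simp only [PlaneState.sq, gas, Sum.elim_inr]
    nlinarith [sq_nonneg (off k - off l)]

theorem line_lt_of_no_crossing {v v' q t s : ℝ} (h : line v q t < line v' q t) (hts : t ≤ s)
    (hc : ¬ (t < -(v + v') ∧ -(v + v') ≤ s)) : line v q s < line v' q s := by
  rw [← sub_neg, line_sub] at h ⊢
  rcases lt_or_ge t (-(v + v')) with h1 | h1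
  · have h2 : s < -(v + v') := by
      by_contra! h2; exact hc ⟨h1, h2⟩
    have : 0 < v - v' := by
      by_contra! h3
      exact absurd h (not_lt.2 (mul_nonneg_of_nonpos_of_nonpos h3 (by linarith)))
    exact mul_neg_of_pos_of_neg this (by linarith)
  · have : v - v' < 0 := by
      by_contra! h3
      exact absurd h (not_lt.2 (mul_nonneg h3 (by linarith)))
    have h4 : t + (v + v') ≠ 0 := fun h0 => by rw [h0, mul_zero] at h; exact lt_irrefl _ h
    have h5 : 0 < t + (v + v') := lt_of_le_of_ne (by linarith) h4.symm
    exact mul_neg_of_neg_of_pos this (by linarith)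

/-- Equal masses on a line exchange velocities. With the diameters removed, the point particles pass
through each other, and a collision is a transposition of the labels. -/
theorem gas_coll {k l : Bool × Fin m} (hkl : chainIndex l = chainIndex k + 1)
    (h : line (v (π k)) q t = line (v (π l)) q t) :
    (gas v q off Y π t).coll (Sum.inl k) (Sum.inl l) = gas v q off Y (π * Equiv.swap k l) t := by
  have hne : l ≠ k := fun e => by subst e; omega
  have hkl' : (chainIndex l : ℝ) = chainIndex k + 1 := by exact_mod_cast hkl
  have hx : (2 * chainIndex k + 1 + line (v (π k)) q t - (2 * chainIndex l + 1 + line (v (π l)) q t) : ℝ)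
      = -2 := by rw [hkl', h]; ring
  simp only [PlaneState.coll, PlaneState.slope, gas, Sum.elim_inl, hx, PlaneState.mk.injEq, true_and]
  refine ⟨?_, ?_, ?_⟩ <;> funext a <;> rcases a with a | a
  · simp only [Sum.elim_inl, Equiv.Perm.mul_apply]
    by_cases h1 : a = k
    · rw [h1, Equiv.swap_apply_left, h]
    by_cases h2 : a = l
    · rw [h2, Equiv.swap_apply_right, h]
    · rw [Equiv.swap_apply_of_ne_of_ne h1 h2]
  · rfl
  · simp only [Sum.elim_inl, Equiv.Perm.mul_apply, Sum.inl.injEq]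
    by_cases h1 : a = k
    · rw [if_pos h1, h1, Equiv.swap_apply_left]; ring
    by_cases h2 : a = l
    · rw [if_neg h1, if_pos h2, h2, Equiv.swap_apply_right]; ring
    · rw [if_neg h1, if_neg h2, Equiv.swap_apply_of_ne_of_ne h1 h2]
  · simp
  · simp only [Sum.elim_inl, Sum.inl.injEq]
    split_ifs <;> simp
  · simp

/-- A gas of balls on a line, all of whose collisions happen at different times. -/
theorem exists_gas_evolution {d : ℕ} (hd : 2 ≤ d) (hv : Function.Injective v)
    (hsum : ∀ a b a' b', v a < v b → v a' < v b' → v a + v b = v a' + v b' → a = a' ∧ b = b')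
    (hT : ∀ a b, v a < v b → -(v a + v b) < T) (hY : ∀ k, 3 ≤ Y k - T)
    (hYY : ∀ k l, k ≠ l → 4 < (Y k - Y l) ^ 2) (n : ℕ) :
    ∀ (π : Equiv.Perm (Bool × Fin m)) (t : ℝ), t < T → InOrder v q π t →
      (Finset.univ.filter fun k : (Bool × Fin m) × (Bool × Fin m) =>
        v k.1 < v k.2 ∧ t < -(v k.1 + v k.2)).card = n →
      ∃ π', InOrder v q π' T ∧
        PlaneEvo hd (gas v q off Y π t) (T - t) n (gas v q off Y π' T) := by
  induction n with
  | zero =>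
    intro π t ht hπ hn
    rw [Finset.card_eq_zero, Finset.filter_eq_empty_iff] at hn
    have none : ∀ a b, v a ≠ v b → ¬ (t < -(v a + v b)) := by
      intro a b hab h
      rcases lt_or_gt_of_ne hab with h1 | h1
      · exact hn (Finset.mem_univ (a, b)) ⟨h1, h⟩
      · exact hn (Finset.mem_univ (b, a)) ⟨h1, by rwa [add_comm]⟩
    have ord : ∀ s, t ≤ s → InOrder v q π s := fun s hs k l hkl =>
      line_lt_of_no_crossing (hπ k l hkl) hs fun h => none _ _
        (hv.ne (π.injective.ne fun e => by subst e; omega)) h.1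
    refine ⟨π, ord T ht.le, ?_⟩
    have := PlaneEvo.free (hd := hd) (S := gas v q off Y π t) (T := T - t) (by linarith)
      fun s hs a b hab => by
        rw [gas_fly]
        exact gas_sq (fun k => by linarith [hY k, hs.2]) hYY hab
          fun k l _ hkl => ord (t + s) (by linarith [hs.1]) k l hkl
    rwa [gas_fly, add_sub_cancel] at this
  | succ n ih =>
    intro π t ht hπ hn
    obtain ⟨⟨a, b⟩, hab, hmin⟩ := Finset.exists_min_image _
      (fun k : (Bool × Fin m) × (Bool × Fin m) => -(v k.1 + v k.2))
      (Finset.card_pos.1 (by rw [hn]; omega))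
    simp only [Finset.mem_filter, Finset.mem_univ, true_and] at hab hmin
    obtain ⟨τ, hτ⟩ : ∃ τ, τ = -(v a + v b) := ⟨_, rfl⟩
    rw [← hτ] at hab
    simp only [← hτ] at hmin
    have first : ∀ a' b', v a' < v b' → t < -(v a' + v b') → -(v a' + v b') ≤ τ →
        a' = a ∧ b' = b := by
      intro a' b' h1 h2 h3
      have := hmin (a', b') ⟨h1, h2⟩
      exact hsum _ _ _ _ h1 hab.1 (by linarith)
    -- A time after this meeting and before the next one, where the evolution is cut.
    obtain ⟨t', ht', ht'T, hnext⟩ : ∃ t', τ < t' ∧ t' < T ∧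
        ∀ a' b', v a' < v b' → τ < -(v a' + v b') → t' < -(v a' + v b') := by
      have h1 : ∀ᶠ s in 𝓝[>] τ, ∀ a' b', v a' < v b' → τ < -(v a' + v b') →
          s < -(v a' + v b') := by
        rw [eventually_all]; intro a'
        rw [eventually_all]; intro b'
        rw [eventually_imp_distrib_left]; intro _
        rw [eventually_imp_distrib_left]; intro h
        exact nhdsWithin_le_nhds (Iio_mem_nhds h)
      have h2 : ∀ᶠ s in 𝓝[>] τ, s < T :=
        nhdsWithin_le_nhds (Iio_mem_nhds (by rw [hτ]; exact hT a b hab.1))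
      obtain ⟨s, hs, hs', hs''⟩ := (h1.and (h2.and self_mem_nhdsWithin)).exists
      exact ⟨s, hs'', hs', hs⟩
    obtain ⟨k, rfl⟩ := π.surjective b
    obtain ⟨l, rfl⟩ := π.surjective a
    have hnekl : k ≠ l := fun e => by subst e; exact lt_irrefl _ hab.1
    have hcross : line (v (π k)) q τ = line (v (π l)) q τ := by
      rw [← sub_eq_zero, line_sub, hτ]; ring
    have hkl : chainIndex k < chainIndex l := by
      by_contra! h
      have h1 := hπ l k (lt_of_le_of_ne h fun e => hnekl (chainIndex_injective e).symm)
      rw [← sub_neg, line_sub] at h1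
      nlinarith [hab.1, hab.2]
    -- before the collision
    have before : ∀ s, t ≤ s → s ≤ τ → ∀ k' l', chainIndex k' < chainIndex l' →
        ¬ (k' = k ∧ l' = l) → line (v (π k')) q s < line (v (π l')) q s := by
      intro s hs hsτ k' l' h1 h2
      refine line_lt_of_no_crossing (hπ k' l' h1) hs fun h3 => ?_
      have hne : π k' ≠ π l' := π.injective.ne fun e => by subst e; omega
      rcases lt_or_gt_of_ne (hv.ne hne) with h4 | h4
      · obtain ⟨e1, e2⟩ := first _ _ h4 h3.1 (h3.2.trans hsτ)
        rw [π.injective e1, π.injective e2] at h1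
        omega
      · obtain ⟨e1, e2⟩ := first _ _ h4 (by linarith [h3.1]) (by linarith [h3.2])
        exact h2 ⟨π.injective e2, π.injective e1⟩
    -- A ball between `k` and `l` would carry a point particle strictly between two that are at the
    -- same place.
    have hadj : chainIndex l = chainIndex k + 1 := by
      obtain ⟨j, hj⟩ := exists_chainIndex hkl
      by_contra hcon
      have h1 : chainIndex j < chainIndex l := by omega
      have h2 := before τ hab.2.le le_rfl k j (by omega) (fun h => by rw [h.2] at h1; omega)
      have h3 := before τ hab.2.le le_rfl j l h1 (fun h => by rw [h.1] at hj; omega)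
      linarith
    set π' := π * Equiv.swap k l with hπ'
    have hπk : π' k = π l := by simp [hπ']
    have hπl : π' l = π k := by simp [hπ']
    have hcross' : ∀ j, line (v (π' j)) q τ = line (v (π j)) q τ := by
      intro j
      by_cases h1 : j = k
      · rw [h1, hπk, hcross]
      by_cases h2 : j = l
      · rw [h2, hπl, hcross]
      · rw [hπ', Equiv.Perm.mul_apply, Equiv.swap_apply_of_ne_of_ne h1 h2]
    have nocross : ∀ x y, ∀ s, s ≤ t' → ¬ (τ < -(v x + v y) ∧ -(v x + v y) ≤ s) ∨ v x = v y := by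
      intro x y s hs
      rcases lt_trichotomy (v x) (v y) with h | h | h
      · exact Or.inl fun h' => by linarith [hnext x y h h'.1]
      · exact Or.inr h
      · exact Or.inl fun h' => by linarith [hnext y x h (by linarith [h'.1])]
    have after : ∀ s, τ ≤ s → s ≤ t' → ∀ k' l', chainIndex k' < chainIndex l' →
        ¬ (k' = k ∧ l' = l) → line (v (π' k')) q s < line (v (π' l')) q s := by
      intro s hs hst k' l' h1 h2
      have h3 : line (v (π' k')) q τ < line (v (π' l')) q τ := by
        rw [hcross', hcross']; exact before τ hab.2.le le_rfl k' l' h1 h2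
      rcases nocross (π' k') (π' l') s hst with h | h
      · exact line_lt_of_no_crossing h3 hs h
      · rw [h] at h3; exact absurd h3 (lt_irrefl _)
    have order' : InOrder v q π' t' := by
      intro k' l' h1
      by_cases h2 : k' = k ∧ l' = l
      · rw [h2.1, h2.2, hπk, hπl, ← sub_neg, line_sub]
        exact mul_neg_of_neg_of_pos (by linarith [hab.1]) (by rw [hτ] at ht'; linarith)
      · exact after t' ht'.le le_rfl k' l' h1 h2
    obtain ⟨π'', h1, h2⟩ := ih π' t' ht'T order' (by
      have : (Finset.univ.filter fun k : (Bool × Fin m) × (Bool × Fin m) =>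
          v k.1 < v k.2 ∧ t' < -(v k.1 + v k.2)) =
          (Finset.univ.filter fun k : (Bool × Fin m) × (Bool × Fin m) =>
          v k.1 < v k.2 ∧ t < -(v k.1 + v k.2)).erase (π l, π k) := by
        ext ⟨x, y⟩
        simp only [Finset.mem_filter, Finset.mem_univ, true_and, Finset.mem_erase, ne_eq,
          Prod.mk.injEq]
        constructor
        · rintro ⟨g1, g2⟩
          refine ⟨?_, g1, by linarith [hab.2]⟩
          rintro ⟨rfl, rfl⟩
          linarith
        · rintro ⟨g1, g2, g3⟩
          refine ⟨g2, hnext x y g2 ?_⟩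
          by_contra! h
          exact g1 (first x y g2 g3 h)
      rw [this, Finset.card_erase_of_mem (Finset.mem_filter.2 ⟨Finset.mem_univ _, hab.1, by rw [← hτ]; exact hab.2⟩), hn]
      rfl)
    refine ⟨π'', h1, ?_⟩
    have hτT : τ < T := ht'.trans ht'T
    have e1 : (gas v q off Y π t).fly (τ - t) = gas v q off Y π τ := by
      rw [gas_fly, add_sub_cancel]
    have e2 : ((gas v q off Y π t).fly (τ - t)).coll (Sum.inl k) (Sum.inl l) =
        gas v q off Y π' τ := by rw [e1, gas_coll hadj hcross]
    have hadj' : (chainIndex l : ℝ) = chainIndex k + 1 := by exact_mod_cast hadj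
    have key := PlaneEvo.single (hd := hd) (S := gas v q off Y π t) (t := τ - t) (T := t' - t)
      (i := Sum.inl k) (j := Sum.inl l) (by linarith [hab.2]) (by linarith)
      (fun e => hnekl (Sum.inl_injective e))
      (by
        rw [e1]
        simp only [PlaneState.sq, gas, Sum.elim_inl, hcross, hadj']; ring)
      (by
        rw [e1]
        simp only [PlaneState.slope, gas, Sum.elim_inl, hcross, hadj']
        linarith [hab.1])
      (fun s hs x y hxy g1 g2 => by
        rw [gas_fly]
        refine gas_sq (fun j => by linarith [hY j, hs.2]) hYY hxy fun k' l' g3 g4 =>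
          before _ (by linarith [hs.1]) (by linarith [hs.2]) k' l' g4 ?_
        rintro ⟨rfl, rfl⟩
        rcases g3 with g3 | g3
        · exact g1 g3
        · exact g2 ⟨g3.2, g3.1⟩)
      (fun s hs x y hxy g1 g2 => by
        rw [e2, gas_fly]
        refine gas_sq (fun j => by linarith [hY j, hs.2]) hYY hxy fun k' l' g3 g4 =>
          after _ (by linarith [hs.1]) (by linarith [hs.2]) k' l' g4 ?_
        rintro ⟨rfl, rfl⟩
        rcases g3 with g3 | g3
        · exact g1 g3
        · exact g2 ⟨g3.2, g3.1⟩)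
    rw [e2, gas_fly, show τ + (t' - t - (τ - t)) = t' by ring] at key
    have := key.trans h2
    rwa [show t' - t + (T - t') = T - t by ring, add_comm 1 n] at this

/-- When all point particles have met, they are in the order of their velocities. -/
theorem InOrder.eq_one (h : InOrder v q π T) (hT : ∀ a b, v a < v b → -(v a + v b) < T)
    (hv : ∀ k l, chainIndex k < chainIndex l → v k < v l) : π = 1 := by
  have mono : ∀ k l, chainIndex k < chainIndex l → chainIndex (π k) < chainIndex (π l) := by
    intro k l hkl
    by_contra! hcon
    have hne : π l ≠ π k := π.injective.ne fun e => by subst e; omega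
    have h1 := hv _ _ (lt_of_le_of_ne hcon fun e => hne (chainIndex_injective e))
    have h2 := h k l hkl
    have h3 := hT _ _ h1
    rw [← sub_neg, line_sub] at h2
    nlinarith
  have mono' : ∀ k l, chainIndex (π k) < chainIndex (π l) ↔ chainIndex k < chainIndex l := by
    intro k l
    refine ⟨fun h1 => ?_, mono k l⟩
    by_contra! hcon
    rcases hcon.lt_or_eq with h2 | h2
    · have := mono l k h2; omega
    · rw [chainIndex_injective h2] at h1; omega
  -- A strictly monotone permutation preserves the number of smaller elements, and this number
  -- determines the element.
  have rank : ∀ k : Bool × Fin m,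
      (Finset.univ.filter fun l : Bool × Fin m => chainIndex l < chainIndex (π k)).card =
      (Finset.univ.filter fun l : Bool × Fin m => chainIndex l < chainIndex k).card := by
    intro k
    symm
    refine Finset.card_bij (fun l _ => π l) ?_ (fun _ _ _ _ e => π.injective e) ?_
    · intro l hl
      simpa [mono'] using hl
    · intro l hl
      refine ⟨π.symm l, ?_, by simp⟩
      simp only [Finset.mem_filter, Finset.mem_univ, true_and] at hl ⊢
      rw [← mono']; simpa using hl
  have rank_lt : ∀ k l : Bool × Fin m, chainIndex k < chainIndex l →
      (Finset.univ.filter fun j : Bool × Fin m => chainIndex j < chainIndex k).card <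
      (Finset.univ.filter fun j : Bool × Fin m => chainIndex j < chainIndex l).card := by
    intro k l hkl
    refine Finset.card_lt_card (Finset.ssubset_iff_of_subset ?_ |>.2 ⟨k, by simpa using hkl, by simp⟩)
    intro j hj
    simp only [Finset.mem_filter, Finset.mem_univ, true_and] at hj ⊢
    omega
  ext1 k
  rw [Equiv.Perm.one_apply]
  apply chainIndex_injective
  by_contra hne
  rcases lt_or_gt_of_ne hne with h1 | h1
  · exact (rank_lt _ _ h1).ne (rank k)
  · exact (rank_lt _ _ h1).ne' (rank k)

theorem card_pairs (hv : Function.Injective v) :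
    (Finset.univ.filter fun k : (Bool × Fin m) × (Bool × Fin m) => v k.1 < v k.2).card =
      m * (2 * m - 1) := by
  set A := Finset.univ.filter fun k : (Bool × Fin m) × (Bool × Fin m) => v k.1 < v k.2 with hA
  have h1 : (Finset.univ.filter fun k : (Bool × Fin m) × (Bool × Fin m) => v k.2 < v k.1).card =
      A.card := by
    refine Finset.card_bij (fun k _ => k.swap) ?_ (fun _ _ _ _ e => Prod.swap_injective e) ?_
    · intro k hk; simpa [hA] using hk
    · intro k hk; exact ⟨k.swap, by simpa [hA] using hk, by simp⟩
  have h2 : (Finset.univ.filter fun k : (Bool × Fin m) × (Bool × Fin m) => v k.1 = v k.2).card =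
      2 * m := by
    have : (Finset.univ.filter fun k : (Bool × Fin m) × (Bool × Fin m) => v k.1 = v k.2) =
        Finset.univ.image fun j : Bool × Fin m => (j, j) := by
      ext ⟨x, y⟩
      simp only [Finset.mem_filter, Finset.mem_univ, true_and, Finset.mem_image, hv.eq_iff,
        Prod.mk.injEq]
      exact ⟨fun h => ⟨x, rfl, h⟩, fun ⟨_, h1, h2⟩ => h1.symm.trans h2⟩
    rw [this, Finset.card_image_of_injective _ fun _ _ e => (Prod.mk.inj e).1]
    simp [Fintype.card_prod]
  have h3 : A.card + (A.card + 2 * m) = (2 * m) * (2 * m) := by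
    have e1 := Finset.card_filter_add_card_filter_not (s := Finset.univ)
      (fun k : (Bool × Fin m) × (Bool × Fin m) => v k.1 < v k.2)
    have e2 : (Finset.univ.filter fun k : (Bool × Fin m) × (Bool × Fin m) => ¬ v k.1 < v k.2) =
        (Finset.univ.filter fun k : (Bool × Fin m) × (Bool × Fin m) => v k.2 < v k.1) ∪
        (Finset.univ.filter fun k : (Bool × Fin m) × (Bool × Fin m) => v k.1 = v k.2) := by
      ext k
      simp only [Finset.mem_filter, Finset.mem_univ, true_and, Finset.mem_union, not_lt,
        le_iff_lt_or_eq, eq_comm]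
    rw [e2, Finset.card_union_of_disjoint] at e1
    · rw [h1, h2, ← hA] at e1
      rw [e1]; simp [Fintype.card_prod]
    · rw [Finset.disjoint_filter]
      intro k _ g1 g2
      rw [g2] at g1; exact lt_irrefl _ g1
  rcases Nat.eq_zero_or_pos m with hm | hm
  · subst hm; simpa using h3
  · obtain ⟨j, rfl⟩ : ∃ j, m = j + 1 := ⟨m - 1, by omega⟩
    rw [show 2 * (j + 1) - 1 = 2 * j + 1 by omega]
    nlinarith

end gas

end Ball

/-! ### Choice of the speeds, and the start of the first passage. -/

theorem pair_eq_of_two_pow_add {p q r s : ℕ} (hpq : p ≠ q) (hrs : r ≠ s)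
    (h : 2 ^ p + 2 ^ q = 2 ^ r + 2 ^ s) : p = r ∧ q = s ∨ p = s ∧ q = r := by
  have h1 : ({p, q} : Finset ℕ) = {r, s} := Finset.geomSum_injective (n := 2) le_rfl (by
    simpa [Finset.sum_pair hpq, Finset.sum_pair hrs] using h)
  have hp : p ∈ ({r, s} : Finset ℕ) := h1 ▸ by simp
  have hq : q ∈ ({r, s} : Finset ℕ) := h1 ▸ by simp
  simp only [Finset.mem_insert, Finset.mem_singleton] at hp hq
  omega

namespace Ball

open PlaneState

variable {m c : ℕ}

/-- The exponent in the relative correction of the speed of a ball. -/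
def expo (m : ℕ) (b : Bool) (i : ℕ) : ℕ := (if b then 0 else m) + i + 3

/-- The relative corrections of the speeds of the balls. -/
noncomputable def weight (m : ℕ) (b : Bool) (i : ℕ) : ℝ := 2 ^ expo m b i

theorem expo_injective {b b' : Bool} {i i' : Fin m} (h : expo m b i = expo m b' i') :
    (b, i) = (b', i') := by
  obtain ⟨i, hi⟩ := i
  obtain ⟨i', hi'⟩ := i'
  cases b <;> cases b' <;> simp [expo] at h ⊢ <;> omega

/-- The shift by 3 in `expo` serves this bound, by which the chains are already open three time
units before `1 / u`. -/
theorem eight_le_weight (b : Bool) (i : ℕ) : 8 ≤ weight m b i := by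
  have : (2 : ℝ) ^ 3 ≤ 2 ^ expo m b i := pow_le_pow_right₀ (by norm_num) (by unfold expo; omega)
  unfold weight; linarith

theorem weight_le (b : Bool) (i : Fin m) : weight m b i ≤ 2 ^ (2 * m + 3) := by
  refine pow_le_pow_right₀ (by norm_num) ?_
  have := i.2
  unfold expo; split_ifs <;> omega

theorem weight_lt (b : Bool) {i j : ℕ} (h : i < j) : weight m b i < weight m b j :=
  pow_lt_pow_right₀ (by norm_num) (by unfold expo; omega)

theorem weight_pair {b b' e e' : Bool} {i i' j j' : Fin m} (h₁ : (b, i) ≠ (b', i'))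
    (h₂ : (e, j) ≠ (e', j'))
    (h : weight m b i + weight m b' i' = weight m e j + weight m e' j') :
    (b, i) = (e, j) ∧ (b', i') = (e', j') ∨ (b, i) = (e', j') ∧ (b', i') = (e, j) := by
  have h' : 2 ^ expo m b i + 2 ^ expo m b' i' = 2 ^ expo m e j + 2 ^ expo m e' j' := by
    unfold weight at h; exact_mod_cast h
  rcases pair_eq_of_two_pow_add (fun e => h₁ (expo_injective e)) (fun e => h₂ (expo_injective e)) h'
    with h | h
  · exact Or.inl ⟨expo_injective h.1, expo_injective h.2⟩
  · exact Or.inr ⟨expo_injective h.1, expo_injective h.2⟩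

/-- The velocities of the balls of the chains: the chains expand. -/
noncomputable def speed (u : ℝ) (k : Bool × Fin m) : ℝ :=
  sideSign k.1 * (u + u ^ 2 * weight m k.1 k.2)

section speed

variable {u : ℝ}

theorem weight_mul_le (hu : 0 < u) (huM : u * 2 ^ (2 * m + 3) ≤ 1 / 100)
    (b : Bool) (i : Fin m) : u * weight m b i ≤ 1 / 100 :=
  (mul_le_mul_of_nonneg_left (weight_le b i) hu.le).trans huM

theorem mul_le_one_of_mul_pow (hu : 0 < u) (huM : u * 2 ^ (2 * m + 3) ≤ 1 / 100) :
    800 * u ≤ 1 := by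
  have : (2 : ℝ) ^ 3 ≤ 2 ^ (2 * m + 3) := pow_le_pow_right₀ (by norm_num) (by omega)
  nlinarith

theorem speed_bounds (hu : 0 < u) (huM : u * 2 ^ (2 * m + 3) ≤ 1 / 100)
    (k : Bool × Fin m) : |speed u k| ≤ 2 * u := by
  have h1 := weight_mul_le hu huM k.1 k.2
  have h2 := eight_le_weight (m := m) k.1 k.2
  have : |speed u k| = u + u ^ 2 * weight m k.1 k.2 := by
    rw [speed, abs_mul, abs_of_nonneg (by positivity : 0 ≤ u + u ^ 2 * weight m k.1 k.2)]
    cases k.1 <;> simp [sideSign]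
  rw [this]; nlinarith

theorem speed_lt (hu : 0 < u) (k l : Bool × Fin m) (h : chainIndex k < chainIndex l) :
    speed u k < speed u l := by
  obtain ⟨b, i⟩ := k
  obtain ⟨b', i'⟩ := l
  have h1 := eight_le_weight (m := m) b i
  have h2 := eight_le_weight (m := m) b' i'
  cases b <;> cases b' <;>
    simp only [chainIndex, if_true, Bool.false_eq_true, if_false, speed, sideSign] at h ⊢
  · have := weight_lt (m := m) false (i := i') (j := i) (by omega)
    nlinarith [sq_pos_of_pos hu]
  · nlinarith [sq_pos_of_pos hu]
  · omega
  · have := weight_lt (m := m) true (i := i) (j := i') (by omega)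
    nlinarith [sq_pos_of_pos hu]

theorem speed_injective (hu : 0 < u) :
    Function.Injective (speed (m := m) u) := by
  intro k l h
  by_contra hne
  rcases lt_or_gt_of_ne (chainIndex_injective.ne hne) with h1 | h1
  · exact (speed_lt hu _ _ h1).ne h
  · exact (speed_lt hu _ _ h1).ne' h

/-- The meeting times of different pairs are different. The signs are found from the terms of order
`u`, since the corrections are at most `u / 100`; then the powers of two in the corrections identify
the pair. -/
theorem speed_pair (hu : 0 < u) (huM : u * 2 ^ (2 * m + 3) ≤ 1 / 100)
    (k l k' l' : Bool × Fin m) (h : speed u k < speed u l)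
    (h' : speed u k' < speed u l') (hs : speed u k + speed u l = speed u k' + speed u l') :
    k = k' ∧ l = l' := by
  have order : ∀ k l : Bool × Fin m, speed u k < speed u l → k ≠ l ∧ ¬ (k.1 = true ∧ l.1 = false) := by
    intro k l h
    refine ⟨fun e => by subst e; exact lt_irrefl _ h, fun e => ?_⟩
    refine absurd (speed_lt hu l k ?_) (not_lt.2 h.le)
    simp only [chainIndex, e.1, e.2, if_true, Bool.false_eq_true, if_false]
    omega
  have swap : (k = k' ∧ l = l') ∨ (k = l' ∧ l = k') → k = k' ∧ l = l' := by
    rintro (e | ⟨rfl, rfl⟩)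
    · exact e
    · exact absurd h' (not_lt.2 h.le)
  obtain ⟨n1, o1⟩ := order k l h
  obtain ⟨n2, o2⟩ := order k' l' h'
  apply swap
  obtain ⟨b1, i1⟩ := k
  obtain ⟨b2, i2⟩ := l
  obtain ⟨b3, i3⟩ := k'
  obtain ⟨b4, i4⟩ := l'
  have g1 := weight_mul_le hu huM b1 i1
  have g2 := weight_mul_le hu huM b2 i2
  have g3 := weight_mul_le hu huM b3 i3
  have g4 := weight_mul_le hu huM b4 i4
  have e1 := eight_le_weight (m := m) b1 i1
  have e2 := eight_le_weight (m := m) b2 i2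
  have e3 := eight_le_weight (m := m) b3 i3
  have e4 := eight_le_weight (m := m) b4 i4
  have p1 := mul_pos hu (by linarith : 0 < weight m b1 i1)
  have p2 := mul_pos hu (by linarith : 0 < weight m b2 i2)
  have p3 := mul_pos hu (by linarith : 0 < weight m b3 i3)
  have p4 := mul_pos hu (by linarith : 0 < weight m b4 i4)
  have hs' : sideSign b1 * (1 + u * weight m b1 i1) + sideSign b2 * (1 + u * weight m b2 i2) =
      sideSign b3 * (1 + u * weight m b3 i3) + sideSign b4 * (1 + u * weight m b4 i4) := by
    simp only [speed] at hs
    apply mul_left_cancel₀ hu.ne'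
    linear_combination hs
  have cancel : ∀ {A B : ℝ}, u * A = u * B → A = B := fun h => mul_left_cancel₀ hu.ne' h
  cases b1 <;> cases b2 <;> cases b3 <;> cases b4 <;>
    simp only [sideSign, if_true, Bool.false_eq_true, if_false, not_true_eq_false, and_self,
      one_mul, neg_mul] at hs' o1 o2
  · exact weight_pair n1 n2 (cancel (by linarith))
  · linarith
  · linarith
  · linarith
  -- For two pairs across the axis the equation has weights of both signs; moving the negative ones
  -- gives an equality of sums of two different powers of two.
  · have := weight_pair (m := m) (b := false) (b' := true) (i := i1) (i' := i4)
      (e := false) (e' := true) (j := i3) (j' := i2) (by simp) (by simp) (cancel (by linarith))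
    rcases this with h | h
    · exact Or.inl ⟨h.1, h.2.symm⟩
    · simp at h
  · linarith
  · linarith
  · linarith
  · exact weight_pair n1 n2 (cancel (by linarith))

theorem speed_meet (hu : 0 < u) (huM : u * 2 ^ (2 * m + 3) ≤ 1 / 100)
    (k l : Bool × Fin m) : |speed u k + speed u l| ≤ 4 * u :=
  (abs_add_le _ _).trans (by linarith [speed_bounds hu huM k, speed_bounds hu huM l])

/-- The chains have made room for a ball shortly before the time `1 / u`. -/
theorem two_le_gas (hu : 0 < u) (huM : u * 2 ^ (2 * m + 3) ≤ 1 / 100)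
    {q : ℝ} (hq : q = -u ^ 2) {off Y : Fin c → ℝ} {t : ℝ} (ht : 1 / u - 3 ≤ t)
    (b : Bool) (i : Fin m) :
    2 ≤ sideSign b * (gas (speed u) q off Y 1 t).x (Sum.inl (b, i)) := by
  have h1 := weight_mul_le hu huM b i
  have h2 := eight_le_weight (m := m) b i
  have h3 := mul_le_one_of_mul_pow hu huM
  have hi : (0 : ℝ) ≤ ((i : ℕ) : ℝ) := Nat.cast_nonneg _
  obtain ⟨w, hw⟩ : ∃ w, w = u * weight m b i := ⟨_, rfl⟩
  have hw8 : 8 * u ≤ w := by rw [hw]; nlinarith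
  have hut : 1 - 3 * u ≤ u * t := by
    have := mul_le_mul_of_nonneg_left ht hu.le
    rwa [mul_sub, mul_one_div_cancel hu.ne', mul_comm u 3] at this
  have hwu : u + u ^ 2 * weight m b i = u * (1 + w) := by rw [hw]; ring
  rw [← hw] at h1
  -- The main term `(1 + w) * (u * t)` exceeds 1 because `w ≥ 8 * u`. The value `q = -u ^ 2` cancels
  -- the main part of `v ^ 2` and leaves only `u ^ 2 * (2 * w + w ^ 2)`.
  have a1 : (1 + w) * (1 - 3 * u) ≤ (1 + w) * (u * t) :=
    mul_le_mul_of_nonneg_left hut (by linarith)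
  have a2 : 0 ≤ w * (1 / 800 - u) := mul_nonneg (by linarith) (by linarith)
  have a3 : u ^ 2 * (2 * w + w ^ 2) ≤ w / 100 := by
    have : u ^ 2 ≤ 1 / 800 := by nlinarith
    have : 2 * w + w ^ 2 ≤ 3 * w := by nlinarith
    nlinarith
  have a4 : 0 ≤ u ^ 2 * (2 * w + w ^ 2) := by
    have : 0 ≤ w := by linarith
    positivity
  cases b <;> simp only [gas, line, speed, Sum.elim_inl, Equiv.Perm.one_apply, chainIndex, if_true,
      Bool.false_eq_true, if_false, sideSign, hwu, hq, Int.cast_sub, Int.cast_neg, Int.cast_natCast,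
      Int.cast_one] <;> nlinarith

end speed

/-- The exchange of the two chains. -/
def reversal (m : ℕ) : Equiv.Perm (Bool × Fin m) := Equiv.prodCongr Equiv.boolNot (Equiv.refl _)

theorem chainIndex_reversal (k : Bool × Fin m) : chainIndex (reversal m k) = -1 - chainIndex k := by
  obtain ⟨b, i⟩ := k
  cases b <;> simp [chainIndex, reversal] <;> ring

/-- A state in which the chains have exchanged all of their velocities. -/
theorem exists_evolution_gas {d : ℕ} (hd : 2 ≤ d) {u : ℝ} (hu : 0 < u)
    (huM : u * 2 ^ (2 * m + 3) ≤ 1 / 100) {q : ℝ} (hq : q = -u ^ 2) {off Y : Fin c → ℝ} {h : ℝ}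
    (hh : 0 < h) (hY : ∀ k, Y k = 10 * (k : ℕ) + h + 1 / u) (hoff2 : ∀ k, |off k| ≤ 2)
    (hoff : ∀ k : Fin c, (k : ℕ) = 0 → 4 * |off k| ≤ h ^ 2 / 2) :
    ∃ S T, PlaneEvo hd S T (m * (2 * m - 1)) (gas (m := m) (speed u) q off Y 1 (1 / u)) := by
  have hsm := mul_le_one_of_mul_pow hu huM
  have hinv : 800 ≤ 1 / u := by rw [le_div_iff₀ hu]; linarith
  have hYY : ∀ k l, k ≠ l → 4 < (Y k - Y l) ^ 2 := by
    intro k l hkl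
    rw [hY, hY, show 10 * ((k : ℕ) : ℝ) + h + 1 / u - (10 * ((l : ℕ) : ℝ) + h + 1 / u) =
      10 * (((k : ℕ) : ℝ) - (l : ℕ)) by ring]
    have : (k : ℕ) ≠ l := fun e => hkl (Fin.ext e)
    rcases lt_or_gt_of_ne this with h1 | h1
    · have : ((k : ℕ) : ℝ) + 1 ≤ (l : ℕ) := by exact_mod_cast h1
      nlinarith
    · have : ((l : ℕ) : ℝ) + 1 ≤ (k : ℕ) := by exact_mod_cast h1
      nlinarith
  have hT : ∀ a b : Bool × Fin m, -(speed u a + speed u b) < 1 / u - 3 := fun a b => by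
    linarith [neg_abs_le (speed u a + speed u b), speed_meet hu huM a b]
  have hstart : ∀ a b : Bool × Fin m, -1 < -(speed u a + speed u b) := fun a b => by
    linarith [le_abs_self (speed u a + speed u b), speed_meet hu huM a b]
  -- At time `-1` the velocities are in reversed order and no pair has met, as all meeting times are
  -- at most `4 * u` in absolute value; so every pair still has to meet.
  have order : InOrder (speed u) q (reversal m) (-1) := by
    intro k l hkl
    have := speed_lt hu (reversal m l) (reversal m k) (by
      rw [chainIndex_reversal, chainIndex_reversal]; omega)
    rw [← sub_neg, line_sub]
    exact mul_neg_of_pos_of_neg (by linarith)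
      (by linarith [hstart (reversal m k) (reversal m l)])
  have card := card_pairs (speed_injective (m := m) hu)
  obtain ⟨π, hπ, ev⟩ := exists_gas_evolution (off := off) (Y := Y) hd (speed_injective hu)
    (speed_pair hu huM) (fun a b _ => hT a b)
    (fun k => by rw [hY]; linarith [Nat.cast_nonneg (α := ℝ) (k : ℕ)]) hYY (m * (2 * m - 1))
    (reversal m) (-1) (by linarith) order (by
      rw [← card]
      congr 1
      exact Finset.filter_congr fun k _ => and_iff_left (hstart _ _))
  have hπ1 := hπ.eq_one (fun a b _ => hT a b) (speed_lt hu)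
  subst hπ1
  -- In the last three time units the lowest falling ball descends from height `h + 3` to `h`,
  -- between chains that have made room for it.
  have fly := PlaneEvo.free (hd := hd) (S := gas (m := m) (speed u) q off Y 1 (1 / u - 3)) (T := 3)
    (by norm_num) (fun s hs a b hab => by
      rw [gas_fly]
      have hYs : ∀ k : Fin c, 10 * ((k : ℕ) : ℝ) + h ≤ Y k - (1 / u - 3 + s) := fun k => by
        rw [hY]; linarith [hs.2]
      have chain : ∀ (b : Bool) (i : Fin m) (k : Fin c), 4 <
          (gas (m := m) (speed u) q off Y 1 (1 / u - 3 + s)).sq (Sum.inl (b, i)) (Sum.inr k) := by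
        intro b i k
        have hx := two_le_gas (c := c) hu huM hq (off := off) (Y := Y) (t := 1 / u - 3 + s)
          (by linarith [hs.1]) b i
        rcases Nat.eq_zero_or_pos (k : ℕ) with hk | hk
        · have hyk := hYs k
          rw [hk, Nat.cast_zero, mul_zero, zero_add] at hyk
          have key := four_lt_of_offset (D := sideSign b *
              ((gas (m := m) (speed u) q off Y 1 (1 / u - 3 + s)).x (Sum.inl (b, i)) - off k))
            (B := 2 - |off k|) (lam := 0) (y := Y k - (1 / u - 3 + s)) (h := h)
            (by
              have : sideSign b * off k ≤ |off k| := by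
                cases b <;> simp only [sideSign, if_true, Bool.false_eq_true, if_false]
                · linarith [neg_abs_le (off k)]
                · linarith [le_abs_self (off k)]
              rw [mul_sub]; linarith)
            (by linarith [hoff2 k]) (by ring) (hoff k hk) le_rfl (by linarith) hh (by linarith)
          rw [mul_pow, sq (sideSign b), sideSign_mul_self, one_mul] at key
          refine key.trans_eq ?_
          simp only [PlaneState.sq, gas, Sum.elim_inl, Sum.elim_inr]
          ring
        · have hyk := hYs k
          have : (1 : ℝ) ≤ (k : ℕ) := by exact_mod_cast hk
          simp only [PlaneState.sq, gas, Sum.elim_inl, Sum.elim_inr]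
          nlinarith [sq_nonneg (2 * (chainIndex (b, i) : ℝ) + 1 +
            line (speed u ((1 : Equiv.Perm (Bool × Fin m)) (b, i))) q (1 / u - 3 + s) - off k)]
      rcases a with ⟨b1, i⟩ | k <;> rcases b with ⟨b2, j⟩ | l
      · have hkl : chainIndex (b1, i) ≠ chainIndex (b2, j) :=
          fun e => hab (congrArg _ (chainIndex_injective e))
        have ord : ∀ k l : Bool × Fin m, chainIndex k < chainIndex l →
            line (speed u ((1 : Equiv.Perm (Bool × Fin m)) k)) q (1 / u - 3 + s) <
            line (speed u ((1 : Equiv.Perm (Bool × Fin m)) l)) q (1 / u - 3 + s) := by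
          intro k l hkl
          rw [← sub_neg, line_sub]
          have := speed_lt hu k l hkl
          exact mul_neg_of_neg_of_pos (by simpa using this)
            (by simp only [Equiv.Perm.one_apply]; linarith [hT k l, hs.1])
        rcases lt_or_gt_of_ne hkl with h1 | h1
        · exact gas_sq_chain h1 (ord _ _ h1)
        · rw [sq_comm]; exact gas_sq_chain h1 (ord _ _ h1)
      · exact chain _ _ _
      · rw [sq_comm]; exact chain _ _ _
      · have := hYY k l fun e => hab (congrArg _ e)
        simp only [PlaneState.sq, gas, Sum.elim_inr]
        nlinarith [sq_nonneg (off k - off l)])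
  rw [gas_fly, sub_add_cancel] at fly
  exact ⟨_, _, ev.trans fly⟩

/-- At time `1 / u` a chain ball is displaced outwards by `u * weight` up to order `u ^ 3`, and its
speed is of order `u`. So the chains have displacements of order `ν ^ 2` and negligible velocities
on the scale `ν = √u`. -/
theorem stage_gas {off : Fin c → ℝ → ℝ} {h : ℝ → ℝ} {q : ℝ → ℝ} (hq : ∀ u, q u = -u ^ 2) :
    Stage (m := m) (𝓝[>] (0 : ℝ)) 0 Real.sqrt (weight m) off h fun u =>
      gas (speed u) (q u) (fun k => off k u) (fun k => 10 * (k : ℕ) + h u + 1 / u) 1 (1 / u) where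
  chain_x b i := by
    have lim : Tendsto (fun u : ℝ => weight m b i +
        sideSign b * (2 * u ^ 2 * weight m b i + u ^ 3 * weight m b i ^ 2)) (𝓝[>] 0)
        (𝓝 (weight m b i)) := by
      have : Continuous fun u : ℝ => weight m b i +
        sideSign b * (2 * u ^ 2 * weight m b i + u ^ 3 * weight m b i ^ 2) := by fun_prop
      have := this.tendsto 0
      simp only [ne_eq, OfNat.ofNat_ne_zero, not_false_eq_true, zero_pow, mul_zero, zero_mul,
        add_zero] at this
      exact this.mono_left nhdsWithin_le_nhds
    refine lim.congr' ?_
    filter_upwards [self_mem_nhdsWithin] with u hu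
    have hu : 0 < u := hu
    rw [Real.sq_sqrt hu.le]
    cases b <;> simp only [gas, line, speed, Sum.elim_inl, Equiv.Perm.one_apply, chainIndex,
      if_true, Bool.false_eq_true, if_false, sideSign, hq, Int.cast_sub, Int.cast_neg,
      Int.cast_natCast, Int.cast_one] <;> field_simp <;> ring
  chain_y k := by simp [gas]
  chain_u k := by
    have lim : Tendsto (fun u : ℝ => sideSign k.1 * (√u * (1 + u * weight m k.1 k.2))) (𝓝[>] 0)
        (𝓝 0) := by
      have : Continuous fun u : ℝ => sideSign k.1 * (√u * (1 + u * weight m k.1 k.2)) := by fun_prop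
      have := this.tendsto 0
      simp only [Real.sqrt_zero, zero_mul, mul_zero] at this
      exact this.mono_left nhdsWithin_le_nhds
    refine lim.congr' ?_
    filter_upwards [self_mem_nhdsWithin] with u hu
    have hu : 0 < u := hu
    have hs : 0 < √u := Real.sqrt_pos.2 hu
    rw [eq_div_iff hs.ne']
    simp only [gas, speed, Sum.elim_inl, Equiv.Perm.one_apply]
    have := Real.mul_self_sqrt hu.le
    linear_combination (sideSign k.1 * (1 + u * weight m k.1 k.2)) * this
  chain_w k := by simp [gas]
  next k _ := Eventually.of_forall fun u => by simp [gas]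
  past k hk := absurd hk (Nat.not_lt_zero _)

/-- Two chains of `m` balls and `c` falling balls can collide this many times. -/
theorem le_maxCollisions {d : ℕ} (hd : 2 ≤ d) (hm : 0 < m) :
    ((m * (2 * m - 1) + c * (m * (m + 1)) : ℕ) : ℕ∞) ≤ maxCollisions (2 * m + c) d := by
  obtain ⟨off, h, hoff0, -, hh, -, hoff, key⟩ := Ball.exists_stages (c := c)
    (F := 𝓝[>] (0 : ℝ)) hd hm c 0 (weight m) Real.sqrt (by omega)
    (fun b => by linarith [eight_le_weight (m := m) b 0])
    (fun b i _ => weight_lt b (Nat.lt_succ_self i))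
    (by simpa using (Real.continuous_sqrt.tendsto 0).mono_left nhdsWithin_le_nhds)
    (by filter_upwards [self_mem_nhdsWithin] with u hu using Real.sqrt_pos.2 hu)
  have small_u : ∀ᶠ u : ℝ in 𝓝[>] 0, u * 2 ^ (2 * m + 3) ≤ 1 / 100 := by
    have : Continuous fun u : ℝ => u * 2 ^ (2 * m + 3) := by fun_prop
    have := this.tendsto 0
    rw [zero_mul] at this
    exact nhdsWithin_le_nhds (this.eventually (Iic_mem_nhds (by norm_num)))
  have small_off : ∀ᶠ u in 𝓝[>] (0 : ℝ), ∀ k, |off k u| ≤ 2 := eventually_all.2 fun k => by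
    have := (hoff0 k).abs
    rw [abs_zero] at this
    exact this.eventually (Iic_mem_nhds (by norm_num))
  have small_tip : ∀ᶠ u in 𝓝[>] (0 : ℝ), ∀ k : Fin c, (k : ℕ) = 0 → 4 * |off k u| ≤ h u ^ 2 / 2 :=
    eventually_all.2 fun k => eventually_imp_distrib_left.2 (hoff k)
  -- All requirements hold for small positive `u`; one such speed is fixed.
  obtain ⟨u, h1, h2, h3, h4, h5, hu⟩ := ((key _ (stage_gas fun _ => rfl)).and (small_u.and
    (small_off.and (small_tip.and (hh.and self_mem_nhdsWithin))))).exists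
  obtain ⟨S₀, T₀, ev⟩ := exists_evolution_gas (m := m) hd hu h2 rfl h5 (fun _ => rfl) h3 h4
  obtain ⟨T, S₁, ev'⟩ := h1 S₀ T₀ _ ev
  exact ev'.le_maxCollisions (Fintype.equivFinOfCardEq (by
    simp [Fintype.card_prod])).symm

end Ball

/-! ### Arithmetic of the bound. -/

theorem collisionBound_eq (k : ℕ) :
    collisionBound (3 * k) = k * (k + 1) * k + k * (k - 1) / 2 + k * (k - 1) ∧
    collisionBound (3 * k + 1) = k * (k + 1) * (k + 1) + (k + 1) * k / 2 + k * (k - 1) ∧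
    collisionBound (3 * k + 2) = k * (k + 1) * (k + 2) + (k + 2) * (k + 1) / 2 + k * (k - 1) := by
  have h0 : 3 * k / 3 = k := by omega
  have h1 : (3 * k + 1) / 3 = k := by omega
  have h2 : (3 * k + 2) / 3 = k := by omega
  have e0 : 3 * k - 2 * k = k := by omega
  have e1 : 3 * k + 1 - 2 * k = k + 1 := by omega
  have e2 : 3 * k + 2 - 2 * k = k + 2 := by omega
  have f1 : k + 1 - 1 = k := by omega
  have f2 : k + 2 - 1 = k + 1 := by omega
  simp only [collisionBound, h0, h1, h2, e0, e1, e2, f1, f2, and_self]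

/-- The value of the bound, without natural-number subtractions. -/
theorem collisionBound_cast (k : ℕ) :
    (collisionBound (3 * k) : ℝ) = k ^ 3 + 5 / 2 * k ^ 2 - 3 / 2 * k ∧
    (collisionBound (3 * k + 1) : ℝ) = k ^ 3 + 7 / 2 * k ^ 2 + k / 2 ∧
    (collisionBound (3 * k + 2) : ℝ) = k ^ 3 + 9 / 2 * k ^ 2 + 5 / 2 * k + 1 := by
  have sub : ∀ j : ℕ, ((j * (j - 1) : ℕ) : ℝ) = (j : ℝ) * (j - 1) := by
    rintro (_ | j)
    · simp
    · push_cast [Nat.add_sub_cancel]; ring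
  have half : ∀ j : ℕ, ((j * (j - 1) / 2 : ℕ) : ℝ) = (j : ℝ) * (j - 1) / 2 := by
    intro j
    rw [Nat.cast_div (Nat.even_mul_pred_self j).two_dvd (by norm_num), sub]
    norm_num
  obtain ⟨h0, h1, h2⟩ := collisionBound_eq k
  have g1 := half (k + 1)
  have g2 := half (k + 2)
  rw [show k + 1 - 1 = k by omega] at g1
  rw [show k + 2 - 1 = k + 1 by omega] at g2
  rw [h0, h1, h2]
  refine ⟨?_, ?_, ?_⟩
  · rw [Nat.cast_add, Nat.cast_add, sub, half]; push_cast; ring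
  · rw [Nat.cast_add, Nat.cast_add, sub, g1]; push_cast; ring
  · rw [Nat.cast_add, Nat.cast_add, sub, g2]; push_cast; ring

theorem exists_mod_three (n : ℕ) : ∃ k, n = 3 * k ∨ n = 3 * k + 1 ∨ n = 3 * k + 2 :=
  ⟨n / 3, by omega⟩

theorem lt_collisionBound {n : ℕ} (hn : 3 ≤ n) : (n : ℝ) ^ 3 / 27 < collisionBound n := by
  obtain ⟨k, hk⟩ := exists_mod_three n
  obtain ⟨h0, h1, h2⟩ := collisionBound_cast k
  have hk1 : (1 : ℝ) ≤ k := by exact_mod_cast (by omega : 1 ≤ k)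
  rcases hk with rfl | rfl | rfl
  · rw [h0]; push_cast; nlinarith
  · rw [h1]; push_cast; nlinarith
  · rw [h2]; push_cast; nlinarith

theorem collisionBound_le (n : ℕ) : (collisionBound n : ℝ) ≤ n ^ 3 / 27 + n ^ 2 + n + 1 := by
  obtain ⟨k, hk⟩ := exists_mod_three n
  obtain ⟨h0, h1, h2⟩ := collisionBound_cast k
  have hk0 : (0 : ℝ) ≤ k := Nat.cast_nonneg k
  rcases hk with rfl | rfl | rfl
  · rw [h0]; push_cast; nlinarith
  · rw [h1]; push_cast; nlinarith
  · rw [h2]; push_cast; nlinarith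

theorem tendsto_collisionBound :
    Tendsto (fun n : ℕ => (collisionBound n : ℝ) / ((n : ℝ) ^ 3 / 27)) atTop (𝓝 1) := by
  have inv : Tendsto (fun n : ℕ => ((n : ℝ))⁻¹) atTop (𝓝 0) := tendsto_inv_atTop_nhds_zero_nat
  have upper : Tendsto (fun n : ℕ => 1 + 27 * ((n : ℝ)⁻¹ + (n : ℝ)⁻¹ ^ 2 + (n : ℝ)⁻¹ ^ 3)) atTop
      (𝓝 1) := by
    simpa using (((inv.add (inv.pow 2)).add (inv.pow 3)).const_mul 27).const_add 1
  refine tendsto_of_tendsto_of_tendsto_of_le_of_le' tendsto_const_nhds upper ?_ ?_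
  · filter_upwards [eventually_ge_atTop 3] with n hn
    have : (0 : ℝ) < n := by exact_mod_cast (by omega : 0 < n)
    rw [one_le_div (by positivity)]
    exact (lt_collisionBound hn).le
  · filter_upwards [eventually_ge_atTop 3] with n hn
    have : (0 : ℝ) < n := by exact_mod_cast (by omega : 0 < n)
    rw [div_le_iff₀ (by positivity)]
    refine (collisionBound_le n).trans_eq ?_
    field_simp
    ring

theorem collisionBound_le_maxCollisions {n d : ℕ} (hn : 3 ≤ n) (hd : 2 ≤ d) :
    (collisionBound n : ℕ∞) ≤ maxCollisions n d := by
  have bound : ∀ m c : ℕ, 0 < m → n = 2 * m + c →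
      (collisionBound n : ℝ) ≤ m * (2 * m - 1) + c * (m * (m + 1)) →
      (collisionBound n : ℕ∞) ≤ maxCollisions n d := by
    intro m c hm hmc h
    subst hmc
    refine le_trans ?_ (Ball.le_maxCollisions (c := c) hd hm)
    have : (collisionBound (2 * m + c) : ℝ) ≤ (m * (2 * m - 1) + c * (m * (m + 1)) : ℕ) := by
      push_cast [Nat.cast_sub (by omega : 1 ≤ 2 * m)]; exact h
    exact_mod_cast this
  obtain ⟨k, hk⟩ := exists_mod_three n
  obtain ⟨h0, h1, h2⟩ := collisionBound_cast k
  have hk1 : (1 : ℝ) ≤ k := by exact_mod_cast (by omega : 1 ≤ k)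
  rcases hk with rfl | rfl | rfl
  · exact bound k k (by omega) (by omega) (by rw [h0]; nlinarith)
  · exact bound k (k + 1) (by omega) (by omega) (by rw [h1]; push_cast; nlinarith)
  -- Here `m` is rounded up: chains of `k` balls with `k + 2` falling balls would fall short of the
  -- bound for small `k`, for example 7 against 9 when `k = 1`.
  · exact bound (k + 1) k (by omega) (by omega) (by rw [h2]; push_cast; nlinarith)

theorem theorem1 :
    (∀ n d : ℕ, 3 ≤ n → 2 ≤ d → (collisionBound n : ℕ∞) ≤ maxCollisions n d) ∧
    (∀ n : ℕ, 3 ≤ n → (n : ℝ) ^ 3 / 27 < (collisionBound n : ℝ)) ∧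
    Tendsto (fun n : ℕ => (collisionBound n : ℝ) / ((n : ℝ) ^ 3 / 27)) atTop (𝓝 1) :=
  ⟨fun _ _ hn hd => collisionBound_le_maxCollisions hn hd, fun _ hn => lt_collisionBound hn,
    tendsto_collisionBound⟩
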